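/- **Setting.** Let $\mathcal X$ be a measurable space and let $\mathcal H\subset\{0,1\}^{\mathcal X}$ be a nonempty class of finite VC dimension, such that for every $n$ and $b\in\{0,1\}^n$ the set $\{x\in\mathcal X^n:\exists h\in\mathcal H,\ h(x_i)=b_i\ \forall i\}$ is measurable. Let $\ell:[0,1]^2\to[0,\infty)$ be convex in its first argument and $L$-Lipschitz in each argument, $L>0$. In each round $t=1,\dots,T$ a feature $x_t\sim\mu_t$ is drawn independently, an adversary who knows everything so far picks $y_t\in[0,1]$, the learner sees $x_t$ and draws $\hat y_t\in[0,1]$ from $\Phi(x_1,\dots,x_t,y_1,\dots,y_{t-1})$, then $y_t$ is revealed. For a prediction rule $\Phi$ let $$\tilde r_{T,K}(\mathcal H,\Phi)=\sup_{\mu_1,\dots,\mu_T}\mathbb E_{x_1}\sup_{y_1}\mathbb E_{\hat y_1}\cdots\mathbb E_{x_T}\sup_{y_T}\mathbb E_{\hat y_T}\Big[\sum_{t=1}^T\ell(\hat y_t,y_t)-\inf_{h\in\mathcal H}\sum_{t=1}^T\ell(h(x_t),y_t)\Big],$$ where the supremum runs over all sequences of probability distributions on $\mathcal X$ with $\mu_t\neq\mu_{t+1}$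 for at most $K$ indices $t<T$ (the distributions and the change points are unknown to the learner), and $\mathbb E_{x_t}$ is the upper expectation whenever the integrand is not measurable. A mixed ERM oracle returns, for labelled samples $(x_i,y_i)_{i\le m}$, features $(z_j)_{j\le n}$, signs $\varepsilon_j\in\{\pm1\}$ and a weight $C\ge 0$, the value $\inf_{h\in\mathcal H}\{\sum_{i\le m}\ell(h(x_i),y_i)+C\sum_{j\le n}\varepsilon_jh(z_j)\}$. Programs are randomized real-RAM programs which draw uniform integers, evaluate $\ell$ in unit time, can only copy features or pass them to the oracle, and access $\mathcal H$ only through the oracle. **Statement.** There are a single such program, a polynomial $p$ and an absolute constant $C$ such that for all $\mathcal X,\mathcal H,\ell,L$ as above and all integers $T\ge2$, $K\ge1$ the following holds. Given $T,K,L$, the past pairs $(x_i,y_i)_{i<t}$ and $x_t$, the program draws $\hat y_t$ in at most $p(t)$ steps in every round $t$ (an oracle call costs one step plus the length of the query), and the prediction rule $\Phi$ that it computes satisfies $$\tilde r_{T,K}(\mathcal H,\Phi)\le C\,L\sqrt{\mathsf{VC}(\mathcal H)\,\log(\max\{1,L\}\,T)}\;K^{1/5}\,T^{4/5}.$$ 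-/

import Mathlib

open MeasureTheory

/-! ## Hybrid online learning: stochastic features, adversarial labels -/

namespace Hybrid

noncomputable section

/-- The interval `[0,1]` in which labels, predictions and hypothesis values lie. -/
abbrev I01 : Type := Set.Icc (0 : ℝ) 1

/-- The nearest point of `[0,1]`. -/
def clamp (r : ℝ) : I01 := Set.projIcc 0 1 zero_le_one r

/-- `ℓ : [0,1]² → ℝ⁺` is convex in its first argument and `L`-Lipschitz in both arguments
(only the values of `ℓ` on `[0,1]²` are constrained, and only these are ever used). -/
structure IsConvexLipschitzLoss (ℓ : ℝ → ℝ → ℝ) (L : ℝ) : Prop where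
  nonneg : ∀ p q : I01, 0 ≤ ℓ p q
  convex : ∀ q : I01, ConvexOn ℝ (Set.Icc (0 : ℝ) 1) (fun p => ℓ p q)
  lipschitz_left : ∀ p p' q : I01, |ℓ p q - ℓ p' q| ≤ L * |(p : ℝ) - p'|
  lipschitz_right : ∀ p q q' : I01, |ℓ p q - ℓ p q'| ≤ L * |(q : ℝ) - q'|

variable {X : Type*}

/-- The class takes only the values `0` and `1`. -/
def BinaryValued (H : Set (X → I01)) : Prop :=
  ∀ h ∈ H, ∀ x, h x = 0 ∨ h x = 1

/-- `H` shatters the finite set `S`: every subset of `S` is cut out by some `h ∈ H`. -/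
def Shatters (H : Set (X → I01)) (S : Finset X) : Prop :=
  ∀ A ⊆ S, ∃ h ∈ H, ∀ x ∈ S, h x = 1 ↔ x ∈ A

/-- The Vapnik–Chervonenkis dimension of a binary class. -/
def vcDim (H : Set (X → I01)) : ℕ∞ :=
  ⨆ (S : Finset X) (_ : Shatters H S), (S.card : ℕ∞)

/-- Measurability convention for a binary class: for every pattern `b ∈ {0,1}ⁿ`, the set of
`n`-tuples of features on which some hypothesis realises the pattern `b` is measurable.
(Equivalently, all infima over `H` of functions of `h x₁, …, h xₙ` are measurable in
`(x₁, …, xₙ)`. It holds for countable classes of measurable functions and, more generally, for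
pointwise measurable classes.) -/
def TraceMeasurable [MeasurableSpace X] (H : Set (X → I01)) : Prop :=
  ∀ (n : ℕ) (b : Fin n → I01), (∀ i, b i = 0 ∨ b i = 1) →
    MeasurableSet {x : Fin n → X | ∃ h ∈ H, ∀ i, h (x i) = b i}

/-! ### The game and its minimax regret -/

/-- A prediction rule: from the past feature/label pairs and the current feature it produces a
(discrete) distribution of the prediction. -/
abbrev PredictionRule (X : Type*) : Type _ := List (X × I01) → X → PMF I01

/-- Expectation of `f` under a discrete distribution. -/
def pmfExp {α : Type*} (p : PMF α) (f : α → ℝ) : ℝ := ∑' a, (p a).toReal * f a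

/-- Upper expectation: the infimum of `∫ g ∂μ` over the integrable majorants `g` of `f`. It is the
ordinary expectation when `f` is integrable, and it spares us any
measurability question about the suprema over labels in the game below. -/
def upperExp [MeasurableSpace X] (μ : Measure X) (f : X → ℝ) : ℝ :=
  sInf {a : ℝ | ∃ g : X → ℝ, Integrable g μ ∧ (∀ x, f x ≤ g x) ∧ a = ∫ x, g x ∂μ}

/-- The value of the game with `n` rounds left, after the feature/label pairs `hist` (oldest first)
and the cumulative loss `c` of the learner. The next feature has law `μ hist.length`; then the
adversary picks the label (knowing everything so far), then the prediction is drawn: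
`E_{x} sup_{y} E_{ŷ} ⋯ [∑ ℓ(ŷ_t, y_t) - inf_h ∑ ℓ(h x_t, y_t)]`. -/
def gameValue [MeasurableSpace X] (ℓ : ℝ → ℝ → ℝ) (H : Set (X → I01)) (Φ : PredictionRule X)
    (μ : ℕ → ProbabilityMeasure X) : ℕ → List (X × I01) → ℝ → ℝ
  | 0, hist, c => c - ⨅ h : H, (hist.map fun p => ℓ ((h : X → I01) p.1) p.2).sum
  | n + 1, hist, c =>
      upperExp (μ hist.length : Measure X) fun x =>
        ⨆ y : I01, pmfExp (Φ hist x) fun p =>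
          gameValue ℓ H Φ μ n (hist ++ [(x, y)]) (c + ℓ p y)

/-- Among the laws `μ 0, …, μ (T-1)` of the features of the `T` rounds, at most `K` changes occur
from one round to the next. -/
def AtMostChanges [MeasurableSpace X] (μ : ℕ → ProbabilityMeasure X) (T K : ℕ) : Prop :=
  Set.ncard {t : ℕ | t + 1 < T ∧ μ t ≠ μ (t + 1)} ≤ K

/-- The hybrid minimax regret over `T` rounds, the supremum being over all sequences of feature
distributions with at most `K` changes (features are independent across rounds). -/
def minimaxRegret [MeasurableSpace X] (ℓ : ℝ → ℝ → ℝ) (H : Set (X → I01)) (Φ : PredictionRule X)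
    (T K : ℕ) : EReal :=
  ⨆ (μ : ℕ → ProbabilityMeasure X) (_ : AtMostChanges μ T K),
    ((gameValue ℓ H Φ μ T [] 0 : ℝ) : EReal)

/-! ### Randomised programs with access to a mixed ERM oracle

A program is a finite text in a structured imperative language. It works on finitely many arrays of
natural numbers, of reals and of features. Natural numbers may be added, subtracted (truncated) and
compared; reals may be added, subtracted, multiplied, divided and compared; features
are opaque and can only be copied and handed to the oracle. The hypothesis class is accessible only
through the mixed ERM oracle. -/

/-- Expressions of type natural number; `get a i` is the cell `i` of array `a`. -/
inductive NExp : Type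
  | const (n : ℕ)
  | get (a : ℕ) (i : NExp)
  | add (e f : NExp)
  | sub (e f : NExp)

/-- Expressions of type real number; `loss e f` is the loss of the prediction `e` for label `f`. -/
inductive RExp : Type
  | cast (e : NExp)
  | get (a : ℕ) (i : NExp)
  | add (e f : RExp)
  | sub (e f : RExp)
  | mul (e f : RExp)
  | div (e f : RExp)
  | loss (e f : RExp)

/-- Commands.
* `setN a i e`, `setR a i e`: write the value of `e` in the cell `i` of array `a`;
* `setX a i b j`: copy the cell `j` of the feature array `b` to the cell `i` of array `a`;
* `rand a i e`: write a uniformly random element of `{0, …, e}` in the cell `i` of array `a`;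
* `erm a i xs ys m zs ss n C`: call the mixed ERM oracle, write its answer in the cell `i` of the
  real array `a`; the query is made of the first `m` cells of the arrays `xs`, `ys` (labelled
  samples), the first `n` cells of the arrays `zs`, `ss` (features and signs), and the weight `C`;
* `iteN e f c d`, `iteR e f c d`: if `e ≤ f` then `c` else `d`;
* `loop v e c`: run `c` with cell `0` of the array `v` set to `0`, …, `e - 1` in turn. -/
inductive Cmd : Type
  | skip
  | setN (a : ℕ) (i e : NExp)
  | setR (a : ℕ) (i : NExp) (e : RExp)
  | setX (a : ℕ) (i : NExp) (b : ℕ) (j : NExp)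
  | rand (a : ℕ) (i e : NExp)
  | erm (a : ℕ) (i : NExp) (xs ys : ℕ) (m : NExp) (zs ss : ℕ) (n : NExp) (C : RExp)
  | seq (c d : Cmd)
  | iteN (e f : NExp) (c d : Cmd)
  | iteR (e f : RExp) (c d : Cmd)
  | loop (v : ℕ) (e : NExp) (c : Cmd)

/-- The contents of the memory. -/
structure Store (X : Type*) where
  nat : ℕ → ℕ → ℕ
  real : ℕ → ℕ → ℝ
  feat : ℕ → ℕ → X

/-- Overwrite one cell of a family of arrays. -/
def setCell {α : Type*} (m : ℕ → ℕ → α) (a i : ℕ) (v : α) : ℕ → ℕ → α :=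
  Function.update m a (Function.update (m a) i v)

/-- Write `v` in the cell `i` of the natural-number array `a`. -/
def Store.setNat (s : Store X) (a i v : ℕ) : Store X := { s with nat := setCell s.nat a i v }

/-- Write `v` in the cell `i` of the real array `a`. -/
def Store.setReal (s : Store X) (a i : ℕ) (v : ℝ) : Store X :=
  { s with real := setCell s.real a i v }

/-- Write `v` in the cell `i` of the feature array `a`. -/
def Store.setFeat (s : Store X) (a i : ℕ) (v : X) : Store X :=
  { s with feat := setCell s.feat a i v }

/-- Value of a natural-number expression. -/
def NExp.eval (s : Store X) : NExp → ℕ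
  | .const n => n
  | .get a i => s.nat a (i.eval s)
  | .add e f => e.eval s + f.eval s
  | .sub e f => e.eval s - f.eval s

/-- Value of a real expression. -/
def RExp.eval (ℓ : ℝ → ℝ → ℝ) (s : Store X) : RExp → ℝ
  | .cast e => (e.eval s : ℝ)
  | .get a i => s.real a (i.eval s)
  | .add e f => e.eval ℓ s + f.eval ℓ s
  | .sub e f => e.eval ℓ s - f.eval ℓ s
  | .mul e f => e.eval ℓ s * f.eval ℓ s
  | .div e f => e.eval ℓ s / f.eval ℓ s
  | .loss e f => ℓ (clamp (e.eval ℓ s)) (clamp (f.eval ℓ s))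

/-- The mixed ERM oracle: `inf_{h ∈ H} ∑_{i<m} ℓ(h(x_i), y_i) + C ∑_{j<n} ε_j h(z_j)`. -/
def mixedERM (ℓ : ℝ → ℝ → ℝ) (H : Set (X → I01)) (m : ℕ) (x : ℕ → X) (y : ℕ → I01)
    (n : ℕ) (z : ℕ → X) (ε : ℕ → SignType) (C : ℝ) : ℝ :=
  ⨅ h : H, ((∑ i ∈ Finset.range m, ℓ ((h : X → I01) (x i)) (y i))
    + C * ∑ j ∈ Finset.range n, ((ε j : ℤ) : ℝ) * ((h : X → I01) (z j) : ℝ))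

/-- The sign `±1` that a real memory cell stands for in an oracle query. -/
def signOf (r : ℝ) : SignType := if 0 ≤ r then 1 else -1

/-- Iterate a randomised, timed step `n` times, starting from the store `s`; every iteration costs
one time unit on top of the time of its body. -/
def iterate (step : ℕ → Store X → PMF (Store X × ℕ)) (s : Store X) : ℕ → PMF (Store X × ℕ)
  | 0 => PMF.pure (s, 1)
  | n + 1 => (iterate step s n).bind fun p =>
      (step n p.1).map fun q => (q.1, p.2 + q.2 + 1)

/-- Semantics of a command: the joint distribution of the final store and of the running time.
Every elementary command takes one time unit, an oracle query one time unit plus the length of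
the query. -/
def Cmd.exec (ℓ : ℝ → ℝ → ℝ) (H : Set (X → I01)) : Cmd → Store X → PMF (Store X × ℕ)
  | .skip, s => PMF.pure (s, 1)
  | .setN a i e, s => PMF.pure (s.setNat a (i.eval s) (e.eval s), 1)
  | .setR a i e, s => PMF.pure (s.setReal a (i.eval s) (e.eval ℓ s), 1)
  | .setX a i b j, s => PMF.pure (s.setFeat a (i.eval s) (s.feat b (j.eval s)), 1)
  | .rand a i e, s => (PMF.uniformOfFintype (Fin (e.eval s + 1))).map fun k =>
      (s.setNat a (i.eval s) k, 1)
  | .erm a i xs ys m zs ss n C, s =>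
      PMF.pure
        (s.setReal a (i.eval s)
          (mixedERM ℓ H (m.eval s) (s.feat xs) (fun k => clamp (s.real ys k))
            (n.eval s) (s.feat zs) (fun k => signOf (s.real ss k)) (max (C.eval ℓ s) 0)),
          1 + m.eval s + n.eval s)
  | .seq c d, s => (c.exec ℓ H s).bind fun p =>
      (d.exec ℓ H p.1).map fun q => (q.1, p.2 + q.2)
  | .iteN e f c d, s =>
      (if e.eval s ≤ f.eval s then c.exec ℓ H s else d.exec ℓ H s).map fun q => (q.1, q.2 + 1)
  | .iteR e f c d, s =>
      open Classical in
      (if e.eval ℓ s ≤ f.eval ℓ s then c.exec ℓ H s else d.exec ℓ H s).map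
        fun q => (q.1, q.2 + 1)
  | .loop v e c, s =>
      iterate (fun k s' => c.exec ℓ H (s'.setNat v 0 k)) s (e.eval s)

/-- The initial memory in round `t = hist.length + 1`. Cells `0, 1, 2` of the natural-number array
`0` hold the horizon `T`, the number `K` of changes and the number `t - 1` of past rounds; cell
`0` of the real array `0` holds the Lipschitz constant `L`; the real array `1` starts with
`y_1, …, y_{t-1}`; the feature array `0` starts with `x_1, …, x_t`. All other cells
hold `0` or the current feature `x_t`. -/
def initStore (T K : ℕ) (L : ℝ) (hist : List (X × I01)) (x : X) : Store X where
  nat a i := if a = 0 then (if i = 0 then T else if i = 1 then K else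
    if i = 2 then hist.length else 0) else 0
  real a i := if a = 0 then (if i = 0 then L else 0) else
    if a = 1 then ((hist.map fun p => (p.2 : ℝ)).getD i 0) else 0
  feat a i := if a = 0 then ((hist.map Prod.fst).getD i x) else x

/-- One run of the program in the round following the history `hist`, with current feature `x`. -/
def Cmd.run (P : Cmd) (ℓ : ℝ → ℝ → ℝ) (H : Set (X → I01)) (T K : ℕ) (L : ℝ)
    (hist : List (X × I01)) (x : X) : PMF (Store X × ℕ) :=
  P.exec ℓ H (initStore T K L hist x)

/-- The prediction rule computed by a program: its prediction is read in cell `1` of the real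
array `0`. -/
def Cmd.rule (P : Cmd) (ℓ : ℝ → ℝ → ℝ) (H : Set (X → I01)) (T K : ℕ) (L : ℝ) :
    PredictionRule X :=
  fun hist x => (P.run ℓ H T K L hist x).map fun q => clamp (q.1.real 0 1)

/-- The program is oracle-efficient with time bound `p`: in round `t`, whatever the history and the
random draws, it stops within `p(t)` time units. -/
def Cmd.RunsWithin (P : Cmd) (p : Polynomial ℕ) (ℓ : ℝ → ℝ → ℝ) (H : Set (X → I01))
    (T K : ℕ) (L : ℝ) : Prop :=
  ∀ (hist : List (X × I01)) (x : X), ∀ q ∈ (P.run ℓ H T K L hist x).support,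
    q.2 ≤ p.eval (hist.length + 1)

end

end Hybrid

/-! ### Perturbed least losses and the one-round inequality -/

namespace Hybrid

noncomputable section

variable {X : Type*}

/-! The learner is a follow-the-perturbed-leader scheme with random playout. Time is cut into blocks
of length `s`, and the `s ^ 2` features before a block form its pool. In a round `t ≥ s ^ 2` the
unseen features of the block are imitated by uniform draws from the pool with random signs; two
oracle calls compare the least perturbed losses with the current feature weighted by `+L` and by
`-L`, and their difference divided by `2L` is the prediction.

The regret is followed by a potential: minus the least loss on the finished blocks, minus the mean
least perturbed loss on the current one. For each fixed draw, `loss_prediction_add_probe_le` says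
that the loss suffered plus the sign-averaged least loss (`probe`) is at most the new least loss,
whatever the label. Inside a block the potential therefore only increases because a fresh feature
takes the place of a pool draw. At the start of a block the perturbations are worth about `L * √(d s
log s)`, by the Sauer–Shelah count of traces and Massart's argument (`card_traces_le`,
`neg_avgDraws_minLoss_le`). Blocks combine because least losses are superadditive.

Replacing a pool draw by a fresh feature costs the deviation of the empirical mean of `probe` over
the pool from its true mean. The labels may depend on the pool, so the deviation has to be
controlled for all labellings of the block at once: it is bounded by a log-sum-exp over a finite
grid of labellings, whose exponential moment is bounded by Hoeffding's lemma after the few pool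
features that were drawn are set aside (`avgDraws_deviation_le`, `lmarginal_exp_deviation_le`). The
bound is linear in a cost that depends on features only, so the expectation of all later costs
(`futureCost`) can be added to the potential. `gameValue_le` turns such a potential into a bound for
the game.

The deviation bound needs the pool to have the law of the round. A change of law spoils at most `s ^
2 + s` rounds, the first `s ^ 2` rounds have no pool, and such a round costs at most an extra `L`.
Up to constants the total is `L * T * √(d log T / s) + L * K * s ^ 2`, and `s ≈ (T / K) ^ (2 / 5)`
balances the two terms. The remainder verifies a concrete program against this rule; dimension zero
is treated apart, since the bound is then `0`. -/

/-- The real number `±1` attached to a boolean. -/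
def sgn (b : Bool) : ℝ := if b then 1 else -1

lemma abs_sgn_mul_le (b : Bool) (p : I01) : |sgn b * (p : ℝ)| ≤ 1 := by
  have h0 := p.2.1
  have h1 := p.2.2
  cases b <;> simp [sgn, abs_le] <;> constructor <;> linarith

/-- Loss accumulated by the values `v` on the rounds `a, …, b - 1` with labels `υ`, perturbed by
the random signs listed in `l`. -/
def perturbedLoss (ℓ : ℝ → ℝ → ℝ) (L : ℝ) (υ : ℕ → I01) (a b : ℕ) (l : List (ℕ × Bool))
    (v : ℕ → I01) : ℝ :=
  ∑ i ∈ Finset.Ico a b, ℓ (v i) (υ i) + L * (l.map fun p => sgn p.2 * (v p.1 : ℝ)).sum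

/-- Least perturbed loss of a hypothesis on the features `ω`. -/
def minLoss (H : Set (X → I01)) (ℓ : ℝ → ℝ → ℝ) (L : ℝ) (υ : ℕ → I01) (a b : ℕ)
    (l : List (ℕ × Bool)) (ω : ℕ → X) : ℝ :=
  ⨅ h : H, perturbedLoss ℓ L υ a b l fun i => (h : X → I01) (ω i)

/-- Least perturbed loss when the additional feature `x` is perturbed with sign `ε`. -/
def minLossAt (H : Set (X → I01)) (ℓ : ℝ → ℝ → ℝ) (L : ℝ) (υ : ℕ → I01) (a b : ℕ)
    (l : List (ℕ × Bool)) (ε : Bool) (x : X) (ω : ℕ → X) : ℝ :=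
  ⨅ h : H, (perturbedLoss ℓ L υ a b l (fun i => (h : X → I01) (ω i))
    + L * (sgn ε * ((h : X → I01) x : ℝ)))

/-- Average of `minLossAt` over the sign. -/
def probe (H : Set (X → I01)) (ℓ : ℝ → ℝ → ℝ) (L : ℝ) (υ : ℕ → I01) (a b : ℕ)
    (l : List (ℕ × Bool)) (x : X) (ω : ℕ → X) : ℝ :=
  (minLossAt H ℓ L υ a b l true x ω + minLossAt H ℓ L υ a b l false x ω) / 2

/-- The prediction made at feature `x` by a learner which has drawn the perturbation `l`. -/
def prediction (H : Set (X → I01)) (ℓ : ℝ → ℝ → ℝ) (L : ℝ) (υ : ℕ → I01) (a b : ℕ)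
    (l : List (ℕ × Bool)) (x : X) (ω : ℕ → X) : ℝ :=
  (minLossAt H ℓ L υ a b l true x ω - minLossAt H ℓ L υ a b l false x ω) / (L + L)

section basics

variable {H : Set (X → I01)} {ℓ : ℝ → ℝ → ℝ} {L : ℝ}

lemma abs_sum_sgn_le (l : List (ℕ × Bool)) (v : ℕ → I01) :
    |(l.map fun p => sgn p.2 * (v p.1 : ℝ)).sum| ≤ l.length := by
  induction l with
  | nil => simp
  | cons p l ih =>
    simp only [List.map_cons, List.sum_cons, List.length_cons, Nat.cast_add, Nat.cast_one]
    have := abs_add_le (sgn p.2 * (v p.1 : ℝ)) (l.map fun p => sgn p.2 * (v p.1 : ℝ)).sum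
    have := abs_sgn_mul_le p.2 (v p.1)
    linarith

lemma neg_le_perturbedLoss (hL : 0 < L) (hℓ : IsConvexLipschitzLoss ℓ L) (υ : ℕ → I01) (a b : ℕ)
    (l : List (ℕ × Bool)) (v : ℕ → I01) : -(L * l.length) ≤ perturbedLoss ℓ L υ a b l v := by
  have h1 : 0 ≤ ∑ i ∈ Finset.Ico a b, ℓ (v i) (υ i) := Finset.sum_nonneg fun i _ => hℓ.nonneg _ _
  have h2 := (abs_le.1 (abs_sum_sgn_le l v)).1
  have := mul_le_mul_of_nonneg_left h2 hL.le
  unfold perturbedLoss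
  linarith

lemma bddBelow_perturbedLoss (hL : 0 < L) (hℓ : IsConvexLipschitzLoss ℓ L) (υ : ℕ → I01)
    (a b : ℕ) (l : List (ℕ × Bool)) (ω : ℕ → X) :
    BddBelow (Set.range fun h : H => perturbedLoss ℓ L υ a b l fun i => (h : X → I01) (ω i)) :=
  ⟨-(L * l.length), by rintro _ ⟨h, rfl⟩; exact neg_le_perturbedLoss hL hℓ _ _ _ _ _⟩

lemma bddBelow_perturbedLossAt (hL : 0 < L) (hℓ : IsConvexLipschitzLoss ℓ L) (υ : ℕ → I01)
    (a b : ℕ) (l : List (ℕ × Bool)) (ε : Bool) (x : X) (ω : ℕ → X) :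
    BddBelow (Set.range fun h : H => perturbedLoss ℓ L υ a b l (fun i => (h : X → I01) (ω i))
      + L * (sgn ε * ((h : X → I01) x : ℝ))) :=
  ⟨-(L * l.length) - L, by
    rintro _ ⟨h, rfl⟩
    have := neg_le_perturbedLoss hL hℓ υ a b l fun i => (h : X → I01) (ω i)
    have h2 := mul_le_mul_of_nonneg_left (abs_le.1 (abs_sgn_mul_le ε ((h : X → I01) x))).1 hL.le
    dsimp only
    linarith⟩

lemma minLoss_le (hL : 0 < L) (hℓ : IsConvexLipschitzLoss ℓ L) (υ : ℕ → I01) (a b : ℕ)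
    (l : List (ℕ × Bool)) (ω : ℕ → X) {h : X → I01} (hh : h ∈ H) :
    minLoss H ℓ L υ a b l ω ≤ perturbedLoss ℓ L υ a b l fun i => h (ω i) :=
  ciInf_le (bddBelow_perturbedLoss hL hℓ υ a b l ω) (⟨h, hh⟩ : H)

lemma minLossAt_le (hL : 0 < L) (hℓ : IsConvexLipschitzLoss ℓ L) (υ : ℕ → I01) (a b : ℕ)
    (l : List (ℕ × Bool)) (ε : Bool) (x : X) (ω : ℕ → X) {h : X → I01} (hh : h ∈ H) :
    minLossAt H ℓ L υ a b l ε x ω ≤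
      perturbedLoss ℓ L υ a b l (fun i => h (ω i)) + L * (sgn ε * (h x : ℝ)) :=
  ciInf_le (bddBelow_perturbedLossAt hL hℓ υ a b l ε x ω) (⟨h, hh⟩ : H)

lemma le_minLoss (hH : H.Nonempty) {υ : ℕ → I01} {a b : ℕ} {l : List (ℕ × Bool)} {ω : ℕ → X}
    {c : ℝ} (h : ∀ h ∈ H, c ≤ perturbedLoss ℓ L υ a b l fun i => h (ω i)) :
    c ≤ minLoss H ℓ L υ a b l ω := by
  have := hH.to_subtype
  exact le_ciInf fun h' => h h'.1 h'.2

lemma le_minLossAt (hH : H.Nonempty) {υ : ℕ → I01} {a b : ℕ} {l : List (ℕ × Bool)} {ε : Bool}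
    {x : X} {ω : ℕ → X} {c : ℝ}
    (h : ∀ h ∈ H, c ≤ perturbedLoss ℓ L υ a b l (fun i => h (ω i)) + L * (sgn ε * (h x : ℝ))) :
    c ≤ minLossAt H ℓ L υ a b l ε x ω := by
  have := hH.to_subtype
  exact le_ciInf fun h' => h h'.1 h'.2

/-- A draw put at the head of the list plays the role of the current feature. This is what lets a
pool draw and a true feature be exchanged. -/
lemma minLoss_cons (υ : ℕ → I01) (a b : ℕ) (i : ℕ) (ε : Bool) (l : List (ℕ × Bool)) (ω : ℕ → X) :
    minLoss H ℓ L υ a b ((i, ε) :: l) ω = minLossAt H ℓ L υ a b l ε (ω i) ω := by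
  unfold minLoss minLossAt perturbedLoss
  congr 1
  ext h
  simp only [List.map_cons, List.sum_cons]
  ring

/-- The extra term lies in `[0, L]` for every hypothesis, so the infimum moves by at most that. With
the analogue for the other sign, this puts the prediction in `[0, 1]`. -/
lemma minLossAt_true_mem (hH : H.Nonempty) (hL : 0 < L) (hℓ : IsConvexLipschitzLoss ℓ L)
    (υ : ℕ → I01) (a b : ℕ) (l : List (ℕ × Bool)) (x : X) (ω : ℕ → X) :
    minLossAt H ℓ L υ a b l true x ω ∈
      Set.Icc (minLoss H ℓ L υ a b l ω) (minLoss H ℓ L υ a b l ω + L) := by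
  constructor
  · refine le_minLossAt hH fun h hh => (minLoss_le hL hℓ υ a b l ω hh).trans ?_
    have := mul_nonneg hL.le (h x).2.1
    simp only [sgn, if_true, one_mul]
    linarith
  · rw [← sub_le_iff_le_add]
    refine le_minLoss hH fun h hh => ?_
    have h1 := minLossAt_le hL hℓ υ a b l true x ω hh
    have := mul_le_mul_of_nonneg_left (h x).2.2 hL.le
    simp only [sgn, if_true, one_mul] at h1
    linarith

lemma minLossAt_false_mem (hH : H.Nonempty) (hL : 0 < L) (hℓ : IsConvexLipschitzLoss ℓ L)
    (υ : ℕ → I01) (a b : ℕ) (l : List (ℕ × Bool)) (x : X) (ω : ℕ → X) :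
    minLossAt H ℓ L υ a b l false x ω ∈
      Set.Icc (minLoss H ℓ L υ a b l ω - L) (minLoss H ℓ L υ a b l ω) := by
  constructor
  · refine le_minLossAt hH fun h hh => ?_
    have h1 := minLoss_le hL hℓ υ a b l ω hh
    have := mul_le_mul_of_nonneg_left (h x).2.2 hL.le
    simp only [sgn, Bool.false_eq_true, if_false]
    linarith
  · refine le_minLoss hH fun h hh => ?_
    have h1 := minLossAt_le hL hℓ υ a b l false x ω hh
    have := mul_nonneg hL.le (h x).2.1
    simp only [sgn, Bool.false_eq_true, if_false] at h1
    linarith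

/-- The window has width `L` and its centre does not depend on `x`: this is the oscillation that
enters Hoeffding's lemma. -/
lemma probe_mem (hH : H.Nonempty) (hL : 0 < L) (hℓ : IsConvexLipschitzLoss ℓ L)
    (υ : ℕ → I01) (a b : ℕ) (l : List (ℕ × Bool)) (x : X) (ω : ℕ → X) :
    probe H ℓ L υ a b l x ω ∈
      Set.Icc (minLoss H ℓ L υ a b l ω - L / 2) (minLoss H ℓ L υ a b l ω + L / 2) := by
  obtain ⟨h1, h2⟩ := minLossAt_true_mem hH hL hℓ υ a b l x ω
  obtain ⟨h3, h4⟩ := minLossAt_false_mem hH hL hℓ υ a b l x ω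
  constructor <;> unfold probe <;> linarith

/-- Averaging over the sign of a perturbation can only decrease the least loss. -/
lemma probe_le_minLoss (hH : H.Nonempty) (hL : 0 < L) (hℓ : IsConvexLipschitzLoss ℓ L)
    (υ : ℕ → I01) (a b : ℕ) (l : List (ℕ × Bool)) (x : X) (ω : ℕ → X) :
    probe H ℓ L υ a b l x ω ≤ minLoss H ℓ L υ a b l ω := by
  refine le_minLoss hH fun h hh => ?_
  have h1 := minLossAt_le hL hℓ υ a b l true x ω hh
  have h2 := minLossAt_le hL hℓ υ a b l false x ω hh
  simp only [sgn, Bool.false_eq_true, if_false, if_true] at h1 h2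
  unfold probe
  linarith

lemma prediction_mem (hH : H.Nonempty) (hL : 0 < L) (hℓ : IsConvexLipschitzLoss ℓ L)
    (υ : ℕ → I01) (a b : ℕ) (l : List (ℕ × Bool)) (x : X) (ω : ℕ → X) :
    prediction H ℓ L υ a b l x ω ∈ Set.Icc (0 : ℝ) 1 := by
  obtain ⟨h1, h2⟩ := minLossAt_true_mem hH hL hℓ υ a b l x ω
  obtain ⟨h3, h4⟩ := minLossAt_false_mem hH hL hℓ υ a b l x ω
  unfold prediction
  constructor
  · apply div_nonneg <;> linarith
  · rw [div_le_one (by linarith)]; linarith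

lemma coe_clamp {r : ℝ} (hr : r ∈ Set.Icc (0 : ℝ) 1) : ((clamp r : I01) : ℝ) = r := by
  unfold clamp
  rw [Set.projIcc_of_mem _ hr]

lemma perturbedLoss_congr {υ υ' : ℕ → I01} {a b : ℕ} {l : List (ℕ × Bool)} {v v' : ℕ → I01}
    (h1 : ∀ i ∈ Finset.Ico a b, v i = v' i) (h2 : ∀ i ∈ Finset.Ico a b, υ i = υ' i)
    (h3 : ∀ p ∈ l, v p.1 = v' p.1) :
    perturbedLoss ℓ L υ a b l v = perturbedLoss ℓ L υ' a b l v' := by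
  unfold perturbedLoss
  congr 1
  · exact Finset.sum_congr rfl fun i hi => by rw [h1 i hi, h2 i hi]
  · congr 2
    exact List.map_congr_left fun p hp => by rw [h3 p hp]

lemma minLoss_congr {υ υ' : ℕ → I01} {a b : ℕ} {l : List (ℕ × Bool)} {ω ω' : ℕ → X}
    (h1 : ∀ i ∈ Finset.Ico a b, ω i = ω' i) (h2 : ∀ i ∈ Finset.Ico a b, υ i = υ' i)
    (h3 : ∀ p ∈ l, ω p.1 = ω' p.1) :
    minLoss H ℓ L υ a b l ω = minLoss H ℓ L υ' a b l ω' := by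
  unfold minLoss
  congr 1
  ext h
  exact perturbedLoss_congr (fun i hi => by rw [h1 i hi]) h2 (fun i hi => by rw [h3 i hi])

lemma minLossAt_congr {υ υ' : ℕ → I01} {a b : ℕ} {l : List (ℕ × Bool)} {ε : Bool} {x : X}
    {ω ω' : ℕ → X}
    (h1 : ∀ i ∈ Finset.Ico a b, ω i = ω' i) (h2 : ∀ i ∈ Finset.Ico a b, υ i = υ' i)
    (h3 : ∀ p ∈ l, ω p.1 = ω' p.1) :
    minLossAt H ℓ L υ a b l ε x ω = minLossAt H ℓ L υ' a b l ε x ω' := by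
  unfold minLossAt
  congr 1
  ext h
  rw [perturbedLoss_congr (fun i hi => by rw [h1 i hi]) h2 (fun i hi => by rw [h3 i hi])]

/-- Apart from its argument `x`, the quantity reads only the features of the block and the drawn
ones; resampling an undrawn pool feature leaves it unchanged. -/
lemma probe_congr {υ υ' : ℕ → I01} {a b : ℕ} {l : List (ℕ × Bool)} {x : X} {ω ω' : ℕ → X}
    (h1 : ∀ i ∈ Finset.Ico a b, ω i = ω' i) (h2 : ∀ i ∈ Finset.Ico a b, υ i = υ' i)
    (h3 : ∀ p ∈ l, ω p.1 = ω' p.1) :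
    probe H ℓ L υ a b l x ω = probe H ℓ L υ' a b l x ω' := by
  unfold probe
  rw [minLossAt_congr h1 h2 h3, minLossAt_congr h1 h2 h3]

lemma prediction_congr {υ υ' : ℕ → I01} {a b : ℕ} {l : List (ℕ × Bool)} {x : X} {ω ω' : ℕ → X}
    (h1 : ∀ i ∈ Finset.Ico a b, ω i = ω' i) (h2 : ∀ i ∈ Finset.Ico a b, υ i = υ' i)
    (h3 : ∀ p ∈ l, ω p.1 = ω' p.1) :
    prediction H ℓ L υ a b l x ω = prediction H ℓ L υ' a b l x ω' := by
  unfold prediction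
  rw [minLossAt_congr h1 h2 h3, minLossAt_congr h1 h2 h3]

lemma perturbedLoss_succ (υ : ℕ → I01) {a t : ℕ} (ha : a ≤ t) (l : List (ℕ × Bool))
    (v : ℕ → I01) :
    perturbedLoss ℓ L υ a (t + 1) l v = perturbedLoss ℓ L υ a t l v + ℓ (v t) (υ t) := by
  unfold perturbedLoss
  rw [Finset.sum_Ico_succ_top ha]
  ring

lemma perturbedLoss_update (υ : ℕ → I01) {a t : ℕ} (ha : a ≤ t) {l : List (ℕ × Bool)}
    (hl : ∀ p ∈ l, p.1 ≠ t) (h : X → I01) (ω : ℕ → X) (x : X) (y : I01) :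
    perturbedLoss ℓ L (Function.update υ t y) a (t + 1) l
      (fun i => h (Function.update ω t x i)) =
    perturbedLoss ℓ L υ a t l (fun i => h (ω i)) + ℓ (h x) y := by
  rw [perturbedLoss_succ _ ha]
  simp only [Function.update_self]
  congr 1
  refine perturbedLoss_congr (fun i hi => ?_) (fun i hi => ?_) (fun p hp => ?_)
  · rw [Function.update_of_ne (Finset.mem_Ico.1 hi).2.ne]
  · rw [Function.update_of_ne (Finset.mem_Ico.1 hi).2.ne]
  · rw [Function.update_of_ne (hl p hp)]

/-- The loss of the prediction is paid for by the decrease of the averaged least loss. -/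
lemma loss_prediction_add_probe_le (hH : H.Nonempty) (hB : BinaryValued H) (hL : 0 < L)
    (hℓ : IsConvexLipschitzLoss ℓ L) (υ : ℕ → I01) {a t : ℕ} (ha : a ≤ t)
    {l : List (ℕ × Bool)} (hl : ∀ p ∈ l, p.1 ≠ t) (ω : ℕ → X) (x : X) (y : I01) :
    ℓ (clamp (prediction H ℓ L υ a t l x ω)) y + probe H ℓ L υ a t l x ω ≤
      minLoss H ℓ L (Function.update υ t y) a (t + 1) l (Function.update ω t x) := by
  refine le_minLoss hH fun h hh => ?_
  rw [perturbedLoss_update υ ha hl]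
  have h1 := minLossAt_le hL hℓ υ a t l true x ω hh
  have h2 := minLossAt_le hL hℓ υ a t l false x ω hh
  have hp := prediction_mem hH hL hℓ υ a t l x ω
  have hlip := (abs_le.1 (hℓ.lipschitz_left (clamp (prediction H ℓ L υ a t l x ω)) (h x) y)).2
  rw [coe_clamp hp] at hlip ⊢
  have hpe : L * prediction H ℓ L υ a t l x ω =
      (minLossAt H ℓ L υ a t l true x ω - minLossAt H ℓ L υ a t l false x ω) / 2 := by
    unfold prediction; field_simp; ring
  simp only [sgn, Bool.false_eq_true, if_false, if_true] at h1 h2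
  unfold probe
  -- With `p` the prediction, `L * p` is half the difference of the two least losses and `probe`
  -- half their sum. If `h x = 0`, then `L * p + probe` is the value for `+`, to which `h`
  -- contributes nothing at `x`; if `h x = 1`, then `L * (1 - p) + probe` is `L` plus the value for
  -- `-`, where `h` gains `L`. The prediction equalises the two cases.
  rcases hB h hh x with hx | hx <;> rw [hx] at hlip h1 h2 ⊢ <;>
    simp only [Set.Icc.coe_zero, Set.Icc.coe_one, sub_zero] at hlip h1 h2 ⊢
  · rw [abs_of_nonneg hp.1] at hlip
    linarith
  · rw [abs_of_nonpos (by linarith [hp.2])] at hlip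
    linarith

/-- One round costs at most `L` more than a round of the best hypothesis. -/
lemma loss_add_minLoss_le (hH : H.Nonempty) (hL : 0 < L)
    (hℓ : IsConvexLipschitzLoss ℓ L) (υ : ℕ → I01) {a t : ℕ} (ha : a ≤ t)
    {l : List (ℕ × Bool)} (hl : ∀ p ∈ l, p.1 ≠ t) (ω : ℕ → X) (x : X) (p y : I01) :
    ℓ p y + minLoss H ℓ L υ a t l ω ≤
      minLoss H ℓ L (Function.update υ t y) a (t + 1) l (Function.update ω t x) + L := by
  rw [← sub_le_iff_le_add]
  refine le_minLoss hH fun h hh => ?_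
  rw [perturbedLoss_update υ ha hl]
  have h1 := minLoss_le hL hℓ υ a t l ω hh
  have hlip := (abs_le.1 (hℓ.lipschitz_left p (h x) y)).2
  have : |(p : ℝ) - h x| ≤ 1 := by
    have := p.2.1; have := p.2.2; have := (h x).2.1; have := (h x).2.2
    rw [abs_le]; constructor <;> linarith
  have := mul_le_mul_of_nonneg_left this hL.le
  linarith

/-- A single hypothesis serving both intervals does no better than the best one on each. Regret
against the whole past is thus bounded block by block. -/
lemma minLoss_add_minLoss_le (hH : H.Nonempty) (hL : 0 < L)
    (hℓ : IsConvexLipschitzLoss ℓ L) (υ : ℕ → I01) {a b c : ℕ} (hab : a ≤ b) (hbc : b ≤ c)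
    (ω : ℕ → X) :
    minLoss H ℓ L υ a b [] ω + minLoss H ℓ L υ b c [] ω ≤ minLoss H ℓ L υ a c [] ω := by
  refine le_minLoss hH fun h hh => ?_
  refine (add_le_add (minLoss_le hL hℓ υ a b [] ω hh) (minLoss_le hL hℓ υ b c [] ω hh)).trans ?_
  simp only [perturbedLoss, List.map_nil, List.sum_nil, mul_zero, add_zero]
  rw [Finset.sum_Ico_consecutive _ hab hbc]

/-- The averaged least loss is a Lipschitz function of the labels. -/
lemma abs_probe_sub_le (hH : H.Nonempty) (hL : 0 < L) (hℓ : IsConvexLipschitzLoss ℓ L)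
    {υ υ' : ℕ → I01} {a b : ℕ} (l : List (ℕ × Bool)) (x : X) (ω : ℕ → X) {δ : ℝ}
    (hδ : ∀ i ∈ Finset.Ico a b, |(υ i : ℝ) - υ' i| ≤ δ) :
    probe H ℓ L υ a b l x ω ≤ probe H ℓ L υ' a b l x ω + (b - a : ℕ) * (L * δ) := by
  have key : ∀ ε, minLossAt H ℓ L υ a b l ε x ω ≤
      minLossAt H ℓ L υ' a b l ε x ω + (b - a : ℕ) * (L * δ) := by
    intro ε
    rw [← sub_le_iff_le_add]
    refine le_minLossAt hH fun h hh => ?_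
    have h1 := minLossAt_le hL hℓ υ a b l ε x ω hh
    have h2 : ∑ i ∈ Finset.Ico a b, ℓ (h (ω i)) (υ i) ≤
        ∑ i ∈ Finset.Ico a b, ℓ (h (ω i)) (υ' i) + (b - a : ℕ) * (L * δ) := by
      have : ∀ i ∈ Finset.Ico a b, ℓ (h (ω i)) (υ i) ≤ ℓ (h (ω i)) (υ' i) + L * δ := by
        intro i hi
        have h3 := (abs_le.1 (hℓ.lipschitz_right (h (ω i)) (υ i) (υ' i))).2
        have := mul_le_mul_of_nonneg_left (hδ i hi) hL.le
        linarith
      refine (Finset.sum_le_sum this).trans_eq ?_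
      rw [Finset.sum_add_distrib, Finset.sum_const, Nat.card_Ico, nsmul_eq_mul]
    unfold perturbedLoss at h1 ⊢
    linarith
  have := key true
  have := key false
  unfold probe
  linarith

end basics

/-! ### Averages over random perturbations -/

/-- Average of `φ` over lists of `k` independent uniform pairs of an index in `S` and a sign. -/
def avgDraws (S : Finset ℕ) : ℕ → (List (ℕ × Bool) → ℝ) → ℝ
  | 0, φ => φ []
  | k + 1, φ => avgDraws S k fun l =>
      (∑ i ∈ S, (φ ((i, true) :: l) + φ ((i, false) :: l)) / 2) / S.card

section draws

variable {S : Finset ℕ}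

lemma avgDraws_mono {k : ℕ} {φ ψ : List (ℕ × Bool) → ℝ}
    (h : ∀ l : List (ℕ × Bool), l.length = k → (∀ p ∈ l, p.1 ∈ S) → φ l ≤ ψ l) :
    avgDraws S k φ ≤ avgDraws S k ψ := by
  induction k generalizing φ ψ with
  | zero => exact h [] rfl (by simp)
  | succ k ih =>
    refine ih fun l hl hS => ?_
    gcongr with i hi
    · exact h _ (by simp [hl]) (List.forall_mem_cons.2 ⟨hi, hS⟩)
    · exact h _ (by simp [hl]) (List.forall_mem_cons.2 ⟨hi, hS⟩)

lemma avgDraws_congr {k : ℕ} {φ ψ : List (ℕ × Bool) → ℝ}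
    (h : ∀ l : List (ℕ × Bool), l.length = k → (∀ p ∈ l, p.1 ∈ S) → φ l = ψ l) :
    avgDraws S k φ = avgDraws S k ψ :=
  le_antisymm (avgDraws_mono fun l h1 h2 => (h l h1 h2).le)
    (avgDraws_mono fun l h1 h2 => (h l h1 h2).ge)

lemma avgDraws_add (k : ℕ) (φ ψ : List (ℕ × Bool) → ℝ) :
    avgDraws S k (fun l => φ l + ψ l) = avgDraws S k φ + avgDraws S k ψ := by
  induction k generalizing φ ψ with
  | zero => rfl
  | succ k ih =>
    simp only [avgDraws, ← ih]
    congr 1; ext l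
    rw [← add_div, ← Finset.sum_add_distrib]
    congr 1
    exact Finset.sum_congr rfl fun i _ => by ring

lemma avgDraws_mul_left (k : ℕ) (c : ℝ) (φ : List (ℕ × Bool) → ℝ) :
    avgDraws S k (fun l => c * φ l) = c * avgDraws S k φ := by
  induction k generalizing φ with
  | zero => rfl
  | succ k ih =>
    simp only [avgDraws, ← ih]
    congr 1; ext l
    rw [← mul_div_assoc, Finset.mul_sum]
    congr 1
    exact Finset.sum_congr rfl fun i _ => by ring

lemma avgDraws_neg (k : ℕ) (φ : List (ℕ × Bool) → ℝ) :
    avgDraws S k (fun l => -φ l) = -avgDraws S k φ := by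
  simpa using avgDraws_mul_left k (-1) φ

lemma avgDraws_sub (k : ℕ) (φ ψ : List (ℕ × Bool) → ℝ) :
    avgDraws S k (fun l => φ l - ψ l) = avgDraws S k φ - avgDraws S k ψ := by
  simp only [sub_eq_add_neg, avgDraws_add, avgDraws_neg]

lemma avgDraws_const (hS : S.Nonempty) (k : ℕ) (c : ℝ) : avgDraws S k (fun _ => c) = c := by
  induction k with
  | zero => rfl
  | succ k ih =>
    have : (S.card : ℝ) ≠ 0 := by exact_mod_cast hS.card_pos.ne'
    simp only [avgDraws, add_self_div_two, Finset.sum_const, nsmul_eq_mul]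
    rw [mul_div_cancel_left₀ _ this, ih]

lemma avgDraws_finset_sum {ι : Type*} (s : Finset ι) (k : ℕ) (φ : ι → List (ℕ × Bool) → ℝ) :
    avgDraws S k (fun l => ∑ j ∈ s, φ j l) = ∑ j ∈ s, avgDraws S k (φ j) := by
  classical
  induction s using Finset.induction_on with
  | empty => simpa using avgDraws_mul_left (S := S) k 0 fun _ => 0
  | insert j s hj ih => simp only [Finset.sum_insert hj, avgDraws_add, ih]

variable {H : Set (X → I01)} {ℓ : ℝ → ℝ → ℝ} {L : ℝ}

/-- The newest draw sits at the head, and averaging over its sign produces `probe` at a pool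
feature. A potential with `k + 1` draws thus reads as one with `k` draws and an empirical mean in
place of a true feature. -/
lemma avgDraws_succ_minLoss (k : ℕ) (υ : ℕ → I01) (a b : ℕ) (ω : ℕ → X) :
    avgDraws S (k + 1) (fun l => minLoss H ℓ L υ a b l ω) =
      avgDraws S k fun l => (∑ i ∈ S, probe H ℓ L υ a b l (ω i) ω) / S.card := by
  simp only [avgDraws, minLoss_cons, probe]

/-- An infimum of affine functions is concave, so symmetric noise only lowers it on average.
Leftover perturbations may therefore be dropped at the horizon. -/
lemma avgDraws_minLoss_le (hS : S.Nonempty) (hH : H.Nonempty) (hL : 0 < L)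
    (hℓ : IsConvexLipschitzLoss ℓ L) (k : ℕ) (υ : ℕ → I01) (a b : ℕ) (ω : ℕ → X) :
    avgDraws S k (fun l => minLoss H ℓ L υ a b l ω) ≤ minLoss H ℓ L υ a b [] ω := by
  induction k with
  | zero => exact le_rfl
  | succ k ih =>
    rw [avgDraws_succ_minLoss]
    refine le_trans (avgDraws_mono fun l _ _ => ?_) ih
    have hc : (0 : ℝ) < S.card := by exact_mod_cast hS.card_pos
    rw [div_le_iff₀ hc]
    refine (Finset.sum_le_sum fun i _ => probe_le_minLoss hH hL hℓ υ a b l (ω i) ω).trans_eq ?_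
    rw [Finset.sum_const, nsmul_eq_mul, mul_comm]

end draws

end

end Hybrid

/-! ### Expectations, histories and the potential method -/

namespace Hybrid

noncomputable section

variable {X : Type*}

section expectations

lemma summable_pmf_mul {α : Type*} (p : PMF α) {f : α → ℝ} {B : ℝ} (hf : ∀ a, |f a| ≤ B) :
    Summable fun a => (p a).toReal * f a := by
  have h1 : Summable fun a => (p a).toReal := ENNReal.summable_toReal p.tsum_coe_ne_top
  refine Summable.of_norm_bounded (h1.mul_right B) fun a => ?_
  rw [Real.norm_eq_abs, abs_mul, abs_of_nonneg ENNReal.toReal_nonneg]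
  exact mul_le_mul_of_nonneg_left (hf a) ENNReal.toReal_nonneg

lemma pmfExp_const {α : Type*} (p : PMF α) (c : ℝ) : pmfExp p (fun _ => c) = c := by
  unfold pmfExp
  rw [tsum_mul_right, ← ENNReal.tsum_toReal_eq fun a => p.apply_ne_top a, p.tsum_coe]
  simp

lemma pmfExp_mono {α : Type*} (p : PMF α) {f g : α → ℝ} {B : ℝ} (hf : ∀ a, |f a| ≤ B)
    (hg : ∀ a, |g a| ≤ B) (h : ∀ a, f a ≤ g a) : pmfExp p f ≤ pmfExp p g :=
  (summable_pmf_mul p hf).tsum_le_tsum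
    (fun a => mul_le_mul_of_nonneg_left (h a) ENNReal.toReal_nonneg) (summable_pmf_mul p hg)

lemma pmfExp_add {α : Type*} (p : PMF α) {f g : α → ℝ} {B : ℝ} (hf : ∀ a, |f a| ≤ B)
    (hg : ∀ a, |g a| ≤ B) : pmfExp p (fun a => f a + g a) = pmfExp p f + pmfExp p g := by
  unfold pmfExp
  rw [← (summable_pmf_mul p hf).tsum_add (summable_pmf_mul p hg)]
  simp only [mul_add]

lemma pmfExp_mem_Icc {α : Type*} (p : PMF α) {f : α → ℝ} {a b : ℝ}
    (hf : ∀ x, f x ∈ Set.Icc a b) : pmfExp p f ∈ Set.Icc a b := by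
  have h1 : ∀ x, |f x| ≤ max |a| |b| := fun x => abs_le_max_abs_abs (hf x).1 (hf x).2
  constructor
  · rw [← pmfExp_const p a]
    exact pmfExp_mono p (fun _ => le_max_left _ _) h1 fun x => (hf x).1
  · rw [← pmfExp_const p b]
    exact pmfExp_mono p h1 (fun _ => le_max_right _ _) fun x => (hf x).2

variable [MeasurableSpace X]

/-- The lower bound `a` makes the set of integrals bounded below; otherwise its real infimum would
carry no information. -/
lemma upperExp_le (μ : Measure X) [IsProbabilityMeasure μ] {f g : X → ℝ} {a : ℝ}
    (ha : ∀ x, a ≤ f x) (hg : Integrable g μ) (hfg : ∀ x, f x ≤ g x) :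
    upperExp μ f ≤ ∫ x, g x ∂μ := by
  refine csInf_le ⟨a, ?_⟩ ⟨g, hg, hfg, rfl⟩
  rintro _ ⟨g', hg', hfg', rfl⟩
  simpa using integral_mono (integrable_const a) hg' fun x => (ha x).trans (hfg' x)

lemma upperExp_mem_Icc (μ : Measure X) [IsProbabilityMeasure μ] {f : X → ℝ} {a b : ℝ}
    (hf : ∀ x, f x ∈ Set.Icc a b) : upperExp μ f ∈ Set.Icc a b := by
  constructor
  · refine le_csInf ⟨_, fun _ => b, integrable_const b, fun x => (hf x).2, rfl⟩ ?_
    rintro _ ⟨g', hg', hfg', rfl⟩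
    simpa using integral_mono (integrable_const a) hg' fun x => (hf x).1.trans (hfg' x)
  · simpa using upperExp_le μ (fun x => (hf x).1) (integrable_const b) fun x => (hf x).2

end expectations

section histories

variable {H : Set (X → I01)} {ℓ : ℝ → ℝ → ℝ} {L : ℝ}

/-- The features of a history, continued by `x₀`. -/
def featSeq (x₀ : X) (hist : List (X × I01)) (i : ℕ) : X := (hist.map Prod.fst).getD i x₀

/-- The labels of a history, continued by `0`. -/
def labelSeq (hist : List (X × I01)) (i : ℕ) : I01 := (hist.map Prod.snd).getD i 0

lemma getD_append_singleton {α : Type*} (l : List α) (a d : α) (i : ℕ) :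
    (l ++ [a]).getD i d = Function.update (fun j => l.getD j d) l.length a i := by
  rcases lt_trichotomy i l.length with h | h | h
  · rw [Function.update_of_ne h.ne, List.getD_append _ _ _ _ h]
  · subst h; simp
  · rw [Function.update_of_ne h.ne', List.getD_eq_default _ _ (by simpa using h),
      List.getD_eq_default _ _ h.le]

lemma featSeq_append (x₀ : X) (hist : List (X × I01)) (x : X) (y : I01) :
    featSeq x₀ (hist ++ [(x, y)]) = Function.update (featSeq x₀ hist) hist.length x := by
  ext i
  simp only [featSeq, List.map_append, List.map_cons, List.map_nil, getD_append_singleton,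
    List.length_map]
  rfl

lemma labelSeq_append (hist : List (X × I01)) (x : X) (y : I01) :
    labelSeq (hist ++ [(x, y)]) = Function.update (labelSeq hist) hist.length y := by
  ext i
  simp only [labelSeq, List.map_append, List.map_cons, List.map_nil, getD_append_singleton,
    List.length_map]
  rfl

lemma iInf_hist_eq_minLoss (x₀ : X) (hist : List (X × I01)) :
    ⨅ h : H, (hist.map fun p => ℓ ((h : X → I01) p.1) p.2).sum =
      minLoss H ℓ L (labelSeq hist) 0 hist.length [] (featSeq x₀ hist) := by
  unfold minLoss
  congr 1
  ext h
  induction hist using List.reverseRecOn with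
  | nil => simp [perturbedLoss]
  | append_singleton l p ih =>
    obtain ⟨x, y⟩ := p
    rw [featSeq_append, labelSeq_append, List.length_append, List.length_singleton,
      perturbedLoss_update _ (Nat.zero_le _) (by simp), ← ih]
    simp

end histories

section game

variable [MeasurableSpace X] {H : Set (X → I01)} {ℓ : ℝ → ℝ → ℝ} {L : ℝ}

lemma exists_loss_bound (hℓ : IsConvexLipschitzLoss ℓ L) :
    ∃ B : ℝ, 0 ≤ B ∧ ∀ p q : I01, ℓ p q ∈ Set.Icc 0 B := by
  have key : ∀ p q : I01, ℓ p q ≤ ℓ (0 : I01) (0 : I01) + |L| + |L| := by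
    intro p q
    have h1 := (abs_le.1 (hℓ.lipschitz_left p 0 q)).2
    have h2 := (abs_le.1 (hℓ.lipschitz_right 0 q 0)).2
    have h3 : ∀ r : I01, L * |(r : ℝ) - (0 : I01)| ≤ |L| := by
      intro r
      have : |(r : ℝ) - (0 : I01)| ≤ 1 := by
        simpa [abs_of_nonneg r.2.1] using r.2.2
      calc L * |(r : ℝ) - (0 : I01)| ≤ |L| * |(r : ℝ) - (0 : I01)| :=
            mul_le_mul_of_nonneg_right (le_abs_self L) (abs_nonneg _)
        _ ≤ |L| * 1 := mul_le_mul_of_nonneg_left this (abs_nonneg _)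
        _ = |L| := mul_one _
    have := h3 p
    have := h3 q
    linarith
  exact ⟨_, (hℓ.nonneg 0 0).trans (key 0 0), fun p q => ⟨hℓ.nonneg p q, key p q⟩⟩

/-- Real suprema, infima and series are meaningful only when bounded or summable; this a priori
interval supplies that at every stage of the recursion. -/
lemma gameValue_mem_Icc (hH : H.Nonempty) {B : ℝ} (hB : ∀ p q : I01, ℓ p q ∈ Set.Icc 0 B)
    (Φ : PredictionRule X) (μ : ℕ → ProbabilityMeasure X) (n : ℕ) (hist : List (X × I01))
    (c : ℝ) :
    gameValue ℓ H Φ μ n hist c ∈ Set.Icc (c - (hist.length + n : ℕ) * B) (c + n * B) := by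
  induction n generalizing hist c with
  | zero =>
    have := hH.to_subtype
    have hsum : ∀ h : H, (hist.map fun p => ℓ ((h : X → I01) p.1) p.2).sum ∈
        Set.Icc 0 (hist.length * B) := by
      intro h
      induction hist with
      | nil => simp
      | cons p l ih =>
        obtain ⟨h1, h2⟩ := hB ((h : X → I01) p.1) p.2
        simp only [List.map_cons, List.sum_cons, List.length_cons, Nat.cast_add, Nat.cast_one,
          Set.mem_Icc] at ih ⊢
        constructor <;> linarith [ih.1, ih.2]
    have h0 : 0 ≤ ⨅ h : H, (hist.map fun p => ℓ ((h : X → I01) p.1) p.2).sum :=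
      le_ciInf fun h => (hsum h).1
    have h1 : ⨅ h : H, (hist.map fun p => ℓ ((h : X → I01) p.1) p.2).sum ≤ hist.length * B :=
      (ciInf_le ⟨0, by rintro _ ⟨h, rfl⟩; exact (hsum h).1⟩ (Classical.arbitrary H)).trans
        (hsum _).2
    constructor <;> simp only [gameValue, Nat.cast_zero, add_zero, zero_mul] <;> linarith
  | succ n ih =>
    rw [gameValue]
    have hB0 : 0 ≤ B := (hB 0 0).1.trans (hB 0 0).2
    refine upperExp_mem_Icc _ fun x => ?_
    have key : ∀ y : I01, pmfExp (Φ hist x) (fun p =>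
        gameValue ℓ H Φ μ n (hist ++ [(x, y)]) (c + ℓ p y)) ∈
        Set.Icc (c - (hist.length + (n + 1) : ℕ) * B) (c + (n + 1 : ℕ) * B) := by
      intro y
      refine pmfExp_mem_Icc _ fun p => ?_
      obtain ⟨h1, h2⟩ := ih (hist ++ [(x, y)]) (c + ℓ p y)
      obtain ⟨h3, h4⟩ := hB p y
      simp only [List.length_append, List.length_singleton, Nat.cast_add, Nat.cast_one] at h1 h2
      push_cast
      constructor <;> nlinarith
    constructor
    · exact (key 0).1.trans (le_ciSup (f := fun y : I01 => pmfExp (Φ hist x) fun p =>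
        gameValue ℓ H Φ μ n (hist ++ [(x, y)]) (c + ℓ p y))
        ⟨_, by rintro _ ⟨y, rfl⟩; exact (key y).2⟩ 0)
    · exact ciSup_le fun y => (key y).2

/-- A sequence of potentials which pays for the loss of every round bounds the value of the
game. -/
theorem gameValue_le (hH : H.Nonempty) (hℓ : IsConvexLipschitzLoss ℓ L) (x₀ : X)
    (Φ : PredictionRule X) (μ : ℕ → ProbabilityMeasure X) (T : ℕ)
    (V : ℕ → (ℕ → X) → (ℕ → I01) → ℝ)
    (hV : ∀ ω υ, -minLoss H ℓ L υ 0 T [] ω ≤ V T ω υ)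
    (hstep : ∀ hist : List (X × I01), hist.length < T → ∃ g : X → ℝ,
      Integrable g (μ hist.length : Measure X) ∧
      ∫ x, g x ∂(μ hist.length : Measure X) ≤ V hist.length (featSeq x₀ hist) (labelSeq hist) ∧
      ∀ (x : X) (y : I01), pmfExp (Φ hist x) (fun p => ℓ p y) + V (hist.length + 1)
        (Function.update (featSeq x₀ hist) hist.length x)
        (Function.update (labelSeq hist) hist.length y) ≤ g x)
    (n : ℕ) (hist : List (X × I01)) (hn : hist.length + n = T) (c : ℝ) :
    gameValue ℓ H Φ μ n hist c ≤ c + V hist.length (featSeq x₀ hist) (labelSeq hist) := by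
  obtain ⟨B, hB0, hB⟩ := exists_loss_bound hℓ
  induction n generalizing hist c with
  | zero =>
    rw [gameValue, iInf_hist_eq_minLoss (L := L) x₀]
    obtain rfl : hist.length = T := hn
    have := hV (featSeq x₀ hist) (labelSeq hist)
    linarith
  | succ n ih =>
    obtain ⟨g, hg, hgV, hstep'⟩ := hstep hist (by omega)
    rw [gameValue]
    have hlow : ∀ x, c - (hist.length + (n + 1) : ℕ) * B ≤ ⨆ y : I01, pmfExp (Φ hist x) fun p =>
        gameValue ℓ H Φ μ n (hist ++ [(x, y)]) (c + ℓ p y) := by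
      intro x
      have key : ∀ y : I01, pmfExp (Φ hist x) (fun p =>
          gameValue ℓ H Φ μ n (hist ++ [(x, y)]) (c + ℓ p y)) ∈
          Set.Icc (c - (hist.length + (n + 1) : ℕ) * B) (c + (n + 1 : ℕ) * B) := by
        intro y
        refine pmfExp_mem_Icc _ fun p => ?_
        obtain ⟨h1, h2⟩ := gameValue_mem_Icc hH hB Φ μ n (hist ++ [(x, y)]) (c + ℓ p y)
        obtain ⟨h3, h4⟩ := hB p y
        simp only [List.length_append, List.length_singleton, Nat.cast_add, Nat.cast_one] at h1 h2
        push_cast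
        constructor <;> nlinarith
      exact (key 0).1.trans (le_ciSup (f := fun y : I01 => pmfExp (Φ hist x) fun p =>
        gameValue ℓ H Φ μ n (hist ++ [(x, y)]) (c + ℓ p y))
        ⟨_, by rintro _ ⟨y, rfl⟩; exact (key y).2⟩ 0)
    -- `g` dominates all labels simultaneously and is integrable, so it majorises the supremum
    -- without any measurability of the supremum.
    refine (upperExp_le _ (g := fun x => c + g x) hlow ((integrable_const c).add hg)
      fun x => ?_).trans ?_
    · refine ciSup_le fun y => ?_
      set v := V (hist.length + 1) (Function.update (featSeq x₀ hist) hist.length x)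
        (Function.update (labelSeq hist) hist.length y) with hv
      have h1 : ∀ p : I01, gameValue ℓ H Φ μ n (hist ++ [(x, y)]) (c + ℓ p y) ≤
          ℓ p y + (c + v) := by
        intro p
        have := ih (hist ++ [(x, y)]) (by simp; omega) (c + ℓ p y)
        rw [featSeq_append, labelSeq_append, List.length_append, List.length_singleton] at this
        linarith
      have h2 : ∀ p : I01, |gameValue ℓ H Φ μ n (hist ++ [(x, y)]) (c + ℓ p y)| ≤
          |c| + ((hist.length + 1 + n : ℕ) + 1) * B := by
        intro p
        obtain ⟨h1, h2⟩ := gameValue_mem_Icc hH hB Φ μ n (hist ++ [(x, y)]) (c + ℓ p y)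
        obtain ⟨h3, h4⟩ := hB p y
        simp only [List.length_append, List.length_singleton, Nat.cast_add, Nat.cast_one] at h1 h2
        have := neg_abs_le c
        have := le_abs_self c
        have := mul_nonneg (Nat.cast_nonneg (α := ℝ) hist.length) hB0
        push_cast
        rw [abs_le]
        constructor <;> nlinarith
      have h3 : ∀ p : I01, |ℓ p y| ≤ B := fun p => by
        rw [abs_of_nonneg (hB p y).1]; exact (hB p y).2
      refine (pmfExp_mono (B := max (|c| + ((hist.length + 1 + n : ℕ) + 1) * B) (B + |c + v|))
        _ (fun p => (h2 p).trans (le_max_left _ _)) (fun p => ?_) h1).trans ?_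
      · exact (abs_add_le _ _).trans (le_trans (by gcongr; exact h3 p) (le_max_right _ _))
      · rw [pmfExp_add (B := max B |c + v|) _ (fun p => (h3 p).trans (le_max_left _ _))
          (fun _ => le_max_right _ _), pmfExp_const]
        have := hstep' x y
        linarith
    · rw [integral_add (integrable_const c) hg]
      simpa using hgV

end game

end

end Hybrid

/-! ### Traces and Massart's bound, measurability, Hoeffding's lemma -/

namespace Hybrid

noncomputable section

variable {X : Type*}

section patterns

/-- A finite maximum is bounded through a linearised log-sum-exp. -/
lemma le_log_add_div_sub_one {u W A : ℝ} (hA : 0 < A) (h : Real.exp u ≤ W) :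
    u ≤ Real.log A + W / A - 1 := by
  have hW : 0 < W := (Real.exp_pos u).trans_le h
  have h1 : u ≤ Real.log W := (Real.le_log_iff_exp_le hW).2 h
  have h2 : Real.log (W / A) ≤ W / A - 1 := Real.log_le_sub_one_of_pos (div_pos hW hA)
  rw [Real.log_div hW.ne' hA.ne'] at h2
  linarith

/-- A set with at most `d` elements is the range of a map from `Fin d` to `Option S`, where `none`
fills unused slots; counting such maps replaces the sum of binomial coefficients. -/
lemma card_filter_card_le {α : Type*} [DecidableEq α] (S : Finset α) (d : ℕ) :
    (S.powerset.filter fun A => A.card ≤ d).card ≤ (S.card + 1) ^ d := by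
  let F : (Fin d → Option S) → Finset α := fun f =>
    (Finset.univ.filter fun x : S => ∃ j, f j = some x).map (Function.Embedding.subtype _)
  have hsub : (S.powerset.filter fun A => A.card ≤ d) ⊆ Finset.univ.image F := by
    intro A hA
    rw [Finset.mem_filter, Finset.mem_powerset] at hA
    obtain ⟨hAS, hAd⟩ := hA
    rw [Finset.mem_image]
    let e := A.equivFin
    refine ⟨fun j => if hj : (j : ℕ) < A.card then
      some ⟨(e.symm ⟨j, hj⟩ : A), hAS (e.symm ⟨j, hj⟩ : A).2⟩ else none, Finset.mem_univ _, ?_⟩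
    ext a
    simp only [F, Finset.mem_map, Finset.mem_filter, Finset.mem_univ, true_and,
      Function.Embedding.subtype_apply]
    constructor
    · rintro ⟨x, ⟨j, hj⟩, rfl⟩
      split_ifs at hj with h
      · rw [← Option.some.inj hj]
        exact (e.symm ⟨j, h⟩ : A).2
    · intro ha
      refine ⟨⟨a, hAS ha⟩, ⟨⟨e ⟨a, ha⟩, (e ⟨a, ha⟩).2.trans_le hAd⟩, ?_⟩, rfl⟩
      simp
  refine (Finset.card_le_card hsub).trans (Finset.card_image_le.trans ?_)
  simp

variable {H : Set (X → I01)}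

open Classical in
/-- The traces of the class on the features `ω i`, `i ∈ S`. -/
def traces (H : Set (X → I01)) (ω : ℕ → X) (S : Finset ℕ) : Finset (Finset ℕ) :=
  S.powerset.filter fun A => ∃ h ∈ H, ∀ i ∈ S, h (ω i) = 1 ↔ i ∈ A

lemma card_le_of_shatters {d : ℕ} (hd : vcDim H = d) {S : Finset X} (hS : Shatters H S) :
    S.card ≤ d := by
  have : (S.card : ℕ∞) ≤ vcDim H := le_iSup₂_of_le S hS le_rfl
  rw [hd] at this
  exact_mod_cast this

/-- Pajor's form of Sauer–Shelah: a family has at most as many members as it shatters sets. A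
shattered set of indices gives a shattered set of features of the same size, hence has at most `d`
elements. -/
lemma card_traces_le {d : ℕ} (hd : vcDim H = d) (ω : ℕ → X) (S : Finset ℕ) :
    (traces H ω S).card ≤ (S.card + 1) ^ d := by
  classical
  refine ((traces H ω S).card_le_card_shatterer).trans
    ((Finset.card_le_card fun I hI => ?_).trans (card_filter_card_le S d))
  rw [Finset.mem_shatterer] at hI
  have hIS : I ⊆ S := by
    obtain ⟨t, ht, hIt⟩ := hI.exists_superset
    exact hIt.trans (Finset.mem_powerset.1 (Finset.mem_filter.1 ht).1)
  have hsh : ∀ A ⊆ I, ∃ h ∈ H, ∀ i ∈ I, h (ω i) = 1 ↔ i ∈ A := by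
    intro A hA
    obtain ⟨u, hu, hIu⟩ := hI hA
    obtain ⟨-, h, hh, hhu⟩ := Finset.mem_filter.1 hu
    refine ⟨h, hh, fun i hi => ?_⟩
    rw [hhu i (hIS hi), ← hIu]
    simp [hi]
  -- Two indices carrying the same feature cannot be separated, so they do not lie in one shattered
  -- set; passing to features keeps the cardinality.
  have hinj : Set.InjOn ω I := by
    intro i hi j hj hij
    by_contra hne
    obtain ⟨h, -, hhi⟩ := hsh {i} (by simpa using hi)
    have h1 := (hhi i hi).2 (by simp)
    have h2 := (hhi j hj).1 (by rw [← hij]; exact h1)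
    exact hne (Finset.mem_singleton.1 h2).symm
  rw [Finset.mem_filter, Finset.mem_powerset]
  refine ⟨hIS, ?_⟩
  rw [← Finset.card_image_of_injOn hinj]
  refine card_le_of_shatters hd fun A hA => ?_
  obtain ⟨h, hh, hhA⟩ := hsh (I.filter fun i => ω i ∈ A) (Finset.filter_subset _ _)
  refine ⟨h, hh, fun x hx => ?_⟩
  obtain ⟨i, hi, rfl⟩ := Finset.mem_image.1 hx
  rw [hhA i hi]
  simp [hi]

/-- The signed number of draws in `A`. -/
def signedCount (A : Finset ℕ) (l : List (ℕ × Bool)) : ℝ :=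
  (l.map fun p => sgn p.2 * (if p.1 ∈ A then 1 else 0)).sum

/-- Peeling off the newest draw, its sign averages to `cosh (η u)` with `u ∈ {0, 1}`, which is at
most `exp (η ^ 2 / 2)` whichever index was drawn. -/
lemma avgDraws_exp_signedCount_le {S : Finset ℕ} (hS : S.Nonempty) (A : Finset ℕ) (η : ℝ)
    (k : ℕ) : avgDraws S k (fun l => Real.exp (-(η * signedCount A l))) ≤
      Real.exp (k * (η ^ 2 / 2)) := by
  induction k with
  | zero => simp [avgDraws, signedCount]
  | succ k ih =>
    have hc : (0 : ℝ) < S.card := by exact_mod_cast hS.card_pos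
    have hstep : ∀ l : List (ℕ × Bool),
        (∑ i ∈ S, (Real.exp (-(η * signedCount A ((i, true) :: l))) +
          Real.exp (-(η * signedCount A ((i, false) :: l)))) / 2) / S.card ≤
        Real.exp (η ^ 2 / 2) * Real.exp (-(η * signedCount A l)) := by
      intro l
      rw [div_le_iff₀ hc]
      have : ∀ i ∈ S, (Real.exp (-(η * signedCount A ((i, true) :: l))) +
          Real.exp (-(η * signedCount A ((i, false) :: l)))) / 2 ≤
          Real.exp (η ^ 2 / 2) * Real.exp (-(η * signedCount A l)) := by
        intro i _
        set u : ℝ := if i ∈ A then 1 else 0 with hu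
        have h1 : Real.cosh (η * u) ≤ Real.exp (η ^ 2 / 2) := by
          refine (Real.cosh_le_exp_half_sq _).trans (Real.exp_le_exp.2 ?_)
          rw [mul_pow]
          have : u ^ 2 ≤ 1 := by rw [hu]; split_ifs <;> norm_num
          nlinarith [sq_nonneg η]
        rw [Real.cosh_eq] at h1
        have e1 : -(η * signedCount A ((i, true) :: l)) =
            -(η * u) + -(η * signedCount A l) := by
          simp only [signedCount, List.map_cons, List.sum_cons, sgn, if_true, ← hu]; ring
        have e2 : -(η * signedCount A ((i, false) :: l)) =
            η * u + -(η * signedCount A l) := by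
          simp only [signedCount, List.map_cons, List.sum_cons, sgn, Bool.false_eq_true, if_false,
            ← hu]
          ring
        rw [e1, e2, Real.exp_add, Real.exp_add]
        calc _ = (Real.exp (η * u) + Real.exp (-(η * u))) / 2 *
              Real.exp (-(η * signedCount A l)) := by ring
          _ ≤ _ := mul_le_mul_of_nonneg_right h1 (Real.exp_pos _).le
      refine (Finset.sum_le_sum this).trans_eq ?_
      rw [Finset.sum_const, nsmul_eq_mul, mul_comm]
    refine (avgDraws_mono fun l _ _ => hstep l).trans ?_
    rw [avgDraws_mul_left]
    refine (mul_le_mul_of_nonneg_left ih (Real.exp_pos _).le).trans_eq ?_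
    rw [← Real.exp_add]
    congr 1
    push_cast
    ring

/-- Massart's bound for the value of a fresh block: the class has few traces on the pool. -/
lemma neg_avgDraws_minLoss_le {ℓ : ℝ → ℝ → ℝ} {L : ℝ} (hH : H.Nonempty) (hB : BinaryValued H)
    (hL : 0 < L) {d : ℕ} (hd : vcDim H = d) {S : Finset ℕ} (hS : S.Nonempty) {η : ℝ} (hη : 0 < η)
    (k : ℕ) (υ : ℕ → I01) (a : ℕ) (ω : ℕ → X) :
    -avgDraws S k (fun l => minLoss H ℓ L υ a a l ω) ≤
      L * (d * Real.log (S.card + 1) / η + η * k / 2) := by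
  classical
  set 𝒜 := traces H ω S with h𝒜
  obtain ⟨h₀, hh₀⟩ := hH
  have htr : ∀ h ∈ H, (S.filter fun i => h (ω i) = 1) ∈ 𝒜 := by
    intro h hh
    rw [h𝒜, traces, Finset.mem_filter, Finset.mem_powerset]
    exact ⟨Finset.filter_subset _ _, h, hh, fun i hi => by simp [hi]⟩
  have hcard : 0 < (𝒜.card : ℝ) := by
    exact_mod_cast Finset.card_pos.2 ⟨_, htr h₀ hh₀⟩
  -- `A` is the bound for the mean of `W`, so in the linearised log-sum-exp the mean of `W / A` is
  -- at most `1` and cancels against the `-1`.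
  set A : ℝ := 𝒜.card * Real.exp (k * (η ^ 2 / 2)) with hA
  have hA0 : 0 < A := mul_pos hcard (Real.exp_pos _)
  set W : List (ℕ × Bool) → ℝ := fun l => ∑ B ∈ 𝒜, Real.exp (-(η * signedCount B l)) with hW
  have h1 : ∀ l : List (ℕ × Bool), l.length = k → (∀ p ∈ l, p.1 ∈ S) →
      -minLoss H ℓ L υ a a l ω ≤ L / η * (Real.log A - 1 + A⁻¹ * W l) := by
    intro l _ hl
    rw [neg_le]
    refine le_minLoss ⟨h₀, hh₀⟩ fun h hh => ?_
    have h2 : perturbedLoss ℓ L υ a a l (fun i => h (ω i)) =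
        L * signedCount (S.filter fun i => h (ω i) = 1) l := by
      unfold perturbedLoss signedCount
      rw [Finset.Ico_self, Finset.sum_empty, zero_add]
      congr 2
      refine List.map_congr_left fun p hp => ?_
      congr 1
      rcases hB h hh (ω p.1) with h3 | h3 <;> simp [h3, hl p hp]
    rw [h2]
    have h3 := le_log_add_div_sub_one hA0 (u := -(η * signedCount
      (S.filter fun i => h (ω i) = 1) l)) (W := W l)
      (Finset.single_le_sum (f := fun B => Real.exp (-(η * signedCount B l)))
        (fun _ _ => (Real.exp_pos _).le) (htr h hh))
    have h4 : L / η * (-(η * signedCount (S.filter fun i => h (ω i) = 1) l)) ≤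
        L / η * (Real.log A - 1 + A⁻¹ * W l) :=
      mul_le_mul_of_nonneg_left (h3.trans_eq (by ring)) (div_pos hL hη).le
    have h5 : L / η * (-(η * signedCount (S.filter fun i => h (ω i) = 1) l)) =
      -(L * signedCount (S.filter fun i => h (ω i) = 1) l) := by field_simp
    linarith
  rw [← avgDraws_neg]
  refine (avgDraws_mono h1).trans ?_
  rw [avgDraws_mul_left, avgDraws_add, avgDraws_const hS, avgDraws_mul_left, hW,
    avgDraws_finset_sum]
  have h2 : ∑ B ∈ 𝒜, avgDraws S k (fun l => Real.exp (-(η * signedCount B l))) ≤ A := by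
    refine (Finset.sum_le_sum fun B _ => avgDraws_exp_signedCount_le hS B η k).trans_eq ?_
    rw [Finset.sum_const, nsmul_eq_mul]
  have h3 : A⁻¹ * ∑ B ∈ 𝒜, avgDraws S k (fun l => Real.exp (-(η * signedCount B l))) ≤ 1 := by
    rw [inv_mul_le_iff₀ hA0, mul_one]; exact h2
  have h4 : Real.log A ≤ d * Real.log (S.card + 1) + k * (η ^ 2 / 2) := by
    rw [hA, Real.log_mul hcard.ne' (Real.exp_pos _).ne', Real.log_exp, ← Real.log_pow]
    gcongr
    exact_mod_cast card_traces_le hd ω S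
  calc _ ≤ L / η * (d * Real.log (S.card + 1) + k * (η ^ 2 / 2)) :=
        mul_le_mul_of_nonneg_left (by linarith) (div_pos hL hη).le
    _ = _ := by field_simp

end patterns

section measurability

variable [MeasurableSpace X] {H : Set (X → I01)}

/-- The infimum takes its values from finitely many bit patterns, so a strict sublevel set is a
finite union of the trace sets assumed measurable. -/
lemma measurable_iInf_of_traceMeasurable (hB : BinaryValued H)
    (hT : TraceMeasurable H) {n : ℕ} (φ : (Fin n → I01) → ℝ)
    (hbdd : ∀ x : Fin n → X, BddBelow (Set.range fun h : H => φ fun i => (h : X → I01) (x i))) :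
    Measurable fun x : Fin n → X => ⨅ h : H, φ fun i => (h : X → I01) (x i) := by
  rcases isEmpty_or_nonempty H with hH | hH
  · simp only [iInf_of_isEmpty]
    exact measurable_const
  refine measurable_of_Iio fun c => ?_
  have hset : (fun x : Fin n → X => ⨅ h : H, φ fun i => (h : X → I01) (x i)) ⁻¹' Set.Iio c =
      ⋃ β : {β : Fin n → Bool // φ (fun i => if β i then 1 else 0) < c},
        {x | ∃ h ∈ H, ∀ i, h (x i) = if β.1 i then 1 else 0} := by
    ext x
    simp only [Set.mem_preimage, Set.mem_Iio, Set.mem_iUnion, Set.mem_ofPred_eq]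
    rw [ciInf_lt_iff (hbdd x)]
    constructor
    · rintro ⟨h, hh⟩
      have h01 : (fun i => (h : X → I01) (x i)) =
          fun i => if (decide ((h : X → I01) (x i) = 1)) then 1 else 0 := by
        ext1 i
        rcases hB h h.2 (x i) with h0 | h0 <;> simp [h0]
      refine ⟨⟨fun i => decide ((h : X → I01) (x i) = 1), by rw [← h01]; exact hh⟩, h, h.2,
        fun i => congrFun h01 i⟩
    · rintro ⟨⟨β, hβ⟩, h, hh, hhx⟩
      refine ⟨⟨h, hh⟩, ?_⟩
      have : (fun i => h (x i)) = fun i => if β i then 1 else 0 := funext hhx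
      change φ (fun i => h (x i)) < c
      rw [this]
      exact hβ
  rw [hset]
  refine MeasurableSet.iUnion fun β => hT n _ fun i => ?_
  split_ifs <;> simp

variable {ℓ : ℝ → ℝ → ℝ} {L : ℝ}

lemma measurable_minLossAt (hB : BinaryValued H) (hT : TraceMeasurable H) (hL : 0 < L)
    (hℓ : IsConvexLipschitzLoss ℓ L) (υ : ℕ → I01) (a b : ℕ) (l : List (ℕ × Bool)) (ε : Bool) :
    Measurable fun p : X × (ℕ → X) => minLossAt H ℓ L υ a b l ε p.1 p.2 := by
  -- Only finitely many features are read: those before `N`, which exceeds the block and every drawn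
  -- index, and `x`, placed in the last slot.
  obtain ⟨N, hbN, hlN⟩ : ∃ N, b ≤ N ∧ ∀ p ∈ l, p.1 < N := by
    refine ⟨b + (l.map fun p => p.1 + 1).sum, Nat.le_add_right _ _, fun p hp => ?_⟩
    have := List.single_le_sum (l := l.map fun p => p.1 + 1) (by simp) (p.1 + 1)
      (List.mem_map.2 ⟨p, hp, rfl⟩)
    omega
  let ext0 : (Fin (N + 1) → I01) → ℕ → I01 := fun v i => if hi : i < N then v ⟨i, by omega⟩ else 0
  let φ : (Fin (N + 1) → I01) → ℝ := fun v =>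
    perturbedLoss ℓ L υ a b l (ext0 v) + L * (sgn ε * (v (Fin.last N) : ℝ))
  let pts : X × (ℕ → X) → Fin (N + 1) → X := fun p i => if (i : ℕ) < N then p.2 i else p.1
  have hpts : Measurable pts := by
    refine measurable_pi_lambda _ fun i => ?_
    by_cases hi : (i : ℕ) < N
    · simp only [pts, hi, if_true]
      exact (measurable_pi_apply (i : ℕ)).comp measurable_snd
    · simp only [pts, hi, if_false]
      exact measurable_fst
  have hφ : ∀ (h : X → I01) (p : X × (ℕ → X)), φ (fun i => h (pts p i)) =
      perturbedLoss ℓ L υ a b l (fun i => h (p.2 i)) + L * (sgn ε * (h p.1 : ℝ)) := by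
    intro h p
    simp only [φ]
    congr 1
    · refine perturbedLoss_congr (fun i hi => ?_) (fun _ _ => rfl) (fun q hq => ?_)
      · have : i < N := (Finset.mem_Ico.1 hi).2.trans_le hbN
        simp [ext0, pts, this]
      · have := hlN q hq
        simp [ext0, pts, this]
    · simp [pts]
  have key := measurable_iInf_of_traceMeasurable (H := H) hB hT φ (fun x => by
    refine ⟨-(L * l.length) - L, ?_⟩
    rintro _ ⟨h, rfl⟩
    have := neg_le_perturbedLoss hL hℓ υ a b l (ext0 fun i => (h : X → I01) (x i))
    have h2 := mul_le_mul_of_nonneg_left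
      (abs_le.1 (abs_sgn_mul_le ε ((h : X → I01) (x (Fin.last N))))).1 hL.le
    simp only [φ]
    linarith)
  have := key.comp hpts
  simp only [Function.comp_def, hφ] at this
  exact this

lemma measurable_probe (hB : BinaryValued H) (hT : TraceMeasurable H) (hL : 0 < L)
    (hℓ : IsConvexLipschitzLoss ℓ L) (υ : ℕ → I01) (a b : ℕ) (l : List (ℕ × Bool)) :
    Measurable fun p : X × (ℕ → X) => probe H ℓ L υ a b l p.1 p.2 :=
  ((measurable_minLossAt hB hT hL hℓ υ a b l true).add
    (measurable_minLossAt hB hT hL hℓ υ a b l false)).div_const 2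

end measurability

section concentration

variable [MeasurableSpace X]

/-- Hoeffding's lemma, for a function of oscillation `R`. -/
lemma lintegral_exp_sub_integral_le (ν : Measure X) [IsProbabilityMeasure ν] {f : X → ℝ}
    (hf : Measurable f) {a R : ℝ} (hR : 0 ≤ R) (hfa : ∀ x, f x ∈ Set.Icc a (a + R)) (c : ℝ) :
    ∫⁻ x, ENNReal.ofReal (Real.exp (c * (f x - ∫ z, f z ∂ν))) ∂ν ≤
      ENNReal.ofReal (Real.exp (c ^ 2 * R ^ 2 / 8)) := by
  have h := ProbabilityTheory.hasSubgaussianMGF_of_mem_Icc (μ := ν) hf.aemeasurable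
    (Filter.Eventually.of_forall hfa)
  rw [← ofReal_integral_eq_lintegral_ofReal (h.integrable_exp_mul c)
    (Filter.Eventually.of_forall fun _ => (Real.exp_pos _).le)]
  refine ENNReal.ofReal_le_ofReal ((h.mgf_le c).trans_eq ?_)
  congr 1
  simp only [add_sub_cancel_left, NNReal.coe_pow, NNReal.coe_div, coe_nnnorm, Real.norm_eq_abs,
    abs_of_nonneg hR, NNReal.coe_ofNat]
  ring

/-- Coordinatewise Hoeffding bound for a function depending on the other coordinates as
well. -/
lemma lmarginal_exp_sum_le (μ : ℕ → ProbabilityMeasure X) (ν : ProbabilityMeasure X)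
    (S : Finset ℕ) (hμ : ∀ i ∈ S, μ i = ν) {f : (ℕ → X) → X → ℝ}
    (hf : Measurable fun p : X × (ℕ → X) => f p.2 p.1)
    (hdep : ∀ i ∈ S, ∀ ω z, f (Function.update ω i z) = f ω) {R : ℝ} (hR : 0 ≤ R)
    (hosc : ∀ ω, ∃ a, ∀ x, f ω x ∈ Set.Icc a (a + R)) (c : ℝ) (ω : ℕ → X) :
    lmarginal (fun i => (μ i : Measure X)) S (fun ω => ENNReal.ofReal
      (Real.exp (c * ∑ i ∈ S, (f ω (ω i) - ∫ z, f ω z ∂(ν : Measure X))))) ω ≤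
      ENNReal.ofReal (Real.exp (S.card * (c ^ 2 * R ^ 2 / 8))) := by
  classical
  have hm1 : ∀ i : ℕ, Measurable fun ω : ℕ → X => f ω (ω i) := fun i =>
    hf.comp (g := fun p : X × (ℕ → X) => f p.2 p.1) (f := fun ω : ℕ → X => (ω i, ω))
      ((measurable_pi_apply i).prodMk measurable_id)
  have hm2 : Measurable fun ω : ℕ → X => ∫ z, f ω z ∂(ν : Measure X) :=
    (StronglyMeasurable.integral_prod_left' (f := fun p : X × (ℕ → X) => f p.2 p.1)
      hf.stronglyMeasurable).measurable
  have hmeas : ∀ S : Finset ℕ, Measurable fun ω : ℕ → X => ENNReal.ofReal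
      (Real.exp (c * ∑ i ∈ S, (f ω (ω i) - ∫ z, f ω z ∂(ν : Measure X)))) := fun S =>
    (Real.measurable_exp.comp ((Finset.measurable_fun_sum S fun i _ =>
      (hm1 i).sub hm2).const_mul c)).ennreal_ofReal
  induction S using Finset.induction_on generalizing ω with
  | empty => simp
  | insert i S hi ih =>
    rw [lmarginal_insert' _ (hmeas _) hi]
    have hfi : ∀ z, f (Function.update ω i z) = f ω := hdep i (by simp) ω
    -- The coordinate `i` is integrated out first. Resampling it does not change `f`, so its factor
    -- splits off and Hoeffding's lemma applies with the other features frozen.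
    have hinner : ∀ ω : ℕ → X, ∫⁻ z, ENNReal.ofReal (Real.exp (c * ∑ j ∈ insert i S,
        (f (Function.update ω i z) (Function.update ω i z j) -
          ∫ x, f (Function.update ω i z) x ∂(ν : Measure X)))) ∂(μ i : Measure X) ≤
        ENNReal.ofReal (Real.exp (c ^ 2 * R ^ 2 / 8)) * ENNReal.ofReal
          (Real.exp (c * ∑ j ∈ S, (f ω (ω j) - ∫ x, f ω x ∂(ν : Measure X)))) := by
      intro ω
      have e : ∀ z, ENNReal.ofReal (Real.exp (c * ∑ j ∈ insert i S,
          (f (Function.update ω i z) (Function.update ω i z j) -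
            ∫ x, f (Function.update ω i z) x ∂(ν : Measure X)))) =
          ENNReal.ofReal (Real.exp (c * (f ω z - ∫ x, f ω x ∂(ν : Measure X)))) *
          ENNReal.ofReal
            (Real.exp (c * ∑ j ∈ S, (f ω (ω j) - ∫ x, f ω x ∂(ν : Measure X)))) := by
        intro z
        rw [← ENNReal.ofReal_mul (Real.exp_pos _).le, ← Real.exp_add, ← mul_add,
          Finset.sum_insert hi, hdep i (by simp) ω z, Function.update_self]
        congr 4
        refine Finset.sum_congr rfl fun j hj => ?_
        rw [Function.update_of_ne (ne_of_mem_of_not_mem hj hi)]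
      simp only [e]
      rw [lintegral_mul_const', hμ i (by simp)]
      · obtain ⟨a, ha⟩ := hosc ω
        gcongr
        exact lintegral_exp_sub_integral_le (ν : Measure X)
          (hf.comp (measurable_id.prodMk measurable_const)) hR ha c
      · exact ENNReal.ofReal_ne_top
    refine (lmarginal_mono hinner ω).trans ?_
    have : lmarginal (fun i => (μ i : Measure X)) S (fun ω =>
        ENNReal.ofReal (Real.exp (c ^ 2 * R ^ 2 / 8)) * ENNReal.ofReal
          (Real.exp (c * ∑ j ∈ S, (f ω (ω j) - ∫ x, f ω x ∂(ν : Measure X))))) ω =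
        ENNReal.ofReal (Real.exp (c ^ 2 * R ^ 2 / 8)) *
        lmarginal (fun i => (μ i : Measure X)) S (fun ω => ENNReal.ofReal
          (Real.exp (c * ∑ j ∈ S, (f ω (ω j) - ∫ x, f ω x ∂(ν : Measure X))))) ω := by
      unfold lmarginal
      rw [lintegral_const_mul' _ _ ENNReal.ofReal_ne_top]
    rw [this]
    refine (mul_le_mul_right (ih (fun j hj => hμ j (by simp [hj]))
      (fun j hj => hdep j (by simp [hj])) ω) _).trans_eq ?_
    rw [← ENNReal.ofReal_mul (Real.exp_pos _).le, ← Real.exp_add, Finset.card_insert_of_notMem hi]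
    congr 2
    push_cast
    ring

end concentration

end

end Hybrid

/-! ### Deviations of the pool mean, uniformly over labels -/

namespace Hybrid

noncomputable section

variable {X : Type*}

/-- The labels on the rounds `a, …, b - 1` given by the multiples `g i / N`. -/
def gridLabels (N a b : ℕ) (g : Fin (b - a) → Fin (N + 1)) (i : ℕ) : I01 :=
  if h : a ≤ i ∧ i < b then clamp ((g ⟨i - a, by omega⟩ : ℕ) / N) else 0

lemma exists_gridLabels_near {N : ℕ} (hN : 0 < N) (a b : ℕ) (υ : ℕ → I01) :
    ∃ g, ∀ i ∈ Finset.Ico a b, |(υ i : ℝ) - gridLabels N a b g i| ≤ 1 / N := by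
  have hN' : (0 : ℝ) < N := by exact_mod_cast hN
  have hfl : ∀ i, ⌊(N : ℝ) * υ i⌋₊ < N + 1 := fun i => by
    rw [Nat.lt_succ_iff, ← Nat.cast_le (α := ℝ)]
    exact (Nat.floor_le (mul_nonneg hN'.le (υ i).2.1)).trans
      (mul_le_of_le_one_right hN'.le (υ i).2.2)
  refine ⟨fun j => ⟨⌊(N : ℝ) * υ (a + j)⌋₊, hfl _⟩, fun i hi => ?_⟩
  rw [Finset.mem_Ico] at hi
  simp only [gridLabels, hi, dite_true, and_self]
  have e : a + (i - a) = i := by omega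
  rw [e]
  have h1 := Nat.floor_le (mul_nonneg hN'.le (υ i).2.1)
  have h2 := Nat.lt_floor_add_one ((N : ℝ) * υ i)
  have h3 : (⌊(N : ℝ) * υ i⌋₊ : ℝ) ≤ N := by exact_mod_cast Nat.lt_succ_iff.1 (hfl i)
  rw [coe_clamp ⟨by positivity, by rwa [div_le_one hN']⟩, abs_le]
  constructor
  · have : (⌊(N : ℝ) * υ i⌋₊ : ℝ) / N ≤ υ i := by rw [div_le_iff₀ hN']; linarith
    have : 0 ≤ 1 / (N : ℝ) := by positivity
    linarith
  · rw [sub_le_iff_le_add, ← add_div, le_div_iff₀ hN']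
    linarith

variable [MeasurableSpace X] {H : Set (X → I01)} {ℓ : ℝ → ℝ → ℝ} {L : ℝ}

/-- Deviation of the empirical mean of `probe` over the pool `S` from its mean. -/
def deviation (H : Set (X → I01)) (ℓ : ℝ → ℝ → ℝ) (L : ℝ) (ν : ProbabilityMeasure X)
    (S : Finset ℕ) (a b : ℕ) (l : List (ℕ × Bool)) (υ : ℕ → I01) (ω : ℕ → X) : ℝ :=
  (∑ i ∈ S, (probe H ℓ L υ a b l (ω i) ω - ∫ z, probe H ℓ L υ a b l z ω ∂(ν : Measure X)))
    / S.card

/-- Exponential moment of the deviations, summed over a grid of labels. -/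
def expDeviation (H : Set (X → I01)) (ℓ : ℝ → ℝ → ℝ) (L : ℝ) (ν : ProbabilityMeasure X)
    (S : Finset ℕ) (a b k N : ℕ) (c : ℝ) (ω : ℕ → X) : ℝ :=
  avgDraws S k fun l => ∑ g : Fin (b - a) → Fin (N + 1),
    Real.exp (c * deviation H ℓ L ν S a b l (gridLabels N a b g) ω)

lemma integrable_probe (hH : H.Nonempty) (hB : BinaryValued H) (hT : TraceMeasurable H)
    (hL : 0 < L) (hℓ : IsConvexLipschitzLoss ℓ L) (ν : Measure X) [IsProbabilityMeasure ν]
    (υ : ℕ → I01) (a b : ℕ) (l : List (ℕ × Bool)) (ω : ℕ → X) :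
    Integrable (fun z => probe H ℓ L υ a b l z ω) ν :=
  Integrable.of_mem_Icc _ _
    ((measurable_probe hB hT hL hℓ υ a b l).comp
      (measurable_id.prodMk measurable_const)).aemeasurable
    (Filter.Eventually.of_forall fun z => probe_mem hH hL hℓ υ a b l z ω)

lemma deviation_le_deviation (hH : H.Nonempty) (hB : BinaryValued H) (hT : TraceMeasurable H)
    (hL : 0 < L) (hℓ : IsConvexLipschitzLoss ℓ L) (ν : ProbabilityMeasure X) {S : Finset ℕ}
    (hS : S.Nonempty) {a b : ℕ} (l : List (ℕ × Bool)) {υ υ' : ℕ → I01} {δ : ℝ}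
    (hδ : ∀ i ∈ Finset.Ico a b, |(υ i : ℝ) - υ' i| ≤ δ) (ω : ℕ → X) :
    deviation H ℓ L ν S a b l υ ω ≤
      deviation H ℓ L ν S a b l υ' ω + 2 * ((b - a : ℕ) * (L * δ)) := by
  have hc : (0 : ℝ) < S.card := by exact_mod_cast hS.card_pos
  have hδ' : ∀ i ∈ Finset.Ico a b, |(υ' i : ℝ) - υ i| ≤ δ := fun i hi => by
    rw [abs_sub_comm]; exact hδ i hi
  have h1 : ∫ z, probe H ℓ L υ' a b l z ω ∂(ν : Measure X) ≤
      ∫ z, probe H ℓ L υ a b l z ω ∂(ν : Measure X) + (b - a : ℕ) * (L * δ) := by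
    have := integral_mono (integrable_probe hH hB hT hL hℓ (ν : Measure X) υ' a b l ω)
      ((integrable_probe hH hB hT hL hℓ (ν : Measure X) υ a b l ω).add
        (integrable_const ((b - a : ℕ) * (L * δ))))
      fun z => abs_probe_sub_le hH hL hℓ l z ω hδ'
    simp only [Pi.add_apply] at this
    rw [integral_add (integrable_probe hH hB hT hL hℓ (ν : Measure X) υ a b l ω)
      (integrable_const _)] at this
    simpa using this
  unfold deviation
  rw [div_add' _ _ _ hc.ne']
  gcongr
  have h2 : ∀ i ∈ S, probe H ℓ L υ a b l (ω i) ω -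
        ∫ z, probe H ℓ L υ a b l z ω ∂(ν : Measure X) ≤
      (probe H ℓ L υ' a b l (ω i) ω - ∫ z, probe H ℓ L υ' a b l z ω ∂(ν : Measure X)) +
        2 * ((b - a : ℕ) * (L * δ)) := by
    intro i _
    have := abs_probe_sub_le hH hL hℓ l (ω i) ω hδ
    linarith
  refine (Finset.sum_le_sum h2).trans_eq ?_
  rw [Finset.sum_add_distrib, Finset.sum_const, nsmul_eq_mul]
  ring

/-- The labels may have been chosen with knowledge of the pool, so they are rounded to the grid and
dominated by a sum over all grid labellings. What remains on the right depends on features only, and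
linearly on `expDeviation`, which lets it be averaged over features later. -/
lemma avgDraws_deviation_le (hH : H.Nonempty) (hB : BinaryValued H) (hT : TraceMeasurable H)
    (hL : 0 < L) (hℓ : IsConvexLipschitzLoss ℓ L) (ν : ProbabilityMeasure X) {S : Finset ℕ}
    (hS : S.Nonempty) (a b k : ℕ) {N : ℕ} (hN : 0 < N) {c A : ℝ} (hc : 0 < c) (hA : 0 < A)
    (υ : ℕ → I01) (ω : ℕ → X) :
    avgDraws S k (fun l => deviation H ℓ L ν S a b l υ ω) ≤
      (Real.log A - 1) / c + expDeviation H ℓ L ν S a b k N c ω / (c * A)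
        + 2 * ((b - a : ℕ) * (L * (1 / N))) := by
  obtain ⟨g, hg⟩ := exists_gridLabels_near hN a b υ
  set W : List (ℕ × Bool) → ℝ := fun l => ∑ g : Fin (b - a) → Fin (N + 1),
    Real.exp (c * deviation H ℓ L ν S a b l (gridLabels N a b g) ω) with hW
  have key : ∀ l : List (ℕ × Bool), deviation H ℓ L ν S a b l υ ω ≤
      (c * A)⁻¹ * W l + ((Real.log A - 1) / c + 2 * ((b - a : ℕ) * (L * (1 / N)))) := by
    intro l
    have h1 := deviation_le_deviation hH hB hT hL hℓ ν hS l hg ω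
    have h2 := le_log_add_div_sub_one hA
      (u := c * deviation H ℓ L ν S a b l (gridLabels N a b g) ω) (W := W l)
      (Finset.single_le_sum (f := fun g : Fin (b - a) → Fin (N + 1) =>
        Real.exp (c * deviation H ℓ L ν S a b l (gridLabels N a b g) ω))
        (fun _ _ => (Real.exp_pos _).le) (Finset.mem_univ g))
    have h3 : deviation H ℓ L ν S a b l (gridLabels N a b g) ω ≤
        (Real.log A + W l / A - 1) / c := by
      rw [le_div_iff₀ hc]; linarith
    have h4 : (Real.log A + W l / A - 1) / c = (c * A)⁻¹ * W l + (Real.log A - 1) / c := by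
      field_simp; ring
    linarith
  refine (avgDraws_mono fun l _ _ => key l).trans_eq ?_
  rw [avgDraws_add, avgDraws_const hS, avgDraws_mul_left]
  unfold expDeviation
  rw [← hW]
  ring

lemma measurable_deviation (hB : BinaryValued H) (hT : TraceMeasurable H) (hL : 0 < L)
    (hℓ : IsConvexLipschitzLoss ℓ L) (ν : ProbabilityMeasure X) (S : Finset ℕ) (a b : ℕ)
    (l : List (ℕ × Bool)) (υ : ℕ → I01) :
    Measurable fun ω : ℕ → X => deviation H ℓ L ν S a b l υ ω := by
  have hm := measurable_probe hB hT hL hℓ υ a b l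
  have hm2 : Measurable fun ω : ℕ → X => ∫ z, probe H ℓ L υ a b l z ω ∂(ν : Measure X) :=
    (StronglyMeasurable.integral_prod_left'
      (f := fun p : X × (ℕ → X) => probe H ℓ L υ a b l p.1 p.2) hm.stronglyMeasurable).measurable
  refine (Finset.measurable_fun_sum S fun i _ => Measurable.sub ?_ hm2).div_const _
  exact hm.comp (f := fun ω : ℕ → X => (ω i, ω)) ((measurable_pi_apply i).prodMk measurable_id)

lemma measurable_avgDraws {S : Finset ℕ} {k : ℕ} {Y : Type*} [MeasurableSpace Y]
    {φ : List (ℕ × Bool) → Y → ℝ} (hφ : ∀ l, Measurable (φ l)) :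
    Measurable fun y => avgDraws S k fun l => φ l y := by
  induction k generalizing φ with
  | zero => exact hφ []
  | succ k ih =>
    exact ih fun l => (Finset.measurable_fun_sum S fun i _ =>
      ((hφ _).add (hφ _)).div_const 2).div_const _

lemma lintegral_avgDraws_le {S : Finset ℕ} (hS : S.Nonempty) {k : ℕ} {Y : Type*}
    [MeasurableSpace Y] (P : Measure Y) {φ : List (ℕ × Bool) → Y → ℝ}
    (hφ : ∀ l, Measurable (φ l)) (h0 : ∀ l y, 0 ≤ φ l y) {C : ℝ} (hC : 0 ≤ C)
    (h : ∀ l : List (ℕ × Bool), l.length = k → (∀ p ∈ l, p.1 ∈ S) →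
      ∫⁻ y, ENNReal.ofReal (φ l y) ∂P ≤ ENNReal.ofReal C) :
    ∫⁻ y, ENNReal.ofReal (avgDraws S k fun l => φ l y) ∂P ≤ ENNReal.ofReal C := by
  induction k generalizing φ with
  | zero => exact h [] rfl (by simp)
  | succ k ih =>
    have hc : (0 : ℝ) < S.card := by exact_mod_cast hS.card_pos
    refine ih (φ := fun l y => (∑ i ∈ S, (φ ((i, true) :: l) y + φ ((i, false) :: l) y) / 2)
      / S.card) (fun l => (Finset.measurable_fun_sum S fun i _ =>
      ((hφ _).add (hφ _)).div_const 2).div_const _) (fun l y => div_nonneg (Finset.sum_nonneg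
      fun i _ => div_nonneg (add_nonneg (h0 _ _) (h0 _ _)) zero_le_two) hc.le)
      fun l hl hlS => ?_
    have e : ∀ y, ENNReal.ofReal ((∑ i ∈ S, (φ ((i, true) :: l) y + φ ((i, false) :: l) y) / 2)
        / S.card) = ENNReal.ofReal (1 / (2 * S.card)) * ∑ i ∈ S,
          (ENNReal.ofReal (φ ((i, true) :: l) y) + ENNReal.ofReal (φ ((i, false) :: l) y)) := by
      intro y
      have : ∀ i ∈ S, ENNReal.ofReal (φ ((i, true) :: l) y) +
          ENNReal.ofReal (φ ((i, false) :: l) y) =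
          ENNReal.ofReal (φ ((i, true) :: l) y + φ ((i, false) :: l) y) :=
        fun i _ => (ENNReal.ofReal_add (h0 _ _) (h0 _ _)).symm
      rw [Finset.sum_congr rfl this, ← ENNReal.ofReal_sum_of_nonneg
        (fun i _ => add_nonneg (h0 _ _) (h0 _ _)), ← ENNReal.ofReal_mul (by positivity),
        ← Finset.sum_div]
      congr 1
      field_simp
    have hm : ∀ i, Measurable fun y => ENNReal.ofReal (φ ((i, true) :: l) y) +
        ENNReal.ofReal (φ ((i, false) :: l) y) := fun i =>
      (hφ _).ennreal_ofReal.add (hφ _).ennreal_ofReal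
    simp only [e]
    rw [lintegral_const_mul' _ _ ENNReal.ofReal_ne_top,
      lintegral_finsetSum _ fun i _ => hm i]
    have h2 : ∀ i ∈ S, ∫⁻ y, (ENNReal.ofReal (φ ((i, true) :: l) y) +
        ENNReal.ofReal (φ ((i, false) :: l) y)) ∂P ≤ ENNReal.ofReal (2 * C) := by
      intro i hi
      rw [lintegral_add_left (hφ _).ennreal_ofReal, two_mul, ENNReal.ofReal_add hC hC]
      exact add_le_add (h _ (by simp [hl]) (List.forall_mem_cons.2 ⟨hi, hlS⟩))
        (h _ (by simp [hl]) (List.forall_mem_cons.2 ⟨hi, hlS⟩))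
    refine (mul_le_mul_right (Finset.sum_le_sum h2) _).trans_eq ?_
    rw [Finset.sum_const, nsmul_eq_mul, ← ENNReal.ofReal_natCast, ← ENNReal.ofReal_mul hc.le,
      ← ENNReal.ofReal_mul (by positivity)]
    congr 1
    field_simp

lemma lmarginal_const_le (μ : ℕ → ProbabilityMeasure X) (S : Finset ℕ) (c : ENNReal)
    (ω : ℕ → X) : lmarginal (fun i => (μ i : Measure X)) S (fun _ => c) ω ≤ c := by
  unfold lmarginal
  simp

/-- A drawn pool feature also enters `probe` through the perturbation, so it is not independent of
the function being averaged. There are at most `l.length` such features, each contributing at most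
`L`; Hoeffding's bound handles the others. -/
lemma lmarginal_exp_deviation_le (hH : H.Nonempty) (hB : BinaryValued H)
    (hT : TraceMeasurable H) (hL : 0 < L) (hℓ : IsConvexLipschitzLoss ℓ L)
    (μ : ℕ → ProbabilityMeasure X) (ν : ProbabilityMeasure X) {S : Finset ℕ} (hS : S.Nonempty)
    (hμ : ∀ i ∈ S, μ i = ν) {a b : ℕ} (hab : a ≤ b) (hSa : ∀ i ∈ S, i < a)
    (l : List (ℕ × Bool)) (υ : ℕ → I01) {c : ℝ} (hc : 0 < c) (ω : ℕ → X) :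
    lmarginal (fun i => (μ i : Measure X)) (Finset.range b) (fun ω => ENNReal.ofReal
      (Real.exp (c * deviation H ℓ L ν S a b l υ ω))) ω ≤
    ENNReal.ofReal (Real.exp (c * L * l.length / S.card + c ^ 2 * L ^ 2 / (8 * S.card))) := by
  classical
  have hcard : (0 : ℝ) < S.card := by exact_mod_cast hS.card_pos
  set R := S \ (l.map Prod.fst).toFinset with hR
  have hRS : R ⊆ S := Finset.sdiff_subset
  have hRb : R ⊆ Finset.range b := fun i hi =>
    Finset.mem_range.2 ((hSa i (hRS hi)).trans_le hab)
  have hm := measurable_deviation hB hT hL hℓ ν S a b l υ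
  set f : (ℕ → X) → X → ℝ := fun ω x => probe H ℓ L υ a b l x ω with hf
  have hfm : Measurable fun p : X × (ℕ → X) => f p.2 p.1 := measurable_probe hB hT hL hℓ υ a b l
  have hmem : ∀ ω x, f ω x ∈ Set.Icc (minLoss H ℓ L υ a b l ω - L / 2)
      (minLoss H ℓ L υ a b l ω - L / 2 + L) := fun ω x => by
    have h1 := (probe_mem hH hL hℓ υ a b l x ω).1
    have h2 := (probe_mem hH hL hℓ υ a b l x ω).2
    constructor <;> simp only [hf] <;> linarith
  have hint : ∀ ω i, f ω (ω i) - ∫ z, f ω z ∂(ν : Measure X) ≤ L := by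
    intro ω i
    have h1 := integral_mono (integrable_const (minLoss H ℓ L υ a b l ω - L / 2))
      (integrable_probe hH hB hT hL hℓ (ν : Measure X) υ a b l ω) fun z => (hmem ω z).1
    simp only [integral_const, probReal_univ, smul_eq_mul, one_mul] at h1
    have h2 := (hmem ω (ω i)).2
    simp only [hf] at h2 ⊢
    linarith
  have hpt : ∀ ω, c * deviation H ℓ L ν S a b l υ ω ≤ c * L * l.length / S.card +
      c / S.card * ∑ i ∈ R, (f ω (ω i) - ∫ z, f ω z ∂(ν : Measure X)) := by
    intro ω
    have h1 : ∑ i ∈ S \ R, (f ω (ω i) - ∫ z, f ω z ∂(ν : Measure X)) ≤ l.length * L := by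
      refine (Finset.sum_le_sum fun i _ => hint ω i).trans ?_
      rw [Finset.sum_const, nsmul_eq_mul]
      refine mul_le_mul_of_nonneg_right ?_ hL.le
      have : S \ R ⊆ (l.map Prod.fst).toFinset := by
        intro i hi
        simp only [hR, Finset.mem_sdiff, not_and, not_not] at hi
        exact hi.2 hi.1
      have h := (Finset.card_le_card this).trans (List.toFinset_card_le _)
      rw [List.length_map] at h
      exact_mod_cast h
    have h2 := Finset.sum_sdiff (f := fun i => f ω (ω i) - ∫ z, f ω z ∂(ν : Measure X)) hRS
    have h3 : deviation H ℓ L ν S a b l υ ω =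
        (∑ i ∈ S \ R, (f ω (ω i) - ∫ z, f ω z ∂(ν : Measure X)) +
          ∑ i ∈ R, (f ω (ω i) - ∫ z, f ω z ∂(ν : Measure X))) / S.card := by
      rw [h2]; rfl
    rw [h3]
    calc _ = c / S.card * ∑ i ∈ S \ R, (f ω (ω i) - ∫ z, f ω z ∂(ν : Measure X)) +
          c / S.card * ∑ i ∈ R, (f ω (ω i) - ∫ z, f ω z ∂(ν : Measure X)) := by ring
      _ ≤ c / S.card * (l.length * L) +
          c / S.card * ∑ i ∈ R, (f ω (ω i) - ∫ z, f ω z ∂(ν : Measure X)) := by gcongr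
      _ = _ := by ring
  have hm' : Measurable fun ω : ℕ → X => ENNReal.ofReal
      (Real.exp (c * deviation H ℓ L ν S a b l υ ω)) :=
    (Real.measurable_exp.comp (hm.const_mul c)).ennreal_ofReal
  -- The undrawn pool coordinates are integrated first, with the rest frozen; the resulting bound is
  -- constant, so the outer marginal is harmless.
  rw [← Finset.sdiff_union_of_subset hRb, lmarginal_union _ _ hm' Finset.sdiff_disjoint]
  refine (lmarginal_mono (fun ω => ?_) ω).trans (lmarginal_const_le μ _ _ ω)
  have h1 : ∀ ω, ENNReal.ofReal (Real.exp (c * deviation H ℓ L ν S a b l υ ω)) ≤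
      ENNReal.ofReal (Real.exp (c * L * l.length / S.card)) * ENNReal.ofReal (Real.exp
        (c / S.card * ∑ i ∈ R, (f ω (ω i) - ∫ z, f ω z ∂(ν : Measure X)))) := by
    intro ω
    rw [← ENNReal.ofReal_mul (Real.exp_pos _).le, ← Real.exp_add]
    exact ENNReal.ofReal_le_ofReal (Real.exp_le_exp.2 (hpt ω))
  refine (lmarginal_mono h1 ω).trans ?_
  have h2 := lmarginal_exp_sum_le μ ν R (fun i hi => hμ i (hRS hi)) hfm
    (fun i hi ω z => by
      ext x
      have hia := hSa i (hRS hi)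
      have hil : ∀ p ∈ l, p.1 ≠ i := by
        rintro p hp rfl
        simp only [hR, Finset.mem_sdiff, List.mem_toFinset] at hi
        exact hi.2 (List.mem_map.2 ⟨p, hp, rfl⟩)
      refine probe_congr (fun j hj => ?_) (fun _ _ => rfl) fun p hp => ?_
      · rw [Function.update_of_ne (hia.trans_le (Finset.mem_Ico.1 hj).1).ne']
      · rw [Function.update_of_ne (hil p hp)])
    hL.le (fun ω => ⟨_, hmem ω⟩) (c / S.card) ω
  have h3 : lmarginal (fun i => (μ i : Measure X)) R (fun ω =>
      ENNReal.ofReal (Real.exp (c * L * l.length / S.card)) * ENNReal.ofReal (Real.exp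
        (c / S.card * ∑ i ∈ R, (f ω (ω i) - ∫ z, f ω z ∂(ν : Measure X))))) ω =
      ENNReal.ofReal (Real.exp (c * L * l.length / S.card)) *
      lmarginal (fun i => (μ i : Measure X)) R (fun ω => ENNReal.ofReal (Real.exp
        (c / S.card * ∑ i ∈ R, (f ω (ω i) - ∫ z, f ω z ∂(ν : Measure X))))) ω := by
    unfold lmarginal
    rw [lintegral_const_mul' _ _ ENNReal.ofReal_ne_top]
  rw [h3]
  refine (mul_le_mul_right h2 _).trans ?_
  rw [← ENNReal.ofReal_mul (Real.exp_pos _).le, ← Real.exp_add]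
  refine ENNReal.ofReal_le_ofReal (Real.exp_le_exp.2 (add_le_add le_rfl ?_))
  have hRcard : (R.card : ℝ) ≤ S.card := by exact_mod_cast Finset.card_le_card hRS
  calc (R.card : ℝ) * ((c / S.card) ^ 2 * L ^ 2 / 8)
      ≤ S.card * ((c / S.card) ^ 2 * L ^ 2 / 8) := by gcongr
    _ = _ := by field_simp

lemma expDeviation_nonneg (ν : ProbabilityMeasure X) {S : Finset ℕ} (hS : S.Nonempty)
    (a b k N : ℕ) (c : ℝ) (ω : ℕ → X) : 0 ≤ expDeviation H ℓ L ν S a b k N c ω := by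
  rw [← avgDraws_const hS k 0]
  exact avgDraws_mono fun l _ _ => Finset.sum_nonneg fun _ _ => (Real.exp_pos _).le

lemma measurable_expDeviation (hB : BinaryValued H) (hT : TraceMeasurable H) (hL : 0 < L)
    (hℓ : IsConvexLipschitzLoss ℓ L) (ν : ProbabilityMeasure X) (S : Finset ℕ) (a b k N : ℕ)
    (c : ℝ) : Measurable fun ω : ℕ → X => expDeviation H ℓ L ν S a b k N c ω :=
  measurable_avgDraws fun l => Finset.measurable_fun_sum _ fun _ _ =>
    Real.measurable_exp.comp ((measurable_deviation hB hT hL hℓ ν S a b l _).const_mul c)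

/-- A union bound: each of the `(N + 1) ^ (b - a)` grid labellings is fixed in advance, so the
previous estimate applies to each separately. -/
lemma lmarginal_expDeviation_le (hH : H.Nonempty) (hB : BinaryValued H)
    (hT : TraceMeasurable H) (hL : 0 < L) (hℓ : IsConvexLipschitzLoss ℓ L)
    (μ : ℕ → ProbabilityMeasure X) (ν : ProbabilityMeasure X) {S : Finset ℕ} (hS : S.Nonempty)
    (hμ : ∀ i ∈ S, μ i = ν) {a b : ℕ} (hab : a ≤ b) (hSa : ∀ i ∈ S, i < a)
    (k N : ℕ) {c : ℝ} (hc : 0 < c) (ω : ℕ → X) :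
    lmarginal (fun i => (μ i : Measure X)) (Finset.range b) (fun ω => ENNReal.ofReal
      (expDeviation H ℓ L ν S a b k N c ω)) ω ≤
    ENNReal.ofReal ((N + 1) ^ (b - a) *
      Real.exp (c * L * k / S.card + c ^ 2 * L ^ 2 / (8 * S.card))) := by
  have hm : ∀ l υ, Measurable fun ω : ℕ → X =>
      Real.exp (c * deviation H ℓ L ν S a b l υ ω) := fun l υ =>
    Real.measurable_exp.comp ((measurable_deviation hB hT hL hℓ ν S a b l υ).const_mul c)
  have hup : Measurable fun y : (∀ _ : Finset.range b, X) =>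
    Function.updateFinset ω (Finset.range b) y := measurable_updateFinset
  refine lintegral_avgDraws_le hS _ (φ := fun l y => ∑ g : Fin (b - a) → Fin (N + 1),
    Real.exp (c * deviation H ℓ L ν S a b l (gridLabels N a b g)
      (Function.updateFinset ω (Finset.range b) y)))
    (fun l => Finset.measurable_fun_sum _ fun g _ => (hm l _).comp hup)
    (fun l y => Finset.sum_nonneg fun _ _ => (Real.exp_pos _).le) (by positivity)
    fun l hl _ => ?_
  simp only [ENNReal.ofReal_sum_of_nonneg fun _ _ => (Real.exp_pos _).le]
  have hm' : ∀ g, Measurable fun y : (∀ _ : Finset.range b, X) => ENNReal.ofReal (Real.exp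
      (c * deviation H ℓ L ν S a b l (gridLabels N a b g)
        (Function.updateFinset ω (Finset.range b) y))) := fun g =>
    ((hm l (gridLabels N a b g)).comp hup).ennreal_ofReal
  rw [lintegral_finsetSum _ fun g _ => hm' g]
  refine (Finset.sum_le_sum fun g _ => lmarginal_exp_deviation_le hH hB hT hL hℓ μ ν hS hμ hab
    hSa l (gridLabels N a b g) hc ω).trans_eq ?_
  rw [Finset.sum_const, nsmul_eq_mul, ← ENNReal.ofReal_natCast,
    ← ENNReal.ofReal_mul (by positivity), hl]
  congr 2
  simp

/-- The trivial estimate from the oscillation of `probe`; it pays for rounds whose pool has the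
wrong law. -/
lemma deviation_le (hH : H.Nonempty) (hB : BinaryValued H)
    (hT : TraceMeasurable H) (hL : 0 < L) (hℓ : IsConvexLipschitzLoss ℓ L)
    (ν : ProbabilityMeasure X) {S : Finset ℕ} (hS : S.Nonempty) (a b : ℕ) (l : List (ℕ × Bool))
    (υ : ℕ → I01) (ω : ℕ → X) : deviation H ℓ L ν S a b l υ ω ≤ L := by
  have hcard : (0 : ℝ) < S.card := by exact_mod_cast hS.card_pos
  unfold deviation
  rw [div_le_iff₀ hcard]
  refine (Finset.sum_le_card_nsmul _ _ L fun i _ => ?_).trans_eq (by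
    rw [nsmul_eq_mul, mul_comm])
  have h1 := integral_mono (integrable_const (minLoss H ℓ L υ a b l ω - L / 2))
    (integrable_probe hH hB hT hL hℓ (ν : Measure X) υ a b l ω)
    fun z => (probe_mem hH hL hℓ υ a b l z ω).1
  simp only [integral_const, probReal_univ, smul_eq_mul, one_mul] at h1
  have h2 := (probe_mem hH hL hℓ υ a b l (ω i) ω).2
  linarith

/-- A crude pointwise bound whose role is to keep the expected future costs finite. -/
lemma expDeviation_le (hH : H.Nonempty) (hB : BinaryValued H)
    (hT : TraceMeasurable H) (hL : 0 < L) (hℓ : IsConvexLipschitzLoss ℓ L)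
    (ν : ProbabilityMeasure X) {S : Finset ℕ} (hS : S.Nonempty) (a b k N : ℕ) {c : ℝ}
    (hc : 0 < c) (ω : ℕ → X) :
    expDeviation H ℓ L ν S a b k N c ω ≤ (N + 1) ^ (b - a) * Real.exp (c * L) := by
  rw [← avgDraws_const hS k ((N + 1) ^ (b - a) * Real.exp (c * L))]
  refine avgDraws_mono fun l _ _ => ?_
  refine (Finset.sum_le_sum fun g _ => Real.exp_le_exp.2 (mul_le_mul_of_nonneg_left
    (deviation_le hH hB hT hL hℓ ν hS a b l (gridLabels N a b g) ω) hc.le)).trans_eq ?_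
  simp

end

end Hybrid

/-! ### Blocks, pools and the potential -/

namespace Hybrid

noncomputable section

variable {X : Type*}

/-- First round of the block of length `s` which contains the round `t`. -/
def blockStart (s t : ℕ) : ℕ := s * (t / s)

/-- The `s ^ 2` rounds before the block of the round `t`. -/
def pool (s t : ℕ) : Finset ℕ := Finset.Ico (blockStart s t - s ^ 2) (blockStart s t)

lemma blockStart_le (s t : ℕ) : blockStart s t ≤ t := Nat.mul_div_le t s

lemma lt_blockStart_add {s : ℕ} (hs : 0 < s) (t : ℕ) : t < blockStart s t + s := by
  have := Nat.lt_mul_div_succ t hs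
  unfold blockStart
  linarith

/-- `s ^ 2` is itself a multiple of `s`, hence the start of a block. From then on the truncated
subtraction in `pool` never truncates. -/
lemma le_blockStart {s t : ℕ} (ht : s ^ 2 ≤ t) : s ^ 2 ≤ blockStart s t := by
  rcases Nat.eq_zero_or_pos s with rfl | hs
  · simp
  rw [blockStart, sq]
  exact Nat.mul_le_mul_left s ((Nat.le_div_iff_mul_le hs).2 (by rwa [← sq]))

lemma blockStart_eq {s t q : ℕ} (h1 : s * q ≤ t) (h2 : t < s * q + s) : blockStart s t = s * q := by
  rw [blockStart, Nat.div_eq_of_lt_le (k := q) (by rwa [mul_comm])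
    (by rw [Nat.succ_mul, mul_comm]; exact h2)]

lemma blockStart_of_dvd {s t : ℕ} (h : s ∣ t) : blockStart s t = t := Nat.mul_div_cancel' h

lemma blockStart_succ {s t : ℕ} (hs : 0 < s) (h : ¬ s ∣ t + 1) :
    blockStart s (t + 1) = blockStart s t := by
  refine blockStart_eq ((blockStart_le s t).trans (Nat.le_succ t)) ?_
  have h1 := lt_blockStart_add hs t
  rw [blockStart] at h1
  rcases Nat.lt_or_ge (t + 1) (s * (t / s) + s) with h2 | h2
  · exact h2
  · exact absurd ⟨t / s + 1, by rw [mul_add, mul_one]; omega⟩ h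

lemma add_one_eq_of_dvd {s t : ℕ} (hs : 0 < s) (h : s ∣ t + 1) : t + 1 = blockStart s t + s := by
  have h1 := lt_blockStart_add hs t
  have h2 : s ∣ blockStart s t := Dvd.intro _ rfl
  have h3 := blockStart_le s t
  have h4 : s ∣ t + 1 - blockStart s t := Nat.dvd_sub h h2
  have := Nat.le_of_dvd (by omega) h4
  omega

lemma card_pool {s t : ℕ} (ht : s ^ 2 ≤ t) : (pool s t).card = s ^ 2 := by
  have := le_blockStart ht
  rw [pool, Nat.card_Ico]
  omega

lemma pool_nonempty {s t : ℕ} (hs : 0 < s) (ht : s ^ 2 ≤ t) : (pool s t).Nonempty := by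
  rw [← Finset.card_pos, card_pool ht]
  positivity

lemma lt_of_mem_pool {s t i : ℕ} (hi : i ∈ pool s t) : i < blockStart s t :=
  (Finset.mem_Ico.1 hi).2

/-- The learner's potential: the regret on the finished blocks plus the expected perturbed regret
on the current one. -/
def potential (H : Set (X → I01)) (ℓ : ℝ → ℝ → ℝ) (L : ℝ) (s t : ℕ) (ω : ℕ → X)
    (υ : ℕ → I01) : ℝ :=
  if s ^ 2 ≤ t then
    -minLoss H ℓ L υ 0 (blockStart s t) [] ω -
      avgDraws (pool s t) (s - (t - blockStart s t)) fun l =>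
        minLoss H ℓ L υ (blockStart s t) t l ω
  else -minLoss H ℓ L υ 0 t [] ω

/-- The potential after the learner has seen the feature `x` and predicted. -/
def midPotential (H : Set (X → I01)) (ℓ : ℝ → ℝ → ℝ) (L : ℝ) (s t : ℕ) (ω : ℕ → X)
    (υ : ℕ → I01) (x : X) : ℝ :=
  if s ^ 2 ≤ t then
    -minLoss H ℓ L υ 0 (blockStart s t) [] ω -
      avgDraws (pool s t) (s - 1 - (t - blockStart s t)) fun l =>
        probe H ℓ L υ (blockStart s t) t l x ω
  else -minLoss H ℓ L υ 0 t [] ω + L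

/-- After `s ^ 2` rounds, the expected loss is that of the predictions computed from the current
block and random draws from the pool. -/
def IsPlayoutRule (H : Set (X → I01)) (ℓ : ℝ → ℝ → ℝ) (L : ℝ) (s : ℕ) (Φ : PredictionRule X) :
    Prop :=
  ∀ (x₀ : X) (hist : List (X × I01)) (x : X) (y : I01), s ^ 2 ≤ hist.length →
    pmfExp (Φ hist x) (fun p => ℓ p y) =
      avgDraws (pool s hist.length) (s - 1 - (hist.length - blockStart s hist.length)) fun l =>
        ℓ (clamp (prediction H ℓ L (labelSeq hist) (blockStart s hist.length) hist.length l x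
          (featSeq x₀ hist))) y

section steps

variable {H : Set (X → I01)} {ℓ : ℝ → ℝ → ℝ} {L : ℝ}

lemma minLoss_update (υ : ℕ → I01) {a b t : ℕ} (hb : b ≤ t) {l : List (ℕ × Bool)}
    (hl : ∀ p ∈ l, p.1 ≠ t) (ω : ℕ → X) (x : X) (y : I01) :
    minLoss H ℓ L (Function.update υ t y) a b l (Function.update ω t x) =
      minLoss H ℓ L υ a b l ω := by
  refine minLoss_congr (fun i hi => ?_) (fun i hi => ?_) fun p hp => ?_
  · rw [Function.update_of_ne ((Finset.mem_Ico.1 hi).2.trans_le hb).ne]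
  · rw [Function.update_of_ne ((Finset.mem_Ico.1 hi).2.trans_le hb).ne]
  · rw [Function.update_of_ne (hl p hp)]

/-- At the first round of a block no loss has accrued and all `s` draws remain, so the perturbed
term is pure noise, priced by Massart's bound. -/
lemma potential_le_of_dvd (hH : H.Nonempty) (hB : BinaryValued H) (hL : 0 < L) {d : ℕ}
    (hd : vcDim H = d) {s t : ℕ} (hs : 0 < s) (ht : s ^ 2 ≤ t) (hst : s ∣ t) {η : ℝ} (hη : 0 < η)
    (ω : ℕ → X) (υ : ℕ → I01) :
    potential H ℓ L s t ω υ ≤ -minLoss H ℓ L υ 0 t [] ω +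
      L * (d * Real.log ((s : ℝ) ^ 2 + 1) / η + η * s / 2) := by
  have h := neg_avgDraws_minLoss_le (ℓ := ℓ) hH hB hL hd (pool_nonempty hs ht) hη s υ t ω
  rw [card_pool ht] at h
  rw [potential, if_pos ht, blockStart_of_dvd hst, Nat.sub_self, Nat.sub_zero]
  push_cast at h
  linarith

/-- The one-round inequality holds draw by draw and is averaged afterwards. The round also uses up
one draw, which matches the drop from the potential to the intermediate one. -/
lemma pmfExp_add_potential_le (hH : H.Nonempty) (hB : BinaryValued H)
    (hL : 0 < L) (hℓ : IsConvexLipschitzLoss ℓ L) {d : ℕ} (hd : vcDim H = d) {s : ℕ} (hs : 0 < s)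
    {Φ : PredictionRule X} (hΦ : IsPlayoutRule H ℓ L s Φ) {η : ℝ} (hη : 0 < η) (x₀ : X)
    (hist : List (X × I01)) (x : X) (y : I01) :
    pmfExp (Φ hist x) (fun p => ℓ p y) + potential H ℓ L s (hist.length + 1)
        (Function.update (featSeq x₀ hist) hist.length x)
        (Function.update (labelSeq hist) hist.length y) ≤
      midPotential H ℓ L s hist.length (featSeq x₀ hist) (labelSeq hist) x +
        if s ∣ hist.length + 1 ∧ s ^ 2 ≤ hist.length + 1 then
          L * (d * Real.log ((s : ℝ) ^ 2 + 1) / η + η * s / 2) else 0 := by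
  set t := hist.length with ht
  set ω := featSeq x₀ hist
  set υ := labelSeq hist
  by_cases hst : s ^ 2 ≤ t
  · have hpool : ∀ i ∈ pool s t, i ≠ t := fun i hi =>
      ((lt_of_mem_pool hi).trans_le (blockStart_le s t)).ne
    have hpred : pmfExp (Φ hist x) (fun p => ℓ p y) =
        avgDraws (pool s t) (s - 1 - (t - blockStart s t)) fun l =>
          ℓ (clamp (prediction H ℓ L υ (blockStart s t) t l x ω)) y := hΦ x₀ hist x y hst
    rw [hpred, midPotential, if_pos hst]
    have hone : avgDraws (pool s t) (s - 1 - (t - blockStart s t)) (fun l =>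
        ℓ (clamp (prediction H ℓ L υ (blockStart s t) t l x ω)) y) -
        avgDraws (pool s t) (s - 1 - (t - blockStart s t)) (fun l => minLoss H ℓ L
          (Function.update υ t y) (blockStart s t) (t + 1) l (Function.update ω t x)) ≤
        -avgDraws (pool s t) (s - 1 - (t - blockStart s t)) (fun l =>
          probe H ℓ L υ (blockStart s t) t l x ω) := by
      rw [← avgDraws_sub, ← avgDraws_neg]
      refine avgDraws_mono fun l _ hl => ?_
      have := loss_prediction_add_probe_le hH hB hL hℓ υ (blockStart_le s t)
        (fun p hp => hpool _ (hl p hp)) ω x y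
      linarith
    have hpast : minLoss H ℓ L (Function.update υ t y) 0 (blockStart s t) []
        (Function.update ω t x) = minLoss H ℓ L υ 0 (blockStart s t) [] ω :=
      minLoss_update υ (blockStart_le s t) (by simp) ω x y
    -- At the end of a block no draws are left: the block joins the finished past by
    -- superadditivity, and the next block is opened at Massart's price.
    by_cases hdvd : s ∣ t + 1
    · rw [if_pos ⟨hdvd, by omega⟩]
      have h1 := potential_le_of_dvd (ℓ := ℓ) hH hB hL hd hs (by omega) hdvd hη
        (Function.update ω t x) (Function.update υ t y)
      have h2 := minLoss_add_minLoss_le hH hL hℓ (Function.update υ t y)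
        (Nat.zero_le (blockStart s t)) ((blockStart_le s t).trans (Nat.le_succ t))
        (Function.update ω t x)
      have h3 : s - 1 - (t - blockStart s t) = 0 := by
        have := add_one_eq_of_dvd hs hdvd
        omega
      rw [h3] at hone ⊢
      simp only [avgDraws] at hone ⊢
      linarith
    · rw [if_neg fun h => hdvd h.1]
      have hbs := blockStart_succ hs hdvd
      have hpe : pool s (t + 1) = pool s t := by rw [pool, pool, hbs]
      rw [potential, if_pos (by omega), hpe, hbs, hpast]
      have h3 : s - (t + 1 - blockStart s t) = s - 1 - (t - blockStart s t) := by
        have := blockStart_le s t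
        omega
      rw [h3]
      linarith
  · rw [midPotential, if_neg hst]
    have hlow : minLoss H ℓ L (Function.update υ t y) 0 (t + 1) [] (Function.update ω t x) + L -
        minLoss H ℓ L υ 0 t [] ω ≥ pmfExp (Φ hist x) (fun p => ℓ p y) := by
      refine (pmfExp_mem_Icc (Φ hist x) (a := 0) fun p => ⟨hℓ.nonneg _ _, ?_⟩).2
      have := loss_add_minLoss_le hH hL hℓ υ (Nat.zero_le t) (l := []) (by simp) ω x p y
      linarith
    -- Without a pool a round costs `L`. If `t + 1 = s ^ 2` the pool has just filled, and the first
    -- playout block must be opened as well.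
    by_cases hst' : s ^ 2 ≤ t + 1
    · have hdvd : s ∣ t + 1 := by
        rw [show t + 1 = s ^ 2 by omega, sq]; exact Dvd.intro _ rfl
      rw [if_pos ⟨hdvd, hst'⟩]
      have h1 := potential_le_of_dvd (ℓ := ℓ) hH hB hL hd hs hst' hdvd hη
        (Function.update ω t x) (Function.update υ t y)
      linarith
    · rw [if_neg fun h => hst' h.2, potential, if_neg hst']
      linarith

lemma neg_minLoss_le_potential (hH : H.Nonempty) (hL : 0 < L) (hℓ : IsConvexLipschitzLoss ℓ L)
    {s : ℕ} (hs : 0 < s) (t : ℕ) (ω : ℕ → X) (υ : ℕ → I01) :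
    -minLoss H ℓ L υ 0 t [] ω ≤ potential H ℓ L s t ω υ := by
  unfold potential
  split_ifs with ht
  · have h1 := minLoss_add_minLoss_le hH hL hℓ υ (Nat.zero_le (blockStart s t))
      (blockStart_le s t) ω
    have h2 := avgDraws_minLoss_le (pool_nonempty hs ht) hH hL hℓ (s - (t - blockStart s t)) υ
      (blockStart s t) t ω
    linarith
  · exact le_rfl

lemma integrable_avgDraws [MeasurableSpace X] {ν : Measure X} {S : Finset ℕ} {k : ℕ}
    {φ : List (ℕ × Bool) → X → ℝ} (hφ : ∀ l, Integrable (φ l) ν) :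
    Integrable (fun x => avgDraws S k fun l => φ l x) ν := by
  induction k generalizing φ with
  | zero => exact hφ []
  | succ k ih =>
    exact ih fun l => (integrable_finsetSum _ fun i _ =>
      ((hφ _).add (hφ _)).div_const 2).div_const _

lemma integral_avgDraws [MeasurableSpace X] {ν : Measure X} {S : Finset ℕ} {k : ℕ}
    {φ : List (ℕ × Bool) → X → ℝ} (hφ : ∀ l, Integrable (φ l) ν) :
    ∫ x, avgDraws S k (fun l => φ l x) ∂ν = avgDraws S k fun l => ∫ x, φ l x ∂ν := by
  induction k generalizing φ with
  | zero => rfl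
  | succ k ih =>
    have h1 : ∀ l i, Integrable (fun x => (φ ((i, true) :: l) x + φ ((i, false) :: l) x) / 2) ν :=
      fun l i => ((hφ _).add (hφ _)).div_const 2
    simp only [avgDraws]
    rw [ih fun l => (integrable_finsetSum _ fun i _ => h1 l i).div_const _]
    congr 1
    ext l
    rw [integral_div, integral_finsetSum _ fun i _ => h1 l i]
    congr 1
    refine Finset.sum_congr rfl fun i _ => ?_
    rw [integral_div, integral_add (hφ _) (hφ _)]

variable [MeasurableSpace X]

lemma integrable_midPotential (hH : H.Nonempty) (hB : BinaryValued H) (hT : TraceMeasurable H)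
    (hL : 0 < L) (hℓ : IsConvexLipschitzLoss ℓ L) (ν : ProbabilityMeasure X) (s t : ℕ)
    (ω : ℕ → X) (υ : ℕ → I01) : Integrable (midPotential H ℓ L s t ω υ) (ν : Measure X) := by
  unfold midPotential
  split_ifs
  · exact (integrable_const _).sub (integrable_avgDraws fun l =>
      integrable_probe hH hB hT hL hℓ (ν : Measure X) υ _ _ l ω)
  · exact integrable_const _

/-- The two potentials differ only in where the probed feature comes from: the true law on one side,
a uniform pool draw on the other. Their gap is the mean deviation. -/
lemma integral_midPotential_eq (hH : H.Nonempty) (hB : BinaryValued H) (hT : TraceMeasurable H)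
    (hL : 0 < L) (hℓ : IsConvexLipschitzLoss ℓ L) (ν : ProbabilityMeasure X) {s t : ℕ}
    (hs : 0 < s) (ht : s ^ 2 ≤ t) (ω : ℕ → X) (υ : ℕ → I01) :
    ∫ x, midPotential H ℓ L s t ω υ x ∂(ν : Measure X) = potential H ℓ L s t ω υ +
      avgDraws (pool s t) (s - 1 - (t - blockStart s t)) fun l =>
        deviation H ℓ L ν (pool s t) (blockStart s t) t l υ ω := by
  have hint := fun l => integrable_probe hH hB hT hL hℓ (ν : Measure X) υ (blockStart s t) t l ω
  have hk : s - (t - blockStart s t) = s - 1 - (t - blockStart s t) + 1 := by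
    have := lt_blockStart_add hs t
    omega
  have hc : ((pool s t).card : ℝ) ≠ 0 := by exact_mod_cast (pool_nonempty hs ht).card_pos.ne'
  simp only [midPotential, potential, if_pos ht]
  rw [integral_sub (integrable_const _) (integrable_avgDraws hint), integral_const,
    integral_avgDraws hint, hk, avgDraws_succ_minLoss]
  have e : ∀ l, deviation H ℓ L ν (pool s t) (blockStart s t) t l υ ω =
      (∑ i ∈ pool s t, probe H ℓ L υ (blockStart s t) t l (ω i) ω) / (pool s t).card -
        ∫ z, probe H ℓ L υ (blockStart s t) t l z ω ∂(ν : Measure X) := by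
    intro l
    rw [deviation, Finset.sum_sub_distrib, Finset.sum_const, nsmul_eq_mul, sub_div,
      mul_div_cancel_left₀ _ hc]
  simp only [e, avgDraws_sub]
  simp

end steps

/-! ### Expected future costs -/

section future

variable [MeasurableSpace X]

/-- Expected sum of the costs `E t, …, E (t + n - 1)` when the features from the round `t` on are
drawn afresh. -/
def futureCost (μ : ℕ → ProbabilityMeasure X) (E : ℕ → (ℕ → X) → ENNReal) :
    ℕ → ℕ → (ℕ → X) → ENNReal
  | 0, _, _ => 0
  | n + 1, t, ω =>
    E t ω + ∫⁻ x, futureCost μ E n (t + 1) (Function.update ω t x) ∂(μ t : Measure X)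

variable {μ : ℕ → ProbabilityMeasure X} {E : ℕ → (ℕ → X) → ENNReal}

lemma measurable_futureCost (hE : ∀ t, Measurable (E t)) (n t : ℕ) :
    Measurable (futureCost μ E n t) := by
  induction n generalizing t with
  | zero => exact measurable_const
  | succ n ih =>
    refine (hE t).add (Measurable.lintegral_prod_right' (f := fun p : (ℕ → X) × X =>
      futureCost μ E n (t + 1) (Function.update p.1 t p.2)) ?_)
    exact (ih (t + 1)).comp measurable_update'

lemma futureCost_le {C : ENNReal} (hE : ∀ t ω, E t ω ≤ C) (n t : ℕ) (ω : ℕ → X) :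
    futureCost μ E n t ω ≤ n * C := by
  induction n generalizing t ω with
  | zero => simp [futureCost]
  | succ n ih =>
    rw [futureCost, Nat.cast_add, Nat.cast_one, add_mul, one_mul, add_comm]
    refine add_le_add ?_ (hE t ω)
    exact (lintegral_mono fun x => ih (t + 1) _).trans (by simp)

/-- The tower property: averaging over the features before `t` and then over feature `t` is
averaging over the features before `t + 1`. Each cost therefore only needs a bounded mean over its
own past. -/
lemma lmarginal_futureCost_le (hE : ∀ t, Measurable (E t)) {C : ENNReal}
    (hC : ∀ t ω, lmarginal (fun i => (μ i : Measure X)) (Finset.range t) (E t) ω ≤ C)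
    (n t : ℕ) (ω : ℕ → X) :
    lmarginal (fun i => (μ i : Measure X)) (Finset.range t) (futureCost μ E n t) ω ≤ n * C := by
  induction n generalizing t with
  | zero =>
    have : futureCost μ E 0 t = fun _ => 0 := rfl
    rw [this]
    exact (lmarginal_const_le μ _ 0 ω).trans (by simp)
  | succ n ih =>
    have h1 : lmarginal (fun i => (μ i : Measure X)) (Finset.range t) (futureCost μ E (n + 1) t) ω
        = lmarginal (fun i => (μ i : Measure X)) (Finset.range t) (E t) ω +
          lmarginal (fun i => (μ i : Measure X)) (Finset.range t) (fun ω =>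
            ∫⁻ x, futureCost μ E n (t + 1) (Function.update ω t x) ∂(μ t : Measure X)) ω := by
      unfold lmarginal
      exact lintegral_add_left ((hE t).comp measurable_updateFinset) _
    rw [h1, ← lmarginal_insert' _ (measurable_futureCost hE n (t + 1)) (by simp),
      ← Finset.range_add_one, Nat.cast_add, Nat.cast_one, add_mul, one_mul, add_comm]
    exact add_le_add (ih (t + 1)) (hC t ω)

lemma toReal_futureCost_succ (hE : ∀ t, Measurable (E t)) {C : ENNReal} (hC : C ≠ ⊤)
    (hEC : ∀ t ω, E t ω ≤ C) (n t : ℕ) (ω : ℕ → X) :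
    Integrable (fun x => (futureCost μ E n (t + 1) (Function.update ω t x)).toReal)
      (μ t : Measure X) ∧
    (futureCost μ E (n + 1) t ω).toReal = (E t ω).toReal +
      ∫ x, (futureCost μ E n (t + 1) (Function.update ω t x)).toReal ∂(μ t : Measure X) := by
  have hfin : ∀ ω, futureCost μ E n (t + 1) ω < ⊤ := fun ω =>
    (futureCost_le hEC n (t + 1) ω).trans_lt
      (ENNReal.mul_lt_top (ENNReal.natCast_lt_top n) hC.lt_top)
  have hm : Measurable fun x => futureCost μ E n (t + 1) (Function.update ω t x) :=
    (measurable_futureCost hE n (t + 1)).comp (measurable_update ω)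
  have hlt : ∫⁻ x, futureCost μ E n (t + 1) (Function.update ω t x) ∂(μ t : Measure X) ≠ ⊤ :=
    ((lintegral_mono fun x => futureCost_le hEC n (t + 1) _).trans_lt (by
      simpa using ENNReal.mul_lt_top (ENNReal.natCast_lt_top n) hC.lt_top)).ne
  refine ⟨integrable_toReal_of_lintegral_ne_top hm.aemeasurable hlt, ?_⟩
  rw [integral_toReal hm.aemeasurable (Filter.Eventually.of_forall fun x => hfin _), futureCost,
    ENNReal.toReal_add ((hEC t ω).trans_lt hC.lt_top).ne hlt]

end future

end

end Hybrid

/-! ### Regret of a playout rule -/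

namespace Hybrid

noncomputable section

variable {X : Type*} [MeasurableSpace X]

/-- The features of the pool of the round `t` are distributed like the feature of the round. -/
def IsStable (μ : ℕ → ProbabilityMeasure X) (s t : ℕ) : Prop :=
  s ^ 2 ≤ t ∧ ∀ i ∈ pool s t, μ i = μ t

open Classical in
/-- Cost of the round `t`, as a function of the past features, normalised by `A`. -/
def deviationCost (H : Set (X → I01)) (ℓ : ℝ → ℝ → ℝ) (L : ℝ) (μ : ℕ → ProbabilityMeasure X)
    (s N : ℕ) (c A : ℝ) (t : ℕ) (ω : ℕ → X) : ENNReal :=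
  if IsStable μ s t then ENNReal.ofReal (expDeviation H ℓ L (μ t) (pool s t) (blockStart s t) t
    (s - 1 - (t - blockStart s t)) N c ω / (c * A)) else 0

variable {H : Set (X → I01)} {ℓ : ℝ → ℝ → ℝ} {L : ℝ} {μ : ℕ → ProbabilityMeasure X}

lemma measurable_deviationCost (hB : BinaryValued H) (hT : TraceMeasurable H) (hL : 0 < L)
    (hℓ : IsConvexLipschitzLoss ℓ L) (s N : ℕ) (c A : ℝ) (t : ℕ) :
    Measurable (deviationCost H ℓ L μ s N c A t) := by
  unfold deviationCost
  split_ifs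
  · exact ((measurable_expDeviation hB hT hL hℓ _ _ _ _ _ _ _).div_const _).ennreal_ofReal
  · exact measurable_const

lemma sub_blockStart_le {s : ℕ} (hs : 0 < s) (t : ℕ) : t - blockStart s t ≤ s := by
  have := lt_blockStart_add hs t
  omega

lemma deviationCost_le (hH : H.Nonempty) (hB : BinaryValued H) (hT : TraceMeasurable H)
    (hL : 0 < L) (hℓ : IsConvexLipschitzLoss ℓ L) {s : ℕ} (hs : 0 < s) (N : ℕ) {c A : ℝ}
    (hc : 0 < c) (hA : 0 < A) (t : ℕ) (ω : ℕ → X) :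
    deviationCost H ℓ L μ s N c A t ω ≤
      ENNReal.ofReal ((N + 1) ^ s * Real.exp (c * L) / (c * A)) := by
  unfold deviationCost
  split_ifs with h
  · refine ENNReal.ofReal_le_ofReal ?_
    gcongr
    refine (expDeviation_le hH hB hT hL hℓ _ (pool_nonempty hs h.1) _ _ _ N hc ω).trans ?_
    gcongr
    · exact le_add_of_nonneg_left (Nat.cast_nonneg N)
    · exact sub_blockStart_le hs t
  · exact zero_le

/-- The normalisation `A` dominates the exponential moment of every stable round, so dividing by `c
* A` leaves a mean of at most `1 / c`. -/
lemma lmarginal_deviationCost_le (hH : H.Nonempty) (hB : BinaryValued H) (hT : TraceMeasurable H)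
    (hL : 0 < L) (hℓ : IsConvexLipschitzLoss ℓ L) {s : ℕ} (hs : 0 < s) (N : ℕ) {c : ℝ}
    (hc : 0 < c) (t : ℕ) (ω : ℕ → X) :
    lmarginal (fun i => (μ i : Measure X)) (Finset.range t) (deviationCost H ℓ L μ s N c
      ((N + 1) ^ s * Real.exp (c * L * s / (s ^ 2 : ℕ) + c ^ 2 * L ^ 2 / (8 * (s ^ 2 : ℕ)))) t) ω ≤
      ENNReal.ofReal (1 / c) := by
  set A : ℝ := (N + 1) ^ s *
    Real.exp (c * L * s / (s ^ 2 : ℕ) + c ^ 2 * L ^ 2 / (8 * (s ^ 2 : ℕ))) with hA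
  have hA0 : 0 < A := by positivity
  by_cases h : IsStable μ s t
  · have h1 := lmarginal_expDeviation_le hH hB hT hL hℓ μ (μ t) (pool_nonempty hs h.1) h.2
      (blockStart_le s t) (fun i hi => lt_of_mem_pool hi) (s - 1 - (t - blockStart s t)) N hc ω
    rw [card_pool h.1] at h1
    have h2 : deviationCost H ℓ L μ s N c A t = fun ω => ENNReal.ofReal (1 / (c * A)) *
        ENNReal.ofReal (expDeviation H ℓ L (μ t) (pool s t) (blockStart s t) t
          (s - 1 - (t - blockStart s t)) N c ω) := by
      ext ω
      rw [deviationCost, if_pos h, ← ENNReal.ofReal_mul (by positivity)]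
      congr 1
      ring
    have h3 : lmarginal (fun i => (μ i : Measure X)) (Finset.range t)
        (deviationCost H ℓ L μ s N c A t) ω = ENNReal.ofReal (1 / (c * A)) *
        lmarginal (fun i => (μ i : Measure X)) (Finset.range t) (fun ω =>
        ENNReal.ofReal (expDeviation H ℓ L (μ t) (pool s t) (blockStart s t) t
          (s - 1 - (t - blockStart s t)) N c ω)) ω := by
      rw [h2]
      unfold lmarginal
      rw [lintegral_const_mul' _ _ ENNReal.ofReal_ne_top]
    rw [h3]
    refine (mul_le_mul_right h1 _).trans ?_
    rw [← ENNReal.ofReal_mul (by positivity)]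
    refine ENNReal.ofReal_le_ofReal ?_
    rw [one_div_mul_eq_div, div_le_div_iff₀ (by positivity) hc, one_mul]
    have : ((N : ℝ) + 1) ^ (t - blockStart s t) * Real.exp (c * L *
        (s - 1 - (t - blockStart s t) : ℕ) / (s ^ 2 : ℕ) +
        c ^ 2 * L ^ 2 / (8 * (s ^ 2 : ℕ))) ≤ A := by
      rw [hA]
      gcongr
      · exact le_add_of_nonneg_left (Nat.cast_nonneg N)
      · exact sub_blockStart_le hs t
      · omega
    nlinarith
  · have : deviationCost H ℓ L μ s N c A t = fun _ => 0 := by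
      ext ω
      rw [deviationCost, if_neg h]
    rw [this]
    exact (lmarginal_const_le μ _ 0 ω).trans zero_le

-- The expected increase of the potential in one round splits into a deterministic price and a
-- random cost of features. Rounds with an incomplete pool, or with a pool of another law, pay `L`
-- instead.
open Classical in
lemma integral_midPotential_le (hH : H.Nonempty) (hB : BinaryValued H) (hT : TraceMeasurable H)
    (hL : 0 < L) (hℓ : IsConvexLipschitzLoss ℓ L) {s : ℕ} (hs : 0 < s) {N : ℕ} (hN : 0 < N)
    {c A : ℝ} (hc : 0 < c) (hA : 1 ≤ A) (t : ℕ) (ω : ℕ → X) (υ : ℕ → I01) :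
    ∫ x, midPotential H ℓ L s t ω υ x ∂(μ t : Measure X) ≤ potential H ℓ L s t ω υ +
      (Real.log A / c + 2 * (s * (L * (1 / N))) + if IsStable μ s t then 0 else L) +
      (deviationCost H ℓ L μ s N c A t ω).toReal := by
  have hlog : 0 ≤ Real.log A / c := div_nonneg (Real.log_nonneg hA) hc.le
  have hN' : 0 ≤ 2 * (s * (L * (1 / N)) : ℝ) := by positivity
  have htr : 0 ≤ (deviationCost H ℓ L μ s N c A t ω).toReal := ENNReal.toReal_nonneg
  by_cases ht : s ^ 2 ≤ t
  · rw [integral_midPotential_eq hH hB hT hL hℓ (μ t) hs ht]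
    by_cases h : IsStable μ s t
    · have h1 := avgDraws_deviation_le hH hB hT hL hℓ (μ t) (pool_nonempty hs ht)
        (blockStart s t) t (s - 1 - (t - blockStart s t)) hN hc (zero_lt_one.trans_le hA) υ ω
      have h2 : (deviationCost H ℓ L μ s N c A t ω).toReal =
          expDeviation H ℓ L (μ t) (pool s t) (blockStart s t) t
            (s - 1 - (t - blockStart s t)) N c ω / (c * A) := by
        rw [deviationCost, if_pos h, ENNReal.toReal_ofReal]
        exact div_nonneg (expDeviation_nonneg (μ t) (pool_nonempty hs ht) _ _ _ _ _ _)
          (by positivity)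
      rw [if_pos h, h2]
      have h3 : (Real.log A - 1) / c ≤ Real.log A / c := by gcongr; linarith
      have h4 : 2 * ((t - blockStart s t : ℕ) * (L * (1 / N)) : ℝ) ≤
          2 * (s * (L * (1 / N)) : ℝ) := by
        gcongr
        exact sub_blockStart_le hs t
      linarith
    · rw [if_neg h]
      have h1 : avgDraws (pool s t) (s - 1 - (t - blockStart s t)) (fun l =>
          deviation H ℓ L (μ t) (pool s t) (blockStart s t) t l υ ω) ≤ L :=
        (avgDraws_mono fun l _ _ => deviation_le hH hB hT hL hℓ (μ t) (pool_nonempty hs ht)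
          (blockStart s t) t l υ ω).trans_eq (avgDraws_const (pool_nonempty hs ht) _ L)
      linarith
  · rw [if_neg fun h => ht h.1]
    simp only [midPotential, potential, if_neg ht, integral_const, probReal_univ, smul_eq_mul,
      one_mul]
    linarith

open Classical in
/-- Regret of a playout rule for given block length `s`, grid size `N` and parameters `c`, `η`. -/
theorem gameValue_le_of_isPlayoutRule (hH : H.Nonempty) (hB : BinaryValued H)
    (hT : TraceMeasurable H) (hL : 0 < L) (hℓ : IsConvexLipschitzLoss ℓ L) {d : ℕ}
    (hd : vcDim H = d) {s : ℕ} (hs : 0 < s) {Φ : PredictionRule X}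
    (hΦ : IsPlayoutRule H ℓ L s Φ) {η c : ℝ} (hη : 0 < η) (hc : 0 < c) {N : ℕ} (hN : 0 < N)
    (μ : ℕ → ProbabilityMeasure X) (T : ℕ) :
    gameValue ℓ H Φ μ T [] 0 ≤
      (T / s : ℕ) * (L * (d * Real.log ((s : ℝ) ^ 2 + 1) / η + η * s / 2)) +
      ((Finset.range T).filter fun t => ¬IsStable μ s t).card * L +
      T * ((s * Real.log (N + 1) + c * L / s + c ^ 2 * L ^ 2 / (8 * s ^ 2)) / c +
        2 * (s * (L * (1 / N))) + 1 / c) := by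
  have x₀ : X := (μ 0).nonempty.some
  have hs' : (0 : ℝ) < s := by exact_mod_cast hs
  set R : ℝ := L * (d * Real.log ((s : ℝ) ^ 2 + 1) / η + η * s / 2) with hR
  set A : ℝ := (N + 1) ^ s *
    Real.exp (c * L * s / (s ^ 2 : ℕ) + c ^ 2 * L ^ 2 / (8 * (s ^ 2 : ℕ))) with hA
  have hA1 : 1 ≤ A := by
    rw [hA]
    exact one_le_mul_of_one_le_of_one_le
      (one_le_pow₀ (le_add_of_nonneg_left (Nat.cast_nonneg N))) (Real.one_le_exp (by positivity))
  have hlogA : Real.log A = s * Real.log (N + 1) + c * L / s + c ^ 2 * L ^ 2 / (8 * s ^ 2) := by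
    rw [hA, Real.log_mul (by positivity) (Real.exp_pos _).ne', Real.log_exp, Real.log_pow]
    push_cast
    field_simp
    ring
  set E := deviationCost H ℓ L μ s N c A with hE
  have hEm : ∀ t, Measurable (E t) := measurable_deviationCost hB hT hL hℓ s N c A
  have hEle := deviationCost_le (μ := μ) hH hB hT hL hℓ hs N hc (zero_lt_one.trans_le hA1)
  set β : ℕ → ℝ := fun t => if s ∣ t + 1 ∧ s ^ 2 ≤ t + 1 then R else 0 with hβ
  set κ : ℕ → ℝ := fun t =>
    Real.log A / c + 2 * (s * (L * (1 / N))) + if IsStable μ s t then 0 else L with hκ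
  -- The learner's potential, the deterministic prices still to be paid, and the expected remaining
  -- random costs. The last two do not involve the labels, so they pass through the supremum over
  -- `y`.
  set V : ℕ → (ℕ → X) → (ℕ → I01) → ℝ := fun t ω υ => potential H ℓ L s t ω υ +
    ∑ i ∈ Finset.Ico t T, (β i + κ i) + (futureCost μ E (T - t) t ω).toReal with hV
  have key := gameValue_le hH hℓ x₀ Φ μ T V (fun ω υ => by
      simpa [hV, futureCost] using neg_minLoss_le_potential hH hL hℓ hs T ω υ) (fun hist ht => by
    obtain ⟨n, hn⟩ : ∃ n, T = hist.length + (n + 1) := ⟨T - hist.length - 1, by omega⟩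
    obtain ⟨hfi, hfe⟩ := toReal_futureCost_succ (μ := μ) hEm ENNReal.ofReal_ne_top hEle n
      hist.length (featSeq x₀ hist)
    have hmi := integrable_midPotential hH hB hT hL hℓ (μ hist.length) s hist.length
      (featSeq x₀ hist) (labelSeq hist)
    have hci : Integrable (fun _ : X => β hist.length +
      ∑ i ∈ Finset.Ico (hist.length + 1) T, (β i + κ i)) (μ hist.length : Measure X) :=
      integrable_const _
    refine ⟨fun x => midPotential H ℓ L s hist.length (featSeq x₀ hist) (labelSeq hist) x +
      (β hist.length + ∑ i ∈ Finset.Ico (hist.length + 1) T, (β i + κ i)) +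
      (futureCost μ E n (hist.length + 1)
        (Function.update (featSeq x₀ hist) hist.length x)).toReal, (hmi.add hci).add hfi, ?_, ?_⟩
    · have h1 : ∫ x, (midPotential H ℓ L s hist.length (featSeq x₀ hist) (labelSeq hist) x +
          (β hist.length + ∑ i ∈ Finset.Ico (hist.length + 1) T, (β i + κ i)) +
          (futureCost μ E n (hist.length + 1)
            (Function.update (featSeq x₀ hist) hist.length x)).toReal)
            ∂(μ hist.length : Measure X) =
          ∫ x, midPotential H ℓ L s hist.length (featSeq x₀ hist) (labelSeq hist) x
            ∂(μ hist.length : Measure X) +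
          (β hist.length + ∑ i ∈ Finset.Ico (hist.length + 1) T, (β i + κ i)) +
          ∫ x, (futureCost μ E n (hist.length + 1)
            (Function.update (featSeq x₀ hist) hist.length x)).toReal
            ∂(μ hist.length : Measure X) :=
        (integral_add (hmi.add hci) hfi).trans
          (congrArg (· + _) ((integral_add hmi hci).trans (by simp)))
      rw [h1]
      have h2 := integral_midPotential_le (μ := μ) hH hB hT hL hℓ hs hN hc hA1 hist.length
        (featSeq x₀ hist) (labelSeq hist)
      simp only [hV]
      rw [show T - hist.length = n + 1 by omega, hfe, Finset.sum_eq_sum_Ico_succ_bot ht]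
      have h3 : κ hist.length = Real.log A / c + 2 * (s * (L * (1 / N))) +
        if IsStable μ s hist.length then 0 else L := rfl
      rw [← h3] at h2
      linarith
    · intro x y
      have h1 := pmfExp_add_potential_le hH hB hL hℓ hd hs hΦ hη x₀ hist x y
      have h3 : β hist.length = if s ∣ hist.length + 1 ∧ s ^ 2 ≤ hist.length + 1 then
        L * (d * Real.log ((s : ℝ) ^ 2 + 1) / η + η * s / 2) else 0 := rfl
      rw [← h3] at h1
      simp only [hV]
      rw [show T - (hist.length + 1) = n by omega]
      linarith) T [] (by simp) 0
  have hpot : potential H ℓ L s 0 (featSeq x₀ []) (labelSeq (X := X) []) ≤ 0 := by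
    rw [potential, if_neg (by simpa using hs.ne'), neg_nonpos]
    exact le_minLoss hH fun h _ => by simp [perturbedLoss]
  -- At time `0` the marginal is over no coordinate, so the averaged bound becomes a pointwise one.
  have hfut : (futureCost μ E T 0 (featSeq x₀ [])).toReal ≤ T * (1 / c) := by
    have h1 := lmarginal_futureCost_le (μ := μ) hEm
      (lmarginal_deviationCost_le hH hB hT hL hℓ hs N hc) T 0 (featSeq x₀ [])
    rw [Finset.range_zero, lmarginal_empty] at h1
    refine (ENNReal.toReal_mono (ENNReal.mul_ne_top (ENNReal.natCast_ne_top T)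
      ENNReal.ofReal_ne_top) h1).trans_eq ?_
    rw [ENNReal.toReal_mul, ENNReal.toReal_natCast, ENNReal.toReal_ofReal (by positivity)]
  have hβsum : ∑ i ∈ Finset.range T, β i ≤ (T / s : ℕ) * R := by
    have hR0 : 0 ≤ R := by
      have : 0 ≤ Real.log ((s : ℝ) ^ 2 + 1) := Real.log_nonneg (by nlinarith)
      positivity
    rw [hβ, ← Finset.sum_filter, Finset.sum_const, nsmul_eq_mul]
    refine mul_le_mul_of_nonneg_right ?_ hR0
    rw [Nat.cast_le, ← Nat.card_multiples]
    refine Finset.card_le_card fun i hi => ?_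
    rw [Finset.mem_filter] at hi ⊢
    exact ⟨hi.1, hi.2.1⟩
  have hκsum : ∑ i ∈ Finset.range T, κ i = T * (Real.log A / c + 2 * (s * (L * (1 / N)))) +
      ((Finset.range T).filter fun t => ¬IsStable μ s t).card * L := by
    rw [hκ, Finset.sum_add_distrib, Finset.sum_const, Finset.card_range, nsmul_eq_mul]
    congr 1
    rw [← nsmul_eq_mul, ← Finset.sum_const, Finset.sum_filter]
    exact Finset.sum_congr rfl fun i _ => by split_ifs <;> simp_all
  simp only [hV, List.length_nil, Nat.sub_zero, Nat.Ico_zero_eq_range, Finset.sum_add_distrib]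
    at key
  rw [hκsum, hlogA] at key
  linarith

open Classical in
/-- Every change spoils at most `s ^ 2 + s` rounds. -/
lemma card_not_isStable_le {s : ℕ} (hs : 0 < s) {T K : ℕ} (hμ : AtMostChanges μ T K) :
    ((Finset.range T).filter fun t => ¬IsStable μ s t).card ≤ s ^ 2 + K * (s ^ 2 + s) := by
  set J : Set ℕ := {t : ℕ | t + 1 < T ∧ μ t ≠ μ (t + 1)} with hJ
  have hfin : J.Finite := (Set.finite_lt_nat T).subset fun t ht => by
    have := ht.1
    simp only [Set.mem_ofPred_eq]
    omega
  have hJc : hfin.toFinset.card ≤ K := by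
    rw [← Set.ncard_eq_toFinset_card J hfin]; exact hμ
  have hsub : ((Finset.range T).filter fun t => ¬IsStable μ s t) ⊆ Finset.range (s ^ 2) ∪
      hfin.toFinset.biUnion fun j => Finset.Ioc j (j + (s ^ 2 + s)) := by
    intro t ht
    rw [Finset.mem_filter, Finset.mem_range] at ht
    rw [Finset.mem_union, Finset.mem_range, Finset.mem_biUnion]
    by_cases hts : s ^ 2 ≤ t
    · right
      have h1 : ¬∀ i ∈ pool s t, μ i = μ t := fun h => ht.2 ⟨hts, h⟩
      push Not at h1
      obtain ⟨i, hi, hne⟩ := h1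
      have hit : i < t := (lt_of_mem_pool hi).trans_le (blockStart_le s t)
      obtain ⟨j, hj1, hj2⟩ : ∃ j ∈ Finset.Ico i t, μ j ≠ μ (j + 1) := by
        by_contra hcon
        push Not at hcon
        have : ∀ m, i ≤ m → m ≤ t → μ i = μ m := by
          intro m hm
          induction m, hm using Nat.le_induction with
          | base => exact fun _ => rfl
          | succ m hm ih =>
            intro hmt
            rw [ih (by omega)]
            exact hcon m (Finset.mem_Ico.2 ⟨hm, by omega⟩)
        exact hne (this t hit.le le_rfl)
      rw [Finset.mem_Ico] at hj1
      refine ⟨j, hfin.mem_toFinset.2 ⟨by omega, hj2⟩, ?_⟩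
      -- The pool reaches back `s ^ 2` rounds from the start of the block and `t` lies less than `s`
      -- rounds after it, so the change `j` is close behind `t`.
      have h2 := (Finset.mem_Ico.1 hi).1
      have h3 := lt_blockStart_add hs t
      rw [Finset.mem_Ioc]
      omega
    · left; omega
  refine (Finset.card_le_card hsub).trans ((Finset.card_union_le _ _).trans ?_)
  rw [Finset.card_range]
  refine Nat.add_le_add_left (Finset.card_biUnion_le.trans ?_) _
  simp only [Nat.card_Ioc, Nat.add_sub_cancel_left, Finset.sum_const, smul_eq_mul]
  exact Nat.mul_le_mul_right _ hJc

end

end Hybrid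

/-! ### Choice of the block length and of the parameters -/

namespace Hybrid

noncomputable section

/-- The block length: the least `s ≥ 1` with `T² ≤ s⁵ K²`. -/
def IsBlockLength (T K s : ℕ) : Prop :=
  0 < s ∧ T ^ 2 ≤ s ^ 5 * K ^ 2 ∧ ∀ j < s, 0 < j → j ^ 5 * K ^ 2 < T ^ 2

/-- Naming the fifth root turns all fractional powers into polynomials in `u`. -/
lemma exists_fifth_root (n : ℕ) : ∃ u : ℝ, 0 ≤ u ∧ (n : ℝ) = u ^ 5 ∧
    (n : ℝ) ^ (1 / 5 : ℝ) = u ∧ (n : ℝ) ^ (4 / 5 : ℝ) = u ^ 4 := by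
  have hn : (0 : ℝ) ≤ n := Nat.cast_nonneg n
  refine ⟨(n : ℝ) ^ (1 / 5 : ℝ), by positivity, ?_, rfl, ?_⟩
  · rw [← Real.rpow_natCast, ← Real.rpow_mul hn]; norm_num
  · rw [← Real.rpow_natCast, ← Real.rpow_mul hn]; norm_num

lemma IsBlockLength.le_horizon {T K s : ℕ} (h : IsBlockLength T K s) (hT : 1 ≤ T) (hK : 1 ≤ K) :
    s ≤ T := by
  by_contra hlt
  push Not at hlt
  have h1 := h.2.2 T hlt hT
  have h2 : T ^ 2 ≤ T ^ 5 * K ^ 2 := by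
    calc T ^ 2 ≤ T ^ 5 := Nat.pow_le_pow_right hT (by norm_num)
      _ ≤ T ^ 5 * K ^ 2 := Nat.le_mul_of_pos_right _ (by positivity)
  omega

/-- The defining inequality says `√s ≥ (T / K) ^ (1 / 5)`. It bounds the part of the regret of order
`T / √s`. -/
lemma IsBlockLength.horizon_le {T K s : ℕ} (h : IsBlockLength T K s) :
    (T : ℝ) ≤ (K : ℝ) ^ (1 / 5 : ℝ) * (T : ℝ) ^ (4 / 5 : ℝ) * Real.sqrt s := by
  obtain ⟨u, hu, hKu, hK1, -⟩ := exists_fifth_root K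
  obtain ⟨w, hw, hTw, -, hT4⟩ := exists_fifth_root T
  rw [hK1, hT4]
  have h1 : (T : ℝ) ^ 2 ≤ (s : ℝ) ^ 5 * (K : ℝ) ^ 2 := by exact_mod_cast h.2.1
  have hs : Real.sqrt s ^ 2 = s := Real.sq_sqrt (Nat.cast_nonneg s)
  have h2 : w ^ 10 ≤ (Real.sqrt s * u) ^ 10 := by
    rw [hTw, hKu] at h1
    calc w ^ 10 = (w ^ 5) ^ 2 := by ring
      _ ≤ (s : ℝ) ^ 5 * (u ^ 5) ^ 2 := h1
      _ = (Real.sqrt s ^ 2) ^ 5 * (u ^ 5) ^ 2 := by rw [hs]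
      _ = _ := by ring
  have h3 : w ≤ Real.sqrt s * u :=
    le_of_pow_le_pow_left₀ (by norm_num) (mul_nonneg (Real.sqrt_nonneg _) hu) h2
  calc (T : ℝ) = w ^ 4 * w := by rw [hTw]; ring
    _ ≤ w ^ 4 * (Real.sqrt s * u) := by gcongr
    _ = _ := by ring

/-- Minimality of `s` supplies the opposite bound, needed for the spoiled rounds. For `T ≤ K` the
trivial bound `n ≤ T` is enough. -/
lemma IsBlockLength.count_le {T K s n : ℕ} (h : IsBlockLength T K s) (hnT : n ≤ T)
    (hn : n ≤ s ^ 2 + K * (s ^ 2 + s)) (hK : 1 ≤ K) :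
    (n : ℝ) ≤ 12 * ((K : ℝ) ^ (1 / 5 : ℝ) * (T : ℝ) ^ (4 / 5 : ℝ)) := by
  obtain ⟨u, hu, hKu, hK1, -⟩ := exists_fifth_root K
  obtain ⟨w, hw, hTw, -, hT4⟩ := exists_fifth_root T
  rw [hK1, hT4]
  have hs1 : (1 : ℝ) ≤ s := by exact_mod_cast h.1
  rcases le_total T K with hTK | hTK
  · have h1 : w ≤ u := by
      refine le_of_pow_le_pow_left₀ (n := 5) (by norm_num) hu ?_
      rw [← hTw, ← hKu]; exact_mod_cast hTK
    calc (n : ℝ) ≤ T := by exact_mod_cast hnT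
      _ = w * w ^ 4 := by rw [hTw]; ring
      _ ≤ u * w ^ 4 := by gcongr
      _ ≤ 12 * (u * w ^ 4) := le_mul_of_one_le_left (by positivity) (by norm_num)
  · have h1 : u ≤ w := by
      refine le_of_pow_le_pow_left₀ (n := 5) (by norm_num) hw ?_
      rw [← hTw, ← hKu]; exact_mod_cast hTK
    have h2 : ((s : ℝ) - 1) * u ^ 2 ≤ w ^ 2 := by
      rcases Nat.lt_or_ge 1 s with hs | hs
      · have h3 := h.2.2 (s - 1) (by omega) (by omega)
        have h4 : ((s - 1 : ℕ) : ℝ) ^ 5 * (K : ℝ) ^ 2 < (T : ℝ) ^ 2 := by exact_mod_cast h3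
        rw [Nat.cast_sub hs.le, Nat.cast_one, hKu, hTw] at h4
        refine le_of_pow_le_pow_left₀ (n := 5) (by norm_num) (by positivity) ?_
        calc (((s : ℝ) - 1) * u ^ 2) ^ 5 = ((s : ℝ) - 1) ^ 5 * (u ^ 5) ^ 2 := by ring
          _ ≤ (w ^ 5) ^ 2 := h4.le
          _ = _ := by ring
      · have : (s : ℝ) = 1 := le_antisymm (by exact_mod_cast hs) hs1
        rw [this]; simp; positivity
    -- Passing from `s - 1` to `s` costs a factor `2` because `u ≤ w`. Squared it gives `4`, and `s
    -- ^ 2 + K * (s ^ 2 + s) ≤ 3 * K * s ^ 2` then gives `12`.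
    have h3 : (s : ℝ) * u ^ 2 ≤ 2 * w ^ 2 := by nlinarith
    have h4 : (s : ℝ) ^ 2 * u ^ 5 ≤ 4 * (u * w ^ 4) := by
      calc (s : ℝ) ^ 2 * u ^ 5 = u * ((s : ℝ) * u ^ 2) ^ 2 := by ring
        _ ≤ u * (2 * w ^ 2) ^ 2 := by gcongr
        _ = _ := by ring
    have hK' : (1 : ℝ) ≤ K := by exact_mod_cast hK
    have h5 : (n : ℝ) ≤ (s : ℝ) ^ 2 + K * ((s : ℝ) ^ 2 + s) := by exact_mod_cast hn
    have h6 : (s : ℝ) ≤ (s : ℝ) ^ 2 := by nlinarith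
    calc (n : ℝ) ≤ (s : ℝ) ^ 2 + K * ((s : ℝ) ^ 2 + s) := h5
      _ ≤ K * (s : ℝ) ^ 2 + K * ((s : ℝ) ^ 2 + (s : ℝ) ^ 2) := by
          gcongr
          exact le_mul_of_one_le_left (by positivity) hK'
      _ = 3 * ((s : ℝ) ^ 2 * u ^ 5) := by rw [← hKu]; ring
      _ ≤ _ := by linarith

/-- The value `c = σ ^ 3 * g / L` balances the union bound `s * Λ / c` against the Hoeffding term `c
* L ^ 2 / s ^ 2`. With grid size `s ^ 2` every term is a multiple of `L * g / σ`: the coefficients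
`3`, `0.125`, three times `1.25`, and `1.6` add up to less than `9`. -/
lemma round_cost_le {L g σ s Λ : ℝ} (hL : 0 < L) (hg : 0.8 ≤ g) (hσ : 1 ≤ σ) (hs : s = σ ^ 2)
    (hΛ : Λ ≤ 3 * g ^ 2) :
    (s * Λ + σ ^ 3 * g / L * L / s + (σ ^ 3 * g / L) ^ 2 * L ^ 2 / (8 * s ^ 2)) / (σ ^ 3 * g / L) +
      2 * (s * (L * (1 / s ^ 2))) + 1 / (σ ^ 3 * g / L) ≤ 9 * (L * g / σ) := by
  have hg0 : 0 < g := by linarith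
  have hσ0 : 0 < σ := by linarith
  have e1 : s * Λ / (σ ^ 3 * g / L) ≤ 3 * (L * g / σ) := by
    rw [div_le_iff₀ (by positivity), hs]
    calc σ ^ 2 * Λ ≤ σ ^ 2 * (3 * g ^ 2) := by gcongr
      _ = _ := by field_simp
  have e2 : σ ^ 3 * g / L * L / s / (σ ^ 3 * g / L) = L / σ ^ 2 := by
    rw [hs]; field_simp
  have e3 : (σ ^ 3 * g / L) ^ 2 * L ^ 2 / (8 * s ^ 2) / (σ ^ 3 * g / L) = 0.125 * (L * g / σ) := by
    rw [hs]; field_simp; norm_num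
  have e4 : 2 * (s * (L * (1 / s ^ 2))) = 2 * (L / σ ^ 2) := by
    rw [hs]; field_simp
  have hgσ : 0.8 ≤ g * σ := hg.trans (le_mul_of_one_le_right hg0.le hσ)
  have e5 : L / σ ^ 2 ≤ 1.25 * (L * g / σ) := by
    rw [← mul_div_assoc, div_le_div_iff₀ (by positivity) hσ0]
    calc L * σ = L * σ * 1 := by ring
      _ ≤ L * σ * (1.25 * (g * σ)) := by gcongr; linarith
      _ = _ := by ring
  have e6 : 1 / (σ ^ 3 * g / L) ≤ 1.6 * (L * g / σ) := by
    rw [one_div_div, ← mul_div_assoc, div_le_div_iff₀ (by positivity) hσ0]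
    have : 1 ≤ 1.6 * (g * σ) ^ 2 := by nlinarith
    calc L * σ = L * σ * 1 := by ring
      _ ≤ L * σ * (1.6 * (g * σ) ^ 2) := by gcongr
      _ = _ := by ring
  have e7 : 0 ≤ L * g / σ := by positivity
  rw [add_div, add_div, e2, e3, e4]
  linarith

variable {X : Type*} [MeasurableSpace X] {H : Set (X → I01)} {ℓ : ℝ → ℝ → ℝ} {L : ℝ}

theorem gameValue_le_of_isBlockLength (hH : H.Nonempty) (hB : BinaryValued H)
    (hTM : TraceMeasurable H) (hL : 0 < L) (hℓ : IsConvexLipschitzLoss ℓ L) {d : ℕ}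
    (hd : vcDim H = d) (hd1 : 1 ≤ d) {T K s : ℕ} (hT : 2 ≤ T) (hK : 1 ≤ K)
    (hs : IsBlockLength T K s) {Φ : PredictionRule X} (hΦ : IsPlayoutRule H ℓ L s Φ)
    (μ : ℕ → ProbabilityMeasure X) (hμ : AtMostChanges μ T K) :
    gameValue ℓ H Φ μ T [] 0 ≤ 40 * (L * Real.sqrt (d * Real.log (max 1 L * T))
      * (K : ℝ) ^ (1 / 5 : ℝ) * (T : ℝ) ^ (4 / 5 : ℝ)) := by
  classical
  set ρ : ℝ := (K : ℝ) ^ (1 / 5 : ℝ) * (T : ℝ) ^ (4 / 5 : ℝ) with hρ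
  have hρ0 : 0 ≤ ρ := by positivity
  set σ : ℝ := Real.sqrt s with hσ
  have hs1 : (1 : ℝ) ≤ s := by exact_mod_cast hs.1
  have hσ1 : 1 ≤ σ := Real.one_le_sqrt.2 hs1
  have hσs : (s : ℝ) = σ ^ 2 := (Real.sq_sqrt (by linarith)).symm
  have hTρ : (T : ℝ) ≤ ρ * σ := hs.horizon_le
  have hT' : (2 : ℝ) ≤ T := by exact_mod_cast hT
  have hd1' : (1 : ℝ) ≤ d := by exact_mod_cast hd1
  have hlogT : (0.69 : ℝ) ≤ Real.log T := by
    have := Real.log_le_log (by norm_num) hT'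
    have := Real.log_two_gt_d9
    linarith
  set g : ℝ := Real.sqrt (d * Real.log T) with hg
  have hg2 : g ^ 2 = d * Real.log T := Real.sq_sqrt (by positivity)
  have hglog : Real.log T ≤ g ^ 2 := by rw [hg2]; nlinarith
  -- This uses `d ≥ 1` and `T ≥ 2`: `0.64 < 0.69 ≤ log T ≤ g ^ 2`. It lets terms without a factor
  -- `g` be absorbed.
  have hg08 : (0.8 : ℝ) ≤ g := by
    refine Real.le_sqrt_of_sq_le ?_
    rw [← hg2]; linarith
  have hgG : g ≤ Real.sqrt (d * Real.log (max 1 L * T)) := by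
    refine Real.sqrt_le_sqrt (mul_le_mul_of_nonneg_left (Real.log_le_log (by linarith) ?_)
      (by linarith))
    exact le_mul_of_one_le_left (by linarith) (le_max_left _ _)
  have hΛ : Real.log ((s : ℝ) ^ 2 + 1) ≤ 3 * Real.log T := by
    have h1 : (s : ℝ) ≤ T := by exact_mod_cast hs.le_horizon (by omega) hK
    have h2 : (s : ℝ) ^ 2 + 1 ≤ (T : ℝ) ^ 3 := by
      have e1 : (s : ℝ) ^ 2 ≤ (T : ℝ) ^ 2 := by gcongr
      have e2 : 2 * (T : ℝ) ^ 2 ≤ (T : ℝ) ^ 3 := by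
        rw [pow_succ _ 2, mul_comm]; gcongr
      nlinarith
    have := Real.log_le_log (by positivity) h2
    rwa [Real.log_pow] at this
  -- `η = g / σ` balances the two terms of Massart's bound, since `g ^ 2 = d * log T` and `s = σ ^
  -- 2`.
  have key := gameValue_le_of_isPlayoutRule hH hB hTM hL hℓ hd hs.1 hΦ (η := g / σ)
    (c := σ ^ 3 * g / L) (by positivity) (by positivity) (N := s ^ 2) (pow_pos hs.1 2) μ T
  have hn := hs.count_le (n := ((Finset.range T).filter fun t => ¬IsStable μ s t).card)
    ((Finset.card_filter_le _ _).trans (Finset.card_range T).le) (card_not_isStable_le hs.1 hμ) hK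
  rw [← hρ] at hn
  have h1 : ((T / s : ℕ) : ℝ) * (L * (d * Real.log ((s : ℝ) ^ 2 + 1) / (g / σ) + g / σ * s / 2)) ≤
      3.5 * (L * g * ρ) := by
    have e1 : d * Real.log ((s : ℝ) ^ 2 + 1) / (g / σ) + g / σ * s / 2 ≤ 3.5 * (g * σ) := by
      have : d * Real.log ((s : ℝ) ^ 2 + 1) / (g / σ) ≤ 3 * (g * σ) := by
        rw [div_le_iff₀ (by positivity)]
        calc d * Real.log ((s : ℝ) ^ 2 + 1) ≤ d * (3 * Real.log T) := by gcongr
          _ = 3 * g ^ 2 := by rw [hg2]; ring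
          _ = _ := by field_simp
      have e2 : g / σ * s / 2 = 0.5 * (g * σ) := by rw [hσs]; field_simp; norm_num
      linarith
    calc _ ≤ (T / s : ℝ) * (L * (3.5 * (g * σ))) := by
          refine mul_le_mul Nat.cast_div_le (mul_le_mul_of_nonneg_left e1 hL.le) ?_ (by positivity)
          have : 0 ≤ Real.log ((s : ℝ) ^ 2 + 1) := Real.log_nonneg (by nlinarith)
          positivity
      _ ≤ (ρ * σ / s) * (L * (3.5 * (g * σ))) := by gcongr
      _ = _ := by rw [hσs]; field_simp
  have h2 := round_cost_le hL hg08 hσ1 hσs (Λ := Real.log ((s : ℝ) ^ 2 + 1)) (by linarith)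
  rw [Nat.cast_pow] at key
  have h3 : (T : ℝ) * (9 * (L * g / σ)) ≤ 9 * (L * g * ρ) := by
    calc (T : ℝ) * (9 * (L * g / σ)) ≤ ρ * σ * (9 * (L * g / σ)) := by gcongr
      _ = _ := by field_simp
  have h4 := mul_le_mul_of_nonneg_left h2 (by linarith : (0 : ℝ) ≤ T)
  have h5 : ((Finset.range T).filter fun t => ¬IsStable μ s t).card * L ≤ 15 * (L * g * ρ) := by
    calc _ ≤ 12 * ρ * L := by gcongr
      _ ≤ 12 * ρ * L * (1.25 * g) := le_mul_of_one_le_right (by positivity) (by linarith)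
      _ = _ := by ring
  have h6 : L * g * ρ ≤ L * Real.sqrt (d * Real.log (max 1 L * T)) * ρ := by gcongr
  have h7 : 0 ≤ L * g * ρ := by positivity
  calc gameValue ℓ H Φ μ T [] 0 ≤ 40 * (L * g * ρ) := by linarith
    _ ≤ 40 * (L * Real.sqrt (d * Real.log (max 1 L * T)) * ρ) := by gcongr
    _ = _ := by rw [hρ]; ring

end

end Hybrid

/-! ### Discrete expectations and program logic -/

namespace Hybrid

noncomputable section

section pmf

variable {α β : Type*}

lemma pmfExp_pure (a : α) (f : α → ℝ) : pmfExp (PMF.pure a) f = f a := by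
  unfold pmfExp
  rw [tsum_eq_single a]
  · simp
  · intro b hb
    simp [PMF.pure_apply, hb]

lemma pmfExp_congr (p : PMF α) {f g : α → ℝ} (h : ∀ a ∈ p.support, f a = g a) :
    pmfExp p f = pmfExp p g := by
  refine tsum_congr fun a => ?_
  by_cases ha : p a = 0
  · simp [ha]
  · rw [h a ((p.mem_support_iff a).2 ha)]

/-- Fubini for double series: boundedness of `f` makes the joint series absolutely summable. -/
lemma pmfExp_bind (p : PMF α) (q : α → PMF β) {f : β → ℝ} {B : ℝ} (hf : ∀ b, |f b| ≤ B) :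
    pmfExp (p.bind q) f = pmfExp p fun a => pmfExp (q a) f := by
  have h1 : ∑' ab : α × β, p ab.1 * q ab.1 ab.2 ≠ ⊤ := by
    rw [ENNReal.tsum_prod' (f := fun ab : α × β => p ab.1 * q ab.1 ab.2)]
    simp only [ENNReal.tsum_mul_left, PMF.tsum_coe, mul_one]
    exact ENNReal.one_ne_top
  have h2 : Summable fun ab : α × β => (p ab.1 * q ab.1 ab.2).toReal * f ab.2 := by
    refine Summable.of_norm_bounded ((ENNReal.summable_toReal h1).mul_right B) fun ab => ?_
    rw [Real.norm_eq_abs, abs_mul, abs_of_nonneg ENNReal.toReal_nonneg]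
    exact mul_le_mul_of_nonneg_left (hf ab.2) ENNReal.toReal_nonneg
  have h3 : ∀ b, ((p.bind q) b).toReal * f b = ∑' a, (p a * q a b).toReal * f b := by
    intro b
    rw [PMF.bind_apply, ENNReal.tsum_toReal_eq fun a =>
      ENNReal.mul_ne_top (p.apply_ne_top a) ((q a).apply_ne_top b), tsum_mul_right]
  have h4 : ∀ a, (p a).toReal * ∑' b, (q a b).toReal * f b =
      ∑' b, (p a * q a b).toReal * f b := by
    intro a
    rw [← tsum_mul_left]
    exact tsum_congr fun b => by rw [ENNReal.toReal_mul, mul_assoc]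
  unfold pmfExp
  simp only [h3, h4]
  exact Summable.tsum_comm (f := fun a b => (p a * q a b).toReal * f b) h2

lemma pmfExp_map (p : PMF α) (g : α → β) {f : β → ℝ} {B : ℝ} (hf : ∀ b, |f b| ≤ B) :
    pmfExp (p.map g) f = pmfExp p fun a => f (g a) := by
  rw [← PMF.bind_pure_comp, pmfExp_bind p _ hf]
  simp only [Function.comp_apply, pmfExp_pure]

lemma pmfExp_uniformOfFintype [Fintype α] [Nonempty α] (f : α → ℝ) :
    pmfExp (PMF.uniformOfFintype α) f = (∑ a, f a) / Fintype.card α := by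
  unfold pmfExp
  rw [tsum_fintype]
  simp only [PMF.uniformOfFintype_apply, ENNReal.toReal_inv, ENNReal.toReal_natCast]
  rw [← Finset.mul_sum]
  ring

lemma PMF_bind_congr (p : PMF α) {q q' : α → PMF β} (h : ∀ a ∈ p.support, q a = q' a) :
    p.bind q = p.bind q' := by
  ext b
  simp only [PMF.bind_apply]
  refine tsum_congr fun a => ?_
  by_cases ha : p a = 0
  · simp [ha]
  · rw [h a ((p.mem_support_iff a).2 ha)]

/-- Lists of `n` independent draws from `u`, the newest first. -/
def iidDraws (u : PMF α) : ℕ → PMF (List α)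
  | 0 => PMF.pure []
  | n + 1 => (iidDraws u n).bind fun l => u.map fun a => a :: l

lemma length_of_mem_support_iidDraws (u : PMF α) {n : ℕ} {l : List α}
    (hl : l ∈ (iidDraws u n).support) : l.length = n := by
  induction n generalizing l with
  | zero => simpa [iidDraws] using hl
  | succ n ih =>
    rw [iidDraws, PMF.mem_support_bind_iff] at hl
    obtain ⟨l', hl', hl⟩ := hl
    rw [PMF.mem_support_map_iff] at hl
    obtain ⟨a, -, rfl⟩ := hl
    simp [ih hl']

/-- A uniform index in `{0, …, m}` and a uniform bit. -/
def drawPair (m : ℕ) : PMF (Fin (m + 1) × Fin 2) :=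
  (PMF.uniformOfFintype (Fin (m + 1))).bind fun i =>
    (PMF.uniformOfFintype (Fin 2)).map fun j => (i, j)

/-- The perturbation of the round `lo + i` that a draw stands for. -/
def toSigned (lo : ℕ) {m : ℕ} (a : Fin (m + 1) × Fin 2) : ℕ × Bool := (lo + a.1, a.2 == 1)

/-- Both recursions add the newest draw at the head, so the program's random lists match `avgDraws`
step by step. -/
lemma pmfExp_iidDraws (lo m k : ℕ) {φ : List (ℕ × Bool) → ℝ} {B : ℝ} (hφ : ∀ l, |φ l| ≤ B) :
    pmfExp (iidDraws (drawPair m) k) (fun l => φ (l.map (toSigned lo))) =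
      avgDraws (Finset.Ico lo (lo + (m + 1))) k φ := by
  induction k generalizing φ with
  | zero => simp [iidDraws, pmfExp_pure, avgDraws]
  | succ k ih =>
    have hstep : ∀ l : List (Fin (m + 1) × Fin 2), pmfExp ((drawPair m).map fun a => a :: l)
        (fun l => φ (l.map (toSigned lo))) =
        (∑ i ∈ Finset.Ico lo (lo + (m + 1)), (φ ((i, true) :: l.map (toSigned lo)) +
          φ ((i, false) :: l.map (toSigned lo))) / 2) /
          (Finset.Ico lo (lo + (m + 1))).card := by
      intro l
      rw [pmfExp_map _ _ (B := B) fun l => hφ _, drawPair, pmfExp_bind _ _ (B := B) fun l => hφ _]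
      simp only [pmfExp_map _ _ (B := B) fun l : Fin (m + 1) × Fin 2 =>
        hφ (List.map (toSigned lo) (l :: _))]
      rw [pmfExp_uniformOfFintype, Finset.sum_Ico_eq_sum_range, Nat.card_Ico,
        Nat.add_sub_cancel_left, Fintype.card_fin, Finset.sum_range]
      congr 1
      refine Finset.sum_congr rfl fun i _ => ?_
      rw [pmfExp_uniformOfFintype, Fin.sum_univ_two]
      simp [toSigned, add_comm]
    rw [iidDraws, pmfExp_bind _ _ (B := B) fun l => hφ _]
    simp only [hstep]
    have hB : 0 ≤ B := (abs_nonneg _).trans (hφ [])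
    have hc : (0 : ℝ) < (Finset.Ico lo (lo + (m + 1))).card := by simp; positivity
    refine ih (φ := fun l => (∑ i ∈ Finset.Ico lo (lo + (m + 1)),
      (φ ((i, true) :: l) + φ ((i, false) :: l)) / 2) / (Finset.Ico lo (lo + (m + 1))).card)
      fun l => ?_
    rw [abs_div, abs_of_pos hc, div_le_iff₀ hc]
    refine (Finset.abs_sum_le_sum_abs _ _).trans ?_
    rw [mul_comm, ← nsmul_eq_mul]
    refine Finset.sum_le_card_nsmul _ _ _ fun i _ => ?_
    rw [abs_div, abs_two, div_le_iff₀ two_pos]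
    have := abs_add_le (φ ((i, true) :: l)) (φ ((i, false) :: l))
    have := hφ ((i, true) :: l)
    have := hφ ((i, false) :: l)
    linarith

end pmf

variable {X : Type*}

section hoare

variable (ℓ : ℝ → ℝ → ℝ) (H : Set (X → I01))

/-- The command is deterministic from `s`, takes at most `τ` units of time and establishes `Q`. -/
def Cmd.Det (c : Cmd) (s : Store X) (Q : Store X → Prop) (τ : ℕ) : Prop :=
  ∃ s' n, c.exec ℓ H s = PMF.pure (s', n) ∧ Q s' ∧ n ≤ τ

/-- The outcome of the command is a function of a draw from `D`; it takes at most `τ` units of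
time and establishes `Q`. -/
def Cmd.Rnd {α : Type*} (c : Cmd) (s : Store X) (D : PMF α) (Q : α → Store X → Prop)
    (τ : ℕ) : Prop :=
  ∃ F : α → Store X × ℕ, c.exec ℓ H s = D.map F ∧ ∀ a ∈ D.support, Q a (F a).1 ∧ (F a).2 ≤ τ

variable {ℓ H}

lemma Cmd.Det.seq {c d : Cmd} {s : Store X} {Q R : Store X → Prop} {τ τ' : ℕ}
    (hc : c.Det ℓ H s Q τ) (hd : ∀ s', Q s' → d.Det ℓ H s' R τ') :
    (c.seq d).Det ℓ H s R (τ + τ') := by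
  obtain ⟨s₁, n₁, h1, hQ, hn⟩ := hc
  obtain ⟨s₂, n₂, h2, hR, hn'⟩ := hd s₁ hQ
  refine ⟨s₂, n₁ + n₂, ?_, hR, by omega⟩
  rw [Cmd.exec, h1, PMF.pure_bind, h2, PMF.pure_map]

lemma Cmd.Det.seq_rnd {α : Type*} {c d : Cmd} {s : Store X} {Q : Store X → Prop} {D : PMF α}
    {R : α → Store X → Prop} {τ τ' : ℕ}
    (hc : c.Det ℓ H s Q τ) (hd : ∀ s', Q s' → d.Rnd ℓ H s' D R τ') :
    (c.seq d).Rnd ℓ H s D R (τ + τ') := by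
  obtain ⟨s₁, n₁, h1, hQ, hn⟩ := hc
  obtain ⟨F, h2, hF⟩ := hd s₁ hQ
  refine ⟨fun a => ((F a).1, n₁ + (F a).2), ?_, fun a ha => ⟨(hF a ha).1, by
    have := (hF a ha).2; dsimp only; omega⟩⟩
  rw [Cmd.exec, h1, PMF.pure_bind, h2, PMF.map_comp]
  rfl

lemma Cmd.Rnd.seq_det {α : Type*} {c d : Cmd} {s : Store X} {D : PMF α}
    {Q R : α → Store X → Prop} {τ τ' : ℕ}
    (hc : c.Rnd ℓ H s D Q τ) (hd : ∀ a s', Q a s' → d.Det ℓ H s' (R a) τ') :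
    (c.seq d).Rnd ℓ H s D R (τ + τ') := by
  obtain ⟨F, h1, hF⟩ := hc
  -- The outcome must be chosen as a total function of the draw; off the support any value will do.
  have hd' : ∀ a, ∃ p : Store X × ℕ, a ∈ D.support →
      d.exec ℓ H (F a).1 = PMF.pure p ∧ R a p.1 ∧ p.2 ≤ τ' := by
    intro a
    by_cases ha : a ∈ D.support
    · obtain ⟨s', n, h⟩ := hd a (F a).1 (hF a ha).1
      exact ⟨(s', n), fun _ => h⟩
    · exact ⟨F a, fun h => absurd h ha⟩
  choose G hG using hd'
  refine ⟨fun a => ((G a).1, (F a).2 + (G a).2), ?_, fun a ha => ⟨(hG a ha).2.1, by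
    have := (hF a ha).2; have := (hG a ha).2.2; dsimp only; omega⟩⟩
  rw [Cmd.exec, h1, PMF.bind_map, ← PMF.bind_pure_comp]
  refine PMF_bind_congr D fun a ha => ?_
  simp only [Function.comp_apply, (hG a ha).1, PMF.pure_map]

lemma Cmd.Det.loop {v : ℕ} {e : NExp} {c : Cmd} {s : Store X} {n τ : ℕ} (he : e.eval s = n)
    (Inv : ℕ → Store X → Prop) (h0 : Inv 0 s)
    (hstep : ∀ j < n, ∀ st, Inv j st → c.Det ℓ H (st.setNat v 0 j) (Inv (j + 1)) τ) :
    (Cmd.loop v e c).Det ℓ H s (Inv n) (1 + n * (τ + 1)) := by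
  unfold Cmd.Det
  rw [Cmd.exec, he]
  clear he
  induction n with
  | zero => exact ⟨s, 1, rfl, h0, by omega⟩
  | succ n ih =>
    obtain ⟨s₁, n₁, h1, hI, hn⟩ := ih fun j hj => hstep j (by omega)
    obtain ⟨s₂, n₂, h2, hI', hn'⟩ := hstep n (by omega) s₁ hI
    refine ⟨s₂, n₁ + n₂ + 1, ?_, hI', ?_⟩
    · rw [iterate, h1, PMF.pure_bind, h2, PMF.pure_map]
    · rw [Nat.succ_mul]; omega

lemma Cmd.Rnd.loop {α : Type*} {u : PMF α} {v : ℕ} {e : NExp} {c : Cmd} {s : Store X} {n τ : ℕ}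
    (he : e.eval s = n) (Inv : List α → Store X → Prop) (h0 : Inv [] s)
    (hstep : ∀ l : List α, l.length < n → ∀ st, Inv l st →
      c.Rnd ℓ H (st.setNat v 0 l.length) u (fun a => Inv (a :: l)) τ) :
    (Cmd.loop v e c).Rnd ℓ H s (iidDraws u n) Inv (1 + n * (τ + 1)) := by
  classical
  unfold Cmd.Rnd
  rw [Cmd.exec, he]
  clear he
  induction n with
  | zero =>
    refine ⟨fun _ => (s, 1), by rw [iidDraws, PMF.pure_map, iterate], fun l hl => ?_⟩
    rw [iidDraws, PMF.mem_support_pure_iff] at hl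
    subst hl
    exact ⟨h0, by simp⟩
  | succ n ih =>
    obtain ⟨F, h1, hF⟩ := ih fun l hl => hstep l (by omega)
    have hstep' : ∀ l : List α, ∃ G : α → Store X × ℕ, l ∈ (iidDraws u n).support →
        c.exec ℓ H ((F l).1.setNat v 0 n) = u.map G ∧
          ∀ a ∈ u.support, Inv (a :: l) (G a).1 ∧ (G a).2 ≤ τ := by
      intro l
      by_cases hl : l ∈ (iidDraws u n).support
      · have hlen := length_of_mem_support_iidDraws u hl
        obtain ⟨G, hG⟩ := hstep l (by omega) (F l).1 (hF l hl).1
        rw [hlen] at hG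
        exact ⟨G, fun _ => hG⟩
      · exact ⟨fun _ => F l, fun h => absurd h hl⟩
    choose G hG using hstep'
    -- The value on the empty list is a dummy, as lists of `n + 1` draws are never empty.
    refine ⟨fun l => match l with
      | [] => (s, 0)
      | a :: l => ((G l a).1, (F l).2 + (G l a).2 + 1), ?_, fun l hl => ?_⟩
    · rw [iterate, h1, PMF.bind_map, iidDraws, PMF.map_bind]
      refine PMF_bind_congr _ fun l hl => ?_
      simp only [Function.comp_apply, (hG l hl).1, PMF.map_comp]
      rfl
    · rw [iidDraws, PMF.mem_support_bind_iff] at hl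
      obtain ⟨l', hl', hl⟩ := hl
      rw [PMF.mem_support_map_iff] at hl
      obtain ⟨a, ha, rfl⟩ := hl
      refine ⟨((hG l' hl').2 a ha).1, ?_⟩
      have := ((hG l' hl').2 a ha).2
      have := (hF l' hl').2
      simp only
      rw [Nat.succ_mul]
      omega

lemma setCell_apply {α : Type*} (m : ℕ → ℕ → α) (a i : ℕ) (v : α) (a' i' : ℕ) :
    setCell m a i v a' i' = if a' = a ∧ i' = i then v else m a' i' := by
  unfold setCell
  by_cases ha : a' = a
  · subst ha
    by_cases hi : i' = i
    · subst hi; simp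
    · simp [hi]
  · simp [ha]

end hoare

end

end Hybrid

/-! ### The program and its deterministic phases -/

namespace Hybrid

noncomputable section

/-- The cell `0` of the natural-number array `a`. -/
abbrev NExp.var (a : ℕ) : NExp := .get a (.const 0)

/-- Array `1` gets the number of `j ≤ t` with `j ^ 5 * K ^ 2 < T ^ 2`. -/
def blockLengthCmd : Cmd :=
  .loop 8 (.add (.get 0 (.const 2)) (.const 1))
    (.iteR (.mul (.cast (.get 0 (.const 0))) (.cast (.get 0 (.const 0))))
      (.mul (.mul (.mul (.mul (.mul (.mul (.cast (.var 8)) (.cast (.var 8))) (.cast (.var 8)))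
        (.cast (.var 8))) (.cast (.var 8))) (.cast (.get 0 (.const 1))))
        (.cast (.get 0 (.const 1))))
      .skip (.setN 1 (.const 0) (.add (.var 1) (.const 1))))

/-- Array `2` gets the square of the block length. -/
def poolSizeCmd : Cmd := .loop 8 (.var 1) (.setN 2 (.const 0) (.add (.var 2) (.var 1)))

/-- Array `3` gets the first round of the current block. -/
def blockStartCmd : Cmd :=
  .loop 8 (.get 0 (.const 2)) (.iteN (.add (.var 3) (.var 1)) (.get 0 (.const 2))
    (.setN 3 (.const 0) (.add (.var 3) (.var 1))) .skip)

/-- If the pool is full, arrays `4`, `5` get the numbers of past and of future rounds of the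
block. -/
def roundsCmd : Cmd :=
  .iteN (.var 2) (.get 0 (.const 2))
    (.seq (.setN 4 (.const 0) (.sub (.get 0 (.const 2)) (.var 3)))
      (.setN 5 (.const 0) (.sub (.sub (.var 1) (.const 1)) (.sub (.get 0 (.const 2)) (.var 3)))))
    .skip

/-- Copy the samples of the block. -/
def copyCmd : Cmd :=
  .loop 8 (.var 4) (.seq (.setX 1 (.var 8) 0 (.add (.var 3) (.var 8)))
    (.setR 2 (.var 8) (.get 1 (.add (.var 3) (.var 8)))))

/-- Draw features from the pool, and signs. -/
def drawCmd : Cmd :=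
  .loop 8 (.var 5) (.seq (.rand 6 (.const 0) (.sub (.var 2) (.const 1)))
    (.seq (.rand 7 (.const 0) (.const 1))
      (.seq (.setX 2 (.add (.var 8) (.const 1)) 0 (.add (.sub (.var 3) (.var 2)) (.var 6)))
        (.setR 3 (.add (.var 8) (.const 1)) (.sub (.cast (.var 7)) (.cast (.const 1)))))))

/-- Query the oracle for the sign `+` and the sign `-` of the current feature, and predict. -/
def predictCmd : Cmd :=
  .seq (.erm 4 (.const 0) 1 2 (.var 4) 2 3 (.add (.var 5) (.const 1)) (.get 0 (.const 0)))
    (.seq (.setR 3 (.const 0) (.sub (.cast (.const 0)) (.cast (.const 1))))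
      (.seq (.erm 4 (.const 1) 1 2 (.var 4) 2 3 (.add (.var 5) (.const 1)) (.get 0 (.const 0)))
        (.setR 0 (.const 1) (.div (.sub (.get 4 (.const 0)) (.get 4 (.const 1)))
          (.add (.get 0 (.const 0)) (.get 0 (.const 0)))))))

/-- The prediction program. -/
def playoutCmd : Cmd :=
  .seq blockLengthCmd (.seq poolSizeCmd (.seq blockStartCmd (.seq roundsCmd (.seq copyCmd
    (.seq drawCmd predictCmd)))))

variable {X : Type*} {ℓ : ℝ → ℝ → ℝ} {H : Set (X → I01)}

/-- Only working cells of the natural-number arrays differ from `s₀`, and arrays `1, …, 5` hold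
the given values. -/
structure Agrees (s₀ s : Store X) (a m b r k : ℕ) : Prop where
  real : s.real = s₀.real
  feat : s.feat = s₀.feat
  inputs : ∀ i, s.nat 0 i = s₀.nat 0 i
  n1 : s.nat 1 0 = a
  n2 : s.nat 2 0 = m
  n3 : s.nat 3 0 = b
  n4 : s.nat 4 0 = r
  n5 : s.nat 5 0 = k

lemma Agrees.setLoop {s₀ s : Store X} {a m b r k : ℕ} (h : Agrees s₀ s a m b r k) (j : ℕ) :
    Agrees s₀ (s.setNat 8 0 j) a m b r k := by
  obtain ⟨h1, h2, h3, h4, h5, h6, h7, h8⟩ := h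
  constructor <;> simp [Store.setNat, setCell_apply, *]

lemma setNat_nat (s : Store X) (a i v a' i' : ℕ) :
    (s.setNat a i v).nat a' i' = if a' = a ∧ i' = i then v else s.nat a' i' :=
  setCell_apply ..

lemma Cmd.det_setN (a : ℕ) (i e : NExp) (s : Store X) {Q : Store X → Prop}
    (h : Q (s.setNat a (i.eval s) (e.eval s))) : (Cmd.setN a i e).Det ℓ H s Q 1 :=
  ⟨_, 1, rfl, h, le_rfl⟩

lemma Cmd.det_skip {s : Store X} {Q : Store X → Prop} (h : Q s) : Cmd.skip.Det ℓ H s Q 1 :=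
  ⟨_, 1, rfl, h, le_rfl⟩

lemma Cmd.det_setR (a : ℕ) (i : NExp) (e : RExp) (s : Store X) {Q : Store X → Prop}
    (h : Q (s.setReal a (i.eval s) (e.eval ℓ s))) : (Cmd.setR a i e).Det ℓ H s Q 1 :=
  ⟨_, 1, rfl, h, le_rfl⟩

lemma Cmd.det_setX (a : ℕ) (i : NExp) (b : ℕ) (j : NExp) (s : Store X) {Q : Store X → Prop}
    (h : Q (s.setFeat a (i.eval s) (s.feat b (j.eval s)))) : (Cmd.setX a i b j).Det ℓ H s Q 1 :=
  ⟨_, 1, rfl, h, le_rfl⟩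

lemma Cmd.det_iteN {e f : NExp} {c d : Cmd} {s : Store X} {Q : Store X → Prop} {τ : ℕ}
    (hc : e.eval s ≤ f.eval s → c.Det ℓ H s Q τ) (hd : ¬e.eval s ≤ f.eval s → d.Det ℓ H s Q τ) :
    (Cmd.iteN e f c d).Det ℓ H s Q (τ + 1) := by
  unfold Cmd.Det
  rw [Cmd.exec]
  split_ifs with h
  · obtain ⟨s', n, h1, h2, h3⟩ := hc h
    exact ⟨s', n + 1, by rw [h1, PMF.pure_map], h2, by omega⟩
  · obtain ⟨s', n, h1, h2, h3⟩ := hd h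
    exact ⟨s', n + 1, by rw [h1, PMF.pure_map], h2, by omega⟩

lemma Cmd.det_iteR {e f : RExp} {c d : Cmd} {s : Store X} {Q : Store X → Prop} {τ : ℕ}
    (hc : e.eval ℓ s ≤ f.eval ℓ s → c.Det ℓ H s Q τ)
    (hd : ¬e.eval ℓ s ≤ f.eval ℓ s → d.Det ℓ H s Q τ) :
    (Cmd.iteR e f c d).Det ℓ H s Q (τ + 1) := by
  unfold Cmd.Det
  rw [Cmd.exec]
  split_ifs with h
  · obtain ⟨s', n, h1, h2, h3⟩ := hc h
    exact ⟨s', n + 1, by rw [h1, PMF.pure_map], h2, by omega⟩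
  · obtain ⟨s', n, h1, h2, h3⟩ := hd h
    exact ⟨s', n + 1, by rw [h1, PMF.pure_map], h2, by omega⟩

/-- The test succeeds exactly from `j = s` on. The clause `0 < j` is there because `IsBlockLength`
says nothing about `j = 0`, which has to be counted. -/
lemma count_succ_min {T K s : ℕ} (hs : IsBlockLength T K s) (j : ℕ) :
    min (j + 1) s = if T ^ 2 ≤ j ^ 5 * K ^ 2 ∧ 0 < j then min j s else min j s + 1 := by
  rcases Nat.lt_or_ge j s with h | h
  · rw [if_neg, min_eq_left h, min_eq_left h.le]
    rintro ⟨h1, h2⟩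
    exact absurd h1 (hs.2.2 j h h2).not_ge
  · rw [if_pos, min_eq_right h, min_eq_right (by omega)]
    exact ⟨hs.2.1.trans (Nat.mul_le_mul_right _ (Nat.pow_le_pow_left h 5)), by
      have := hs.1; omega⟩

/-- The search stops after `t + 1` steps, because the time may depend on `t` but not on `T`. If it
stops short of `s`, the value found is `t + 1`, whose square exceeds `t`, so the pool test fails as
it should. -/
lemma blockLengthCmd_det {T K s t : ℕ} (hT : 0 < T) (hs : IsBlockLength T K s) (s₀ st : Store X)
    (h0 : s₀.nat 0 0 = T) (h1 : s₀.nat 0 1 = K) (h2 : s₀.nat 0 2 = t)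
    (hst : Agrees s₀ st 0 0 0 0 0) :
    blockLengthCmd.Det ℓ H st (fun s' => Agrees s₀ s' (min (t + 1) s) 0 0 0 0)
      (1 + (t + 1) * 3) := by
  refine Cmd.Det.loop (by simp [NExp.eval, hst.inputs, h2])
    (fun j s' => Agrees s₀ s' (min j s) 0 0 0 0) (by simpa using hst) fun j _ st hI => ?_
  have hI := hI.setLoop j
  have h8 : (st.setNat 8 0 j).nat 8 0 = j := by simp [setNat_nat]
  set st := st.setNat 8 0 j
  have hcond : (RExp.mul (.cast (.get 0 (.const 0))) (.cast (.get 0 (.const 0)))).eval ℓ st ≤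
      (RExp.mul (.mul (.mul (.mul (.mul (.mul (.cast (.var 8)) (.cast (.var 8))) (.cast (.var 8)))
        (.cast (.var 8))) (.cast (.var 8))) (.cast (.get 0 (.const 1))))
        (.cast (.get 0 (.const 1)))).eval ℓ st ↔ T ^ 2 ≤ j ^ 5 * K ^ 2 ∧ 0 < j := by
    simp only [RExp.eval, NExp.eval, hI.inputs, h0, h1, h8]
    have e : ((T : ℝ) * T ≤ j * j * j * j * j * K * K) ↔ T ^ 2 ≤ j ^ 5 * K ^ 2 := by
      rw [← Nat.cast_le (α := ℝ)]
      push_cast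
      rw [show (j : ℝ) * j * j * j * j * K * K = (j : ℝ) ^ 5 * (K : ℝ) ^ 2 by ring,
        show (T : ℝ) * T = (T : ℝ) ^ 2 by ring]
    rw [e]
    refine ⟨fun h => ⟨h, Nat.pos_of_ne_zero ?_⟩, fun h => h.1⟩
    rintro rfl
    have : 0 < T ^ 2 := by positivity
    simp at h
    omega
  refine Cmd.det_iteR (fun h => Cmd.det_skip ?_) fun h => Cmd.det_setN _ _ _ _ ?_
  · rw [count_succ_min hs, if_pos (hcond.1 h)]
    exact hI
  · rw [count_succ_min hs, if_neg fun h' => h (hcond.2 h')]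
    obtain ⟨g1, g2, g3, g4, g5, g6, g7, g8⟩ := hI
    constructor <;> simp [Store.setNat, setCell_apply, NExp.eval, *]

/-- Natural-number expressions have no product, so the square is accumulated by repeated addition.
-/
lemma poolSizeCmd_det {a : ℕ} (s₀ st : Store X) (hst : Agrees s₀ st a 0 0 0 0) :
    poolSizeCmd.Det ℓ H st (fun s' => Agrees s₀ s' a (a ^ 2) 0 0 0) (1 + a * 2) := by
  rw [sq]
  refine Cmd.Det.loop (by simp [NExp.eval, hst.n1])
    (fun j s' => Agrees s₀ s' a (j * a) 0 0 0) (by simpa using hst) fun j _ st hI =>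
    Cmd.det_setN _ _ _ _ ?_
  obtain ⟨g1, g2, g3, g4, g5, g6, g7, g8⟩ := hI.setLoop j
  constructor <;> simp [Store.setNat, setCell_apply, NExp.eval, add_mul] <;>
    simp_all [Store.setNat, setCell_apply]

/-- In the absence of division, multiples of `a` are added while they stay at most `t`; `t`
iterations suffice because `t / a ≤ t`. -/
lemma blockStartCmd_det {a m t : ℕ} (ha : 0 < a) (s₀ st : Store X) (h2 : s₀.nat 0 2 = t)
    (hst : Agrees s₀ st a m 0 0 0) :
    blockStartCmd.Det ℓ H st (fun s' => Agrees s₀ s' a m (blockStart a t) 0 0)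
      (1 + t * 3) := by
  have hfin : blockStart a t = a * min t (t / a) := by
    rw [min_eq_right (Nat.div_le_self t a), blockStart]
  rw [hfin]
  refine Cmd.Det.loop (by simp [NExp.eval, hst.inputs, h2])
    (fun j s' => Agrees s₀ s' a m (a * min j (t / a)) 0 0) (by simpa using hst)
    fun j _ st hI => ?_
  have hI := hI.setLoop j
  set st := st.setNat 8 0 j
  have hcond : a * min j (t / a) + a ≤ t ↔ j < t / a := by
    rw [← mul_add_one, mul_comm, ← Nat.le_div_iff_mul_le ha]
    omega
  refine Cmd.det_iteN (fun h => Cmd.det_setN _ _ _ _ ?_) fun h => Cmd.det_skip ?_ <;>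
    simp only [NExp.eval, hI.inputs, h2, hI.n1, hI.n3, hcond] at h
  · rw [min_eq_left (by omega : j + 1 ≤ t / a)]
    have hI3 := hI.n3
    rw [min_eq_left (by omega : j ≤ t / a)] at hI3
    obtain ⟨g1, g2, g3, g4, g5, g6, g7, g8⟩ := hI
    constructor <;> simp [Store.setNat, setCell_apply, NExp.eval, *]
    ring
  · rw [min_eq_right (by omega : t / a ≤ j + 1)]
    rw [min_eq_right (by omega : t / a ≤ j)] at hI
    exact hI

/-- Numbers of past and of future rounds of the block, or zero if the pool is not full. -/
def pastRounds (a t : ℕ) : ℕ := if a ^ 2 ≤ t then t - blockStart a t else 0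

/-- See `pastRounds`. -/
def futureRounds (a t : ℕ) : ℕ := if a ^ 2 ≤ t then a - 1 - (t - blockStart a t) else 0

lemma roundsCmd_det {a t : ℕ} (s₀ st : Store X) (h2 : s₀.nat 0 2 = t)
    (hst : Agrees s₀ st a (a ^ 2) (blockStart a t) 0 0) :
    roundsCmd.Det ℓ H st (fun s' => Agrees s₀ s' a (a ^ 2) (blockStart a t) (pastRounds a t)
      (futureRounds a t)) 3 := by
  refine Cmd.det_iteN (τ := 2) (fun h => ?_) fun h => ?_ <;>
    simp only [NExp.eval, hst.inputs, h2, hst.n2] at h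
  · rw [pastRounds, futureRounds, if_pos h, if_pos h]
    obtain ⟨g1, g2, g3, g4, g5, g6, g7, g8⟩ := hst
    refine Cmd.Det.seq (Q := fun s' => Agrees s₀ s' a (a ^ 2) (blockStart a t)
      (t - blockStart a t) 0) (τ := 1) (τ' := 1) (Cmd.det_setN _ _ _ _ ?_) fun s' hs' => ?_
    · constructor <;> simp [Store.setNat, setCell_apply, NExp.eval, *]
    · obtain ⟨g1, g2, g3, g4, g5, g6, g7, g8⟩ := hs'
      refine Cmd.det_setN _ _ _ _ ?_
      constructor <;> simp [Store.setNat, setCell_apply, NExp.eval, *]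
  · rw [pastRounds, futureRounds, if_neg h, if_neg h]
    obtain ⟨s', n, h1, h3, h4⟩ := Cmd.det_skip (ℓ := ℓ) (H := H)
      (Q := fun s' => Agrees s₀ s' a (a ^ 2) (blockStart a t) 0 0) hst
    exact ⟨s', n, h1, h3, by omega⟩

/-- The memory after the samples of the block have been copied. -/
structure Loaded (s₀ s : Store X) (m b r k : ℕ) : Prop where
  inputs : s.feat 0 = s₀.feat 0
  weight : s.real 0 0 = s₀.real 0 0
  n2 : s.nat 2 0 = m
  n3 : s.nat 3 0 = b
  n4 : s.nat 4 0 = r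
  n5 : s.nat 5 0 = k
  xs : ∀ i < r, s.feat 1 i = s₀.feat 0 (b + i)
  ys : ∀ i < r, s.real 2 i = s₀.real 1 (b + i)
  current : s.feat 2 0 = s₀.feat 2 0
  sign : s.real 3 0 = s₀.real 3 0

lemma copyCmd_det {a m b r k : ℕ} (s₀ st : Store X) (hst : Agrees s₀ st a m b r k) :
    copyCmd.Det ℓ H st (fun s' => Loaded s₀ s' m b r k) (1 + r * 3) := by
  -- The invariant must also record that the label array is intact, since every iteration reads from
  -- it.
  suffices h : copyCmd.Det ℓ H st (fun s' => Loaded s₀ s' m b r k ∧ s'.real 1 = s₀.real 1)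
      (1 + r * 3) by
    obtain ⟨s', n, h1, h2, h3⟩ := h
    exact ⟨s', n, h1, h2.1, h3⟩
  have hinv := Cmd.Det.loop (ℓ := ℓ) (H := H) (v := 8) (e := .var 4) (s := st) (n := r) (τ := 2)
    (c := .seq (.setX 1 (.var 8) 0 (.add (.var 3) (.var 8)))
      (.setR 2 (.var 8) (.get 1 (.add (.var 3) (.var 8))))) (by simp [NExp.eval, hst.n4])
    (fun j s' => s'.feat 0 = s₀.feat 0 ∧ s'.real 1 = s₀.real 1 ∧ s'.real 0 0 = s₀.real 0 0 ∧
      s'.nat 2 0 = m ∧ s'.nat 3 0 = b ∧ s'.nat 4 0 = r ∧ s'.nat 5 0 = k ∧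
      (∀ i < j, s'.feat 1 i = s₀.feat 0 (b + i)) ∧ (∀ i < j, s'.real 2 i = s₀.real 1 (b + i)) ∧
      s'.feat 2 0 = s₀.feat 2 0 ∧ s'.real 3 0 = s₀.real 3 0) ?_ ?_
  · obtain ⟨s', n, h1, ⟨g1, g2, g3, g4, g5, g6, g7, g8, g9, g10, g11⟩, h3⟩ := hinv
    exact ⟨s', n, h1, ⟨⟨g1, g3, g4, g5, g6, g7, g8, g9, g10, g11⟩, g2⟩, h3⟩
  · simp [hst.feat, hst.real, hst.n2, hst.n3, hst.n4, hst.n5]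
  · rintro j - st ⟨g1, g2, g3, g4, g5, g6, g7, g8, g9, g10, g11⟩
    refine Cmd.Det.seq (τ := 1) (τ' := 1) (Q := fun s' => s' = ((st.setNat 8 0 j).setFeat 1 j
      (s₀.feat 0 (b + j)))) (Cmd.det_setX _ _ _ _ _ ?_) ?_
    · simp [NExp.eval, Store.setNat, setCell_apply, g1, g5]
    · rintro _ rfl
      refine Cmd.det_setR _ _ _ _ ?_
      have e1 : ∀ v : X, setCell st.feat 1 j v 0 = st.feat 0 := fun v => by
        ext i; simp [setCell_apply]
      simp only [NExp.eval, RExp.eval, Store.setNat, Store.setReal, Store.setFeat, e1]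
      refine ⟨g1, g2, ?_, ?_, ?_, ?_, ?_, fun i hi => ?_, fun i hi => ?_, ?_, ?_⟩ <;>
        simp only [setCell_apply]
      · simpa using g3
      · simpa using g4
      · simpa using g5
      · simpa using g6
      · simpa using g7
      · by_cases hij : i = j
        · simp [hij]
        · simpa [hij] using g8 i (by omega)
      · by_cases hij : i = j
        · simp [hij, g5, g2]
        · simpa [hij] using g9 i (by omega)
      · simpa using g10
      · simpa using g11

end

end Hybrid

/-! ### Random draws and oracle calls -/

namespace Hybrid

noncomputable section

variable {X : Type*} {ℓ : ℝ → ℝ → ℝ} {H : Set (X → I01)}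

lemma Cmd.exec_rand {a n : ℕ} {i e : NExp} {s : Store X} (he : e.eval s = n) :
    (Cmd.rand a i e).exec ℓ H s = (PMF.uniformOfFintype (Fin (n + 1))).map
      fun j : Fin (n + 1) => (s.setNat a (i.eval s) j, 1) := by
  subst he
  exact PMF.map_comp (fun j : Fin _ => (j : ℕ)) _ fun j => (s.setNat a (i.eval s) j, 1)

lemma Cmd.rnd_rand_seq_det {a n τ : ℕ} {i e : NExp} {c : Cmd} {s : Store X}
    (he : e.eval s = n) {Q : Fin (n + 1) → Store X → Prop}
    (hc : ∀ j : Fin (n + 1), c.Det ℓ H (s.setNat a (i.eval s) j) (Q j) τ) :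
    ((Cmd.rand a i e).seq c).Rnd ℓ H s (PMF.uniformOfFintype (Fin (n + 1))) Q (1 + τ) := by
  choose F m hF hQ hm using hc
  refine ⟨fun j => (F j, 1 + m j), ?_, fun j _ => ⟨hQ j, by have := hm j; dsimp only; omega⟩⟩
  rw [Cmd.exec, Cmd.exec_rand he, PMF.bind_map, ← PMF.bind_pure_comp]
  refine congrArg (PMF.bind _) (funext fun j => ?_)
  simp only [Function.comp_apply, hF, PMF.pure_map]

lemma Cmd.rnd_rand_seq {α : Type*} {a n τ : ℕ} {i e : NExp} {c : Cmd} {s : Store X} {D : PMF α}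
    (he : e.eval s = n) {Q : Fin (n + 1) × α → Store X → Prop}
    (hc : ∀ j : Fin (n + 1), c.Rnd ℓ H (s.setNat a (i.eval s) j) D (fun b => Q (j, b)) τ) :
    ((Cmd.rand a i e).seq c).Rnd ℓ H s
      ((PMF.uniformOfFintype (Fin (n + 1))).bind fun j => D.map fun b => (j, b)) Q (1 + τ) := by
  choose F hF hQ using hc
  refine ⟨fun p => ((F p.1 p.2).1, 1 + (F p.1 p.2).2), ?_, ?_⟩
  · rw [Cmd.exec, Cmd.exec_rand he, PMF.bind_map, PMF.map_bind]
    refine congrArg (PMF.bind _) (funext fun j => ?_)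
    simp only [Function.comp_apply, hF, PMF.map_comp]
    rfl
  · rintro ⟨j, b⟩ hp
    rw [PMF.mem_support_bind_iff] at hp
    obtain ⟨j', -, hp⟩ := hp
    rw [PMF.mem_support_map_iff] at hp
    obtain ⟨b', hb, hp⟩ := hp
    obtain ⟨rfl, rfl⟩ := Prod.mk.inj hp
    have := hQ j' b' hb
    exact ⟨this.1, by dsimp only; omega⟩

/-- The cells `1, …, l.length` of the arrays `2` and `3` hold the features and the signs of the
perturbation `l` of the features `ω`. -/
def Perturbed (s : Store X) (ω : ℕ → X) (l : List (ℕ × Bool)) : Prop :=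
  ∀ φ : X → ℝ, ∑ j ∈ Finset.range l.length,
    ((signOf (s.real 3 (j + 1)) : ℤ) : ℝ) * φ (s.feat 2 (j + 1)) =
      (l.map fun p => sgn p.2 * φ (ω p.1)).sum

lemma Perturbed.cons {s s' : Store X} {ω : ℕ → X} {l : List (ℕ × Bool)} (h : Perturbed s ω l)
    {i : ℕ} {ε : Bool} (hr : ∀ j < l.length, s'.real 3 (j + 1) = s.real 3 (j + 1))
    (hf : ∀ j < l.length, s'.feat 2 (j + 1) = s.feat 2 (j + 1))
    (hε : ((signOf (s'.real 3 (l.length + 1)) : ℤ) : ℝ) = sgn ε)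
    (hi : s'.feat 2 (l.length + 1) = ω i) : Perturbed s' ω ((i, ε) :: l) := by
  intro φ
  rw [List.length_cons, Finset.sum_range_succ, hε, hi, List.map_cons, List.sum_cons, ← h φ,
    add_comm]
  congr 1
  refine Finset.sum_congr rfl fun j hj => ?_
  rw [hr j (Finset.mem_range.1 hj), hf j (Finset.mem_range.1 hj)]

/-- The program stores the bit minus one: bit `1` becomes `0`, which reads as `+`, and bit `0`
becomes `-1`. -/
lemma signOf_bit (j : Fin 2) : ((signOf ((j : ℕ) - 1 : ℝ) : ℤ) : ℝ) = sgn (j == 1) := by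
  fin_cases j <;> norm_num [signOf, sgn]

lemma drawCmd_rnd {m M b r k : ℕ} (hM : m + 1 = M) (s₀ st : Store X)
    (hst : Loaded s₀ st M b r k) :
    drawCmd.Rnd ℓ H st (iidDraws (drawPair m) k) (fun l s' => l.length = k ∧
      Loaded s₀ s' M b r k ∧ Perturbed s' (s₀.feat 0) (l.map (toSigned (b - M))))
      (1 + k * 5) := by
  have key : drawCmd.Rnd ℓ H st (iidDraws (drawPair m) k) (fun l s' =>
      Loaded s₀ s' M b r k ∧ Perturbed s' (s₀.feat 0) (l.map (toSigned (b - M))))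
      (1 + k * (4 + 1)) := by
    refine Cmd.Rnd.loop (by simp [NExp.eval, hst.n5]) (fun l s' =>
      Loaded s₀ s' M b r k ∧ Perturbed s' (s₀.feat 0) (l.map (toSigned (b - M))))
      ⟨hst, fun φ => by simp⟩ ?_
    rintro l - st ⟨⟨g1, g2, g3, g4, g5, g6, g7, g8, g9, g10⟩, hP⟩
    refine Cmd.rnd_rand_seq (n := m) (τ := 3) ?_ fun i => ?_
    · simp [NExp.eval, Store.setNat, setCell_apply, g3, ← hM]
    refine Cmd.rnd_rand_seq_det (n := 1) (τ := 2) rfl fun j => ?_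
    refine Cmd.Det.seq (τ := 1) (τ' := 1) (Q := fun s' => s' = ((((st.setNat 8 0 l.length).setNat
      6 0 i).setNat 7 0 j).setFeat 2 (l.length + 1) (s₀.feat 0 (b - M + i))))
      (Cmd.det_setX _ _ _ _ _ ?_) ?_
    · simp [NExp.eval, Store.setNat, setCell_apply, g1, g3, g4]
    · rintro _ rfl
      refine Cmd.det_setR _ _ _ _ ⟨?_, ?_⟩
      · simp only [NExp.eval, RExp.eval, Store.setNat, Store.setReal, Store.setFeat]
        refine ⟨funext fun i => ?_, ?_, ?_, ?_, ?_, ?_, fun i hi => ?_, fun i hi => ?_, ?_, ?_⟩ <;>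
          simp only [setCell_apply]
        · simpa using congrFun g1 i
        · simpa using g2
        · simpa using g3
        · simpa using g4
        · simpa using g5
        · simpa using g6
        · simpa using g7 i hi
        · simpa using g8 i hi
        · simpa using g9
        · simpa using g10
      · refine Perturbed.cons hP (fun i hi => ?_) (fun i hi => ?_) ?_ ?_ <;>
          simp only [List.length_map] at * <;>
          simp only [NExp.eval, RExp.eval, Store.setNat, Store.setReal, Store.setFeat,
            setCell_apply]
        · simp [hi.ne]
        · simp [hi.ne]
        · simpa using signOf_bit j
        · simp
  obtain ⟨F, h1, h2⟩ := key
  exact ⟨F, h1, fun l hl => ⟨⟨length_of_mem_support_iidDraws _ hl, (h2 l hl).1⟩, (h2 l hl).2⟩⟩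

/-- Slot `0` of the perturbation arrays is reserved for the current feature, and the draws occupy
the slots after it; hence the shift by one. -/
lemma mixedERM_eq {L : ℝ} (hL : 0 < L) {b r : ℕ} {xs zs ω : ℕ → X} {ys υ : ℕ → I01}
    {σ : ℕ → SignType} {l : List (ℕ × Bool)} {ε : Bool} (hx : ∀ i < r, xs i = ω (b + i))
    (hy : ∀ i < r, ys i = υ (b + i)) (hε : ((σ 0 : ℤ) : ℝ) = sgn ε)
    (hl : ∀ φ : X → ℝ, ∑ j ∈ Finset.range l.length, ((σ (j + 1) : ℤ) : ℝ) * φ (zs (j + 1)) =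
      (l.map fun p => sgn p.2 * φ (ω p.1)).sum) :
    mixedERM ℓ H r xs ys (l.length + 1) zs σ (max L 0) =
      minLossAt H ℓ L υ b (b + r) l ε (zs 0) ω := by
  unfold mixedERM minLossAt perturbedLoss
  congr 1
  ext h
  rw [Finset.sum_range_succ', hl fun z => ((h : X → I01) z : ℝ), hε, max_eq_left hL.le,
    Finset.sum_Ico_eq_sum_range, Nat.add_sub_cancel_left, mul_add, add_assoc]
  congr 1
  refine Finset.sum_congr rfl fun i hi => ?_
  rw [hx i (Finset.mem_range.1 hi), hy i (Finset.mem_range.1 hi)]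

lemma predictCmd_det {L : ℝ} (hL : 0 < L) {m b r : ℕ} {s₀ st : Store X}
    {l : List (ℕ × Bool)} (hst : Loaded s₀ st m b r l.length)
    (hP : Perturbed st (s₀.feat 0) l) (h0 : s₀.real 0 0 = L) (h3 : s₀.real 3 0 = 0) :
    predictCmd.Det ℓ H st (fun s' => s'.real 0 1 = prediction H ℓ L
      (fun i => clamp (s₀.real 1 i)) b (b + r) l (s₀.feat 2 0) (s₀.feat 0))
      (2 * (2 + r + l.length) + 2) := by
  have herm : ∀ (i : NExp) (ε : Bool) (s : Store X), s.feat = st.feat → s.nat = st.nat →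
      s.real 0 = st.real 0 → s.real 2 = st.real 2 → 
      (∀ j, s.real 3 (j + 1) = st.real 3 (j + 1)) →
      ((signOf (s.real 3 0) : ℤ) : ℝ) = sgn ε →
      (Cmd.erm 4 i 1 2 (.var 4) 2 3 (.add (.var 5) (.const 1)) (.get 0 (.const 0))).Det ℓ H s
        (fun s' => s' = s.setReal 4 (i.eval s) (minLossAt H ℓ L (fun i => clamp (s₀.real 1 i)) b
          (b + r) l ε (s₀.feat 2 0) (s₀.feat 0))) (2 + r + l.length) := by
    intro i ε s hf hn hr0 hr2 hr3 hε
    have e1 : (NExp.var 4).eval s = r := by simp [NExp.eval, hn, hst.n4]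
    have e2 : (NExp.add (.var 5) (.const 1)).eval s = l.length + 1 := by
      simp [NExp.eval, hn, hst.n5]
    have e3 : (RExp.get 0 (.const 0)).eval ℓ s = L := by
      simp [RExp.eval, NExp.eval, hr0, hst.weight, h0]
    refine ⟨_, _, rfl, ?_, by rw [e1, e2]; omega⟩
    rw [e1, e2, e3]
    congr 1
    rw [← hst.current, ← hf]
    refine mixedERM_eq hL (fun i hi => ?_) (fun i hi => ?_) hε fun φ => ?_
    · rw [hf, hst.xs i hi]
    · rw [hr2, hst.ys i hi]
    · rw [← hP φ]
      exact Finset.sum_congr rfl fun j _ => by rw [hr3, hf]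
  have e1 : ∀ (a : ℕ) (s : Store X) (i : ℕ) (v : ℝ) (a' : ℕ), a' ≠ a →
      (s.setReal a i v).real a' = s.real a' := by
    intro a s i v a' ha
    ext i'
    simp [Store.setReal, setCell_apply, ha]
  have hτ : 2 * (2 + r + l.length) + 2 =
    (2 + r + l.length) + (1 + ((2 + r + l.length) + 1)) := by ring
  rw [hτ]
  refine Cmd.Det.seq (herm (.const 0) true st rfl rfl rfl rfl (fun _ => rfl) ?_) ?_
  -- The sign cell still holds its initial `0`, which the oracle reads as `+`, so the first query
  -- needs no preparation.
  · rw [hst.sign, h3]; simp [signOf, sgn]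
  rintro _ rfl
  refine Cmd.Det.seq (Cmd.det_setR (Q := fun s' => s' = _) _ _ _ _ rfl) ?_
  rintro _ rfl
  refine Cmd.Det.seq (herm (.const 1) false _ rfl rfl ?_ ?_ (fun j => ?_) ?_) ?_
  · rw [e1 _ _ _ _ _ (by decide), e1 _ _ _ _ _ (by decide)]
  · rw [e1 _ _ _ _ _ (by decide), e1 _ _ _ _ _ (by decide)]
  · simp [Store.setReal, setCell_apply, NExp.eval]
  · norm_num [Store.setReal, setCell_apply, NExp.eval, RExp.eval, signOf, sgn]
  rintro _ rfl
  refine Cmd.det_setR _ _ _ _ ?_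
  simp [Store.setReal, setCell_apply, NExp.eval, RExp.eval, hst.weight, h0, prediction]

lemma playoutCmd_rnd {L : ℝ} (hL : 0 < L) {T K s t a : ℕ} (hT : 0 < T)
    (hs : IsBlockLength T K s) (ha : min (t + 1) s = a) {s₀ : Store X}
    (hs₀ : Agrees s₀ s₀ 0 0 0 0 0) (hT₀ : s₀.nat 0 0 = T) (hK₀ : s₀.nat 0 1 = K)
    (ht₀ : s₀.nat 0 2 = t) (h0 : s₀.real 0 0 = L) (h3 : s₀.real 3 0 = 0) :
    playoutCmd.Rnd ℓ H s₀ (iidDraws (drawPair (a ^ 2 - 1)) (futureRounds a t))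
      (fun l s' => s'.real 0 1 = prediction H ℓ L (fun i => clamp (s₀.real 1 i))
        (blockStart a t) (blockStart a t + pastRounds a t)
        (l.map (toSigned (blockStart a t - a ^ 2))) (s₀.feat 2 0) (s₀.feat 0))
      (40 * (t + 1)) := by
  have ha0 : 0 < a := by have := hs.1; omega
  have hm : a ^ 2 - 1 + 1 = a ^ 2 := Nat.sub_add_cancel (Nat.pow_pos ha0)
  have hr : pastRounds a t ≤ t := by unfold pastRounds; split_ifs <;> omega
  -- Since `a` was capped at `t + 1`, the number of draws is bounded in terms of `t` alone.
  have hk : futureRounds a t ≤ t := by unfold futureRounds; split_ifs <;> omega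
  set r := pastRounds a t
  set k := futureRounds a t
  suffices h : playoutCmd.Rnd ℓ H s₀ (iidDraws (drawPair (a ^ 2 - 1)) k)
      (fun l s' => s'.real 0 1 = prediction H ℓ L (fun i => clamp (s₀.real 1 i))
        (blockStart a t) (blockStart a t + r)
        (l.map (toSigned (blockStart a t - a ^ 2))) (s₀.feat 2 0) (s₀.feat 0))
      ((1 + (t + 1) * 3) + ((1 + a * 2) + ((1 + t * 3) + (3 + ((1 + r * 3) + ((1 + k * 5) +
        (2 * (2 + r + k) + 2))))))) by
    obtain ⟨F, h1, h2⟩ := h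
    refine ⟨F, h1, fun l hl => ⟨(h2 l hl).1, (h2 l hl).2.trans ?_⟩⟩
    omega
  refine Cmd.Det.seq_rnd (blockLengthCmd_det hT hs s₀ s₀ hT₀ hK₀ ht₀ hs₀) fun st hst => ?_
  rw [ha] at hst
  refine Cmd.Det.seq_rnd (poolSizeCmd_det s₀ st hst) fun st hst => ?_
  refine Cmd.Det.seq_rnd (blockStartCmd_det ha0 s₀ st ht₀ hst) fun st hst => ?_
  refine Cmd.Det.seq_rnd (roundsCmd_det s₀ st ht₀ hst) fun st hst => ?_
  refine Cmd.Det.seq_rnd (copyCmd_det s₀ st hst) fun st hst => ?_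
  refine Cmd.Rnd.seq_det (drawCmd_rnd hm s₀ st hst) ?_
  rintro l st ⟨hl, hst, hP⟩
  have hlen : (l.map (toSigned (m := a ^ 2 - 1) (blockStart a t - a ^ 2))).length = k := by
    rw [List.length_map, hl]
  rw [← hlen] at hst ⊢
  exact predictCmd_det hL hst hP h0 h3

end

end Hybrid

/-! ### Correctness of the program, dimension zero, conclusion -/

namespace Hybrid

noncomputable section

variable {X : Type*} {ℓ : ℝ → ℝ → ℝ} {H : Set (X → I01)} {L : ℝ}

lemma clamp_coe (p : I01) : clamp p = p := Set.projIcc_val _ p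

lemma exists_isBlockLength {T K : ℕ} (hT : 1 ≤ T) (hK : 1 ≤ K) : ∃ s, IsBlockLength T K s := by
  classical
  have h : ∃ s, 0 < s ∧ T ^ 2 ≤ s ^ 5 * K ^ 2 := by
    refine ⟨T, hT, ?_⟩
    calc T ^ 2 ≤ T ^ 5 := Nat.pow_le_pow_right hT (by norm_num)
      _ ≤ T ^ 5 * K ^ 2 := Nat.le_mul_of_pos_right _ (Nat.pow_pos hK)
  refine ⟨Nat.find h, (Nat.find_spec h).1, (Nat.find_spec h).2, fun j hj hj0 => ?_⟩
  have := Nat.find_min h hj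
  push Not at this
  exact this hj0

lemma playoutCmd_run (hL : 0 < L) {T K s : ℕ} (hT : 0 < T) (hs : IsBlockLength T K s)
    (hist : List (X × I01)) (x : X) {a t : ℕ} (ht : hist.length = t) (ha : min (t + 1) s = a) :
    ∃ F : List (Fin (a ^ 2 - 1 + 1) × Fin 2) → Store X × ℕ,
      playoutCmd.run ℓ H T K L hist x =
        (iidDraws (drawPair (a ^ 2 - 1)) (futureRounds a t)).map F ∧
      ∀ l ∈ (iidDraws (drawPair (a ^ 2 - 1)) (futureRounds a t)).support,
        (F l).1.real 0 1 = prediction H ℓ L (labelSeq hist)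
          (blockStart a t) (blockStart a t + pastRounds a t)
          (l.map (toSigned (blockStart a t - a ^ 2))) x (featSeq x hist) ∧
        (F l).2 ≤ 40 * (t + 1) := by
  have hlabel : (fun i => clamp ((initStore T K L hist x).real 1 i)) = labelSeq hist := by
    funext i
    have : (initStore T K L hist x).real 1 i = labelSeq hist i := by
      simp only [initStore, labelSeq, one_ne_zero, if_false, if_true, List.getD_eq_getElem?_getD,
        List.getElem?_map]
      cases hist[i]? <;> simp
    rw [this, clamp_coe]
  have h := playoutCmd_rnd (ℓ := ℓ) (H := H) hL hT hs ha (s₀ := initStore T K L hist x)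
    (by constructor <;> simp [initStore]) (by simp [initStore]) (by simp [initStore])
    (by simp [initStore, ht]) (by simp [initStore]) (by simp [initStore])
  rw [hlabel] at h
  exact h

lemma playoutCmd_runsWithin (hL : 0 < L) {T K : ℕ} (hT : 1 ≤ T) (hK : 1 ≤ K) :
    playoutCmd.RunsWithin (Polynomial.C 40 * Polynomial.X) ℓ H T K L := by
  obtain ⟨s, hs⟩ := exists_isBlockLength hT hK
  intro hist x q hq
  obtain ⟨F, hF, h⟩ := playoutCmd_run (ℓ := ℓ) (H := H) hL hT hs hist x rfl rfl
  rw [hF, PMF.mem_support_map_iff] at hq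
  obtain ⟨l, hl, rfl⟩ := hq
  simpa using (h l hl).2

lemma pmfExp_playoutCmd_rule (hL : 0 < L) (hℓ : IsConvexLipschitzLoss ℓ L) {T K s : ℕ}
    (hT : 0 < T) (hs : IsBlockLength T K s) (hist : List (X × I01)) (x : X) (y : I01)
    {a t : ℕ} (ht : hist.length = t) (ha : min (t + 1) s = a) :
    pmfExp (playoutCmd.rule ℓ H T K L hist x) (fun p => ℓ p y) =
      avgDraws (Finset.Ico (blockStart a t - a ^ 2) (blockStart a t - a ^ 2 + a ^ 2))
        (futureRounds a t) fun l => ℓ (clamp (prediction H ℓ L (labelSeq hist)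
          (blockStart a t) (blockStart a t + pastRounds a t) l x (featSeq x hist))) y := by
  obtain ⟨F, hF, h⟩ := playoutCmd_run (ℓ := ℓ) (H := H) hL hT hs hist x ht ha
  obtain ⟨B, -, hB⟩ := exists_loss_bound hℓ
  have hB' : ∀ p : I01, |ℓ p y| ≤ B := fun p => by
    rw [abs_of_nonneg (hB p y).1]
    exact (hB p y).2
  have ha0 : 0 < a := by have := hs.1; omega
  have hm : a ^ 2 - 1 + 1 = a ^ 2 := Nat.sub_add_cancel (Nat.pow_pos ha0)
  rw [Cmd.rule, hF, PMF.map_comp, pmfExp_map _ _ hB']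
  refine (pmfExp_congr _ fun l hl => ?_).trans ((pmfExp_iidDraws (blockStart a t - a ^ 2)
    (a ^ 2 - 1) (futureRounds a t) (φ := fun l => ℓ (clamp (prediction H ℓ L (labelSeq hist)
      (blockStart a t) (blockStart a t + pastRounds a t) l x (featSeq x hist))) y)
      fun l => hB' _).trans (by rw [hm]))
  simp only [Function.comp_apply, (h l hl).1]

lemma isPlayoutRule_playoutCmd (hL : 0 < L) (hℓ : IsConvexLipschitzLoss ℓ L) {T K s : ℕ}
    (hT : 0 < T) (hs : IsBlockLength T K s) :
    IsPlayoutRule H ℓ L s (playoutCmd.rule ℓ H T K L) := by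
  intro x₀ hist x y ht
  -- Once the pool is full, `s ≤ s ^ 2 ≤ t`, so the truncated search has found the true block
  -- length.
  have ha : min (hist.length + 1) s = s := by
    refine min_eq_right ((Nat.le_self_pow two_ne_zero s).trans (ht.trans (Nat.le_succ _)))
  have hb := le_blockStart ht
  have hbt := blockStart_le s hist.length
  rw [pmfExp_playoutCmd_rule hL hℓ hT hs hist x y rfl ha, Nat.sub_add_cancel hb, futureRounds,
    if_pos ht, pastRounds, if_pos ht, Nat.add_sub_cancel' hbt]
  refine avgDraws_congr fun l _ hl => ?_
  have hω : ∀ i < hist.length, featSeq x hist i = featSeq x₀ hist i := fun i hi => by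
    simp [featSeq, List.getD_eq_getElem?_getD, hi]
  -- The program pads the history with `x` and the analysis with `x₀`; only rounds before the
  -- present one are read, where the two agree.
  rw [prediction_congr (fun i hi => hω i (Finset.mem_Ico.1 hi).2) (fun _ _ => rfl)
    fun p hp => hω _ ((lt_of_mem_pool (hl p hp)).trans_le hbt)]

section trivial

/-- Two different hypotheses disagree at some point, which is then shattered. For `d = 0` the
claimed bound is `0`, so the class must be seen to be a singleton. -/
lemma eq_of_vcDim_eq_zero (hB : BinaryValued H) (hd : vcDim H = (0 : ℕ)) {h h' : X → I01}
    (hh : h ∈ H) (hh' : h' ∈ H) : h = h' := by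
  classical
  by_contra hne
  obtain ⟨x, hx⟩ := Function.ne_iff.1 hne
  have key : ∃ g ∈ H, ∃ g' ∈ H, g x = 0 ∧ g' x = 1 := by
    rcases hB h hh x with h0 | h1 <;> rcases hB h' hh' x with h0' | h1'
    · exact absurd (h0.trans h0'.symm) hx
    · exact ⟨h, hh, h', hh', h0, h1'⟩
    · exact ⟨h', hh', h, hh, h0', h1⟩
    · exact absurd (h1.trans h1'.symm) hx
  obtain ⟨g, hg, g', hg', h0, h1⟩ := key
  have : Shatters H {x} := by
    intro A hA
    rcases Finset.subset_singleton_iff.1 hA with rfl | rfl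
    · exact ⟨g, hg, by simp [h0]⟩
    · exact ⟨g', hg', by simp [h1]⟩
  simpa using card_le_of_shatters hd this

lemma prediction_singleton (hL : 0 < L) (h : X → I01) (υ : ℕ → I01) (a b : ℕ)
    (l : List (ℕ × Bool)) (x : X) (ω : ℕ → X) : prediction {h} ℓ L υ a b l x ω = h x := by
  have : ∀ ε, minLossAt {h} ℓ L υ a b l ε x ω =
      perturbedLoss ℓ L υ a b l (fun i => h (ω i)) + L * (sgn ε * (h x : ℝ)) :=
    fun ε => ciInf_unique
  rw [prediction, this, this]
  simp only [sgn, Bool.false_eq_true, if_false, if_true]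
  field_simp
  ring

lemma minLoss_singleton (h : X → I01) (υ : ℕ → I01) (a b : ℕ) (l : List (ℕ × Bool))
    (ω : ℕ → X) : minLoss {h} ℓ L υ a b l ω = perturbedLoss ℓ L υ a b l fun i => h (ω i) :=
  ciInf_unique

/-- With one hypothesis the two oracle values differ by exactly `2 * L * h x`, so the program
predicts `h x` whatever it has drawn, even before the pool is full. Minus the cumulative loss of `h`
is then a potential preserved with equality. -/
lemma gameValue_singleton_le [MeasurableSpace X] (hL : 0 < L) (hℓ : IsConvexLipschitzLoss ℓ L)
    {T K s : ℕ} (hT : 0 < T) (hs : IsBlockLength T K s) (h : X → I01)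
    (μ : ℕ → ProbabilityMeasure X) :
    gameValue ℓ {h} (playoutCmd.rule ℓ {h} T K L) μ T [] 0 ≤ 0 := by
  obtain ⟨x₀⟩ := (μ 0 : Measure X).nonempty_of_neZero
  refine (gameValue_le (L := L) (Set.singleton_nonempty h) hℓ x₀ _ μ T
    (fun t ω υ => -minLoss {h} ℓ L υ 0 t [] ω) (fun ω υ => le_rfl) (fun hist _ => ?_)
    T [] (by simp) 0).trans ?_
  · refine ⟨fun _ => -minLoss {h} ℓ L (labelSeq hist) 0 hist.length [] (featSeq x₀ hist),
      integrable_const _, by simp, fun x y => le_of_eq ?_⟩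
    have ha0 : 0 < min (hist.length + 1) s := lt_min (Nat.succ_pos _) hs.1
    rw [pmfExp_playoutCmd_rule hL hℓ hT hs hist x y rfl rfl]
    simp only [prediction_singleton hL, clamp_coe]
    rw [avgDraws_const (Finset.nonempty_Ico.2 (Nat.lt_add_of_pos_right (Nat.pow_pos ha0))), minLoss_singleton, minLoss_singleton,
      perturbedLoss_update _ (Nat.zero_le _) (by simp)]
    ring
  · simp [minLoss_singleton, perturbedLoss]

end trivial

lemma gameValue_playoutCmd_le [MeasurableSpace X] (hH : H.Nonempty) (hB : BinaryValued H)
    (hTM : TraceMeasurable H) (hL : 0 < L) (hℓ : IsConvexLipschitzLoss ℓ L) {d : ℕ}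
    (hd : vcDim H = d) {T K : ℕ} (hT : 2 ≤ T) (hK : 1 ≤ K)
    (μ : ℕ → ProbabilityMeasure X) (hμ : AtMostChanges μ T K) :
    gameValue ℓ H (playoutCmd.rule ℓ H T K L) μ T [] 0 ≤
      40 * (L * Real.sqrt (d * Real.log (max 1 L * T))
        * (K : ℝ) ^ (1 / 5 : ℝ) * (T : ℝ) ^ (4 / 5 : ℝ)) := by
  have hT0 : 0 < T := by omega
  obtain ⟨s, hs⟩ := exists_isBlockLength (by omega : 1 ≤ T) hK
  rcases Nat.eq_zero_or_pos d with rfl | hd1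
  · obtain ⟨h, hh⟩ := hH
    obtain rfl : H = {h} := Set.eq_singleton_iff_unique_mem.2
      ⟨hh, fun h' hh' => eq_of_vcDim_eq_zero hB hd hh' hh⟩
    refine (gameValue_singleton_le hL hℓ hT0 hs h μ).trans ?_
    positivity
  · exact gameValue_le_of_isBlockLength hH hB hTM hL hℓ hd hd1 hT hK hs
      (isPlayoutRule_playoutCmd hL hℓ hT0 hs) μ hμ

end

end Hybrid

theorem mainTheorem7 :
    ∃ (P : Hybrid.Cmd) (p : Polynomial ℕ) (C : ℝ),
      ∀ (X : Type*) [MeasurableSpace X] (H : Set (X → Hybrid.I01)) (ℓ : ℝ → ℝ → ℝ) (L : ℝ)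
        (d T K : ℕ),
        H.Nonempty → Hybrid.BinaryValued H → Hybrid.TraceMeasurable H →
        Hybrid.vcDim H = (d : ℕ∞) →
        0 < L → Hybrid.IsConvexLipschitzLoss ℓ L →
        2 ≤ T → 1 ≤ K →
        P.RunsWithin p ℓ H T K L ∧
        Hybrid.minimaxRegret ℓ H (P.rule ℓ H T K L) T K ≤
          ((C * (L * Real.sqrt (d * Real.log (max 1 L * T))
            * (K : ℝ) ^ (1 / 5 : ℝ) * (T : ℝ) ^ (4 / 5 : ℝ)) : ℝ) : EReal) := by
  refine ⟨Hybrid.playoutCmd, Polynomial.C 40 * Polynomial.X, 40, ?_⟩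
  intro X _ H ℓ L d T K hH hB hTM hd hL hℓ hT hK
  refine ⟨Hybrid.playoutCmd_runsWithin hL (by omega) hK, ?_⟩
  refine iSup₂_le fun μ hμ => EReal.coe_le_coe_iff.2 ?_
  exact Hybrid.gameValue_playoutCmd_le hH hB hTM hL hℓ hd hT hK μ hμ
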